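/- Let $\mathcal N$ be a von Neumann algebra on a Hilbert space $\mathcal H$ with a faithful normal semifinite trace $\tau$, and let $(\mathcal A,\mathcal H,\mathcal D)$ be a unital odd semifinite spectral triple relative to $(\mathcal N,\tau)$: $\mathcal A\subset\mathcal N$ is a $*$-subalgebra containing the identity of $\mathcal N$, and $\mathcal D$ is a densely defined self-adjoint operator affiliated to $\mathcal N$ such that every $a\in\mathcal A$ preserves $\mathrm{dom}\,\mathcal D$ with $[\mathcal D,a]$ bounded, and $(\lambda-\mathcal D)^{-1}$ is $\tau$-compact for all $\lambda\notin\mathbf R$. Assume that the triple is $QC^\infty$: for all $a\in\mathcal A$, both $a$ and $[\mathcal D,a]$ lie in $\mathrm{dom}\,\delta^k$ for all $k$, where $\delta=[|\mathcal D|,\cdot\,]$. Assume that its spectral dimension $p=\inf\{k:\tau((1+\mathcal D^2)^{-k/2})<\infty\}$ is finite and $p\ge 1$, and let $N=\lfloor p/2\rfloor+1$. Fix $0<c<1/2$, let $l=\{c+iv:v\in\mathbf R\}$, and put $R_s(\lambda)=(\lambda-(1+s^2+\mathcal D^2))^{-1}$. For odd $m$ with $1\le m\le 2N-1$, $a_0,\dots,a_m\in\mathcal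 A$ and $r\in\mathbf C$ with $\mathrm{Re}(r)>(1-m)/2$ define $$\phi^r_m(a_0,\dots,a_m)=\frac{-2\sqrt{2\pi i}}{\Gamma((m+1)/2)}\int_0^\infty s^m\,\tau\Big(\frac1{2\pi i}\int_l\lambda^{-p/2-r}a_0R_s(\lambda)[\mathcal D,a_1]R_s(\lambda)\cdots[\mathcal D,a_m]R_s(\lambda)\,d\lambda\Big)ds ,$$ and for functionals $\phi$ on $\mathcal A^{m+2}$, respectively $\mathcal A^{m+1}$, define $$(B\phi)(a_0,\dots,a_m)=\sum_{j=0}^m(-1)^{mj}\phi(1,a_j,\dots,a_m,a_0,\dots,a_{j-1}),$$ $$(b\phi)(a_0,\dots,a_{m+1})=\sum_{j=0}^m(-1)^j\phi(a_0,\dots,a_ja_{j+1},\dots,a_{m+1})+(-1)^{m+1}\phi(a_{m+1}a_0,a_1,\dots,a_m).$$ Then: (0) For every odd $m$ with $1\le m\le 2N-1$ the functional $\phi^r_m$ is well defined for $\mathrm{Re}(r)>(1-m)/2$ (the $\lambda$-integral converges absolutely in operator norm to a $\tau$-trace class operator for each $s\ge0$, and the $s$-integral converges absolutely), and $r\mapsto\phi^r_m(a_0,\dots,a_m)$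 is holomorphic on this half-plane. (1) For $m=1,3,\dots,2N-3$, $\mathrm{Re}(r)>(1-m)/2$ and all $a_i\in\mathcal A$, $(B\phi^r_{m+2}+b\phi^r_m)(a_0,\dots,a_{m+1})=0$. (2) For $\mathrm{Re}(r)>0$ and $a_0\in\mathcal A$, $(B\phi^r_1)(a_0)=0$. (3) There is a $\delta'$ with $0<\delta'<1$ such that for all $a_0,\dots,a_{2N}\in\mathcal A$ the function $r\mapsto(b\phi^r_{2N-1})(a_0,\dots,a_{2N})$, defined for $\mathrm{Re}(r)>1-N$, is holomorphic for $\mathrm{Re}(r)>-p/2+\delta'/2$; that is, there is a holomorphic function on the half-plane $\mathrm{Re}(r)>-p/2+\delta'/2$ which agrees with it wherever both are defined. Thus $(\phi^r_m)_{m=1,\,\mathrm{odd}}^{2N-1}$ is a $(b,B)$-cocycle modulo functions holomorphic in the half-plane $\mathrm{Re}(r)>-p/2+\delta'/2$. -/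

import Mathlib

open scoped ENNReal

noncomputable section

namespace ResolventCocycle

variable {H : Type*} [NormedAddCommGroup H] [InnerProductSpace ℂ H] [CompleteSpace H]

/-! ### Traces on von Neumann algebras -/

/-- A faithful normal semifinite trace on the von Neumann algebra `M`, as a map on the positive cone
`M₊` with values in `[0, ∞]` (the values outside `M₊` are irrelevant and never used). -/
structure FNSTrace (M : VonNeumannAlgebra H) where
  /-- the underlying function, of which only the values on `M₊` matter -/
  toFun : (H →L[ℂ] H) → ℝ≥0∞
  map_add : ∀ x ∈ M, ∀ y ∈ M, 0 ≤ x → 0 ≤ y → toFun (x + y) = toFun x + toFun y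
  map_smul : ∀ t : ℝ, 0 ≤ t → ∀ x ∈ M, 0 ≤ x →
    toFun ((t : ℂ) • x) = ENNReal.ofReal t * toFun x
  tracial : ∀ x ∈ M, toFun (star x * x) = toFun (x * star x)
  faithful : ∀ x ∈ M, 0 ≤ x → toFun x = 0 → x = 0
  normal : ∀ S : Set (H →L[ℂ] H), S.Nonempty → DirectedOn (· ≤ ·) S →
    (∀ y ∈ S, y ∈ M ∧ 0 ≤ y) → ∀ x, IsLUB S x → toFun x = ⨆ y ∈ S, toFun y
  semifinite : ∀ x ∈ M, 0 ≤ x → x ≠ 0 → ∃ y ∈ M, 0 ≤ y ∧ y ≠ 0 ∧ y ≤ x ∧ toFun y < ∞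

variable {M : VonNeumannAlgebra H}

/-- `T ∈ 𝓛¹(M, τ)`: `T ∈ M` and `τ(|T|) < ∞`, where `|T| = (T* T)^{1/2}`. -/
def FNSTrace.MemL1 (τ : FNSTrace M) (T : H →L[ℂ] H) : Prop :=
  T ∈ M ∧ τ.toFun (CFC.abs T) < ∞

/-- The linear extension of `τ` to `𝓛¹(M, τ)`: the four positive operators are the positive and
negative parts of the real and imaginary parts of `T`. -/
def FNSTrace.trace (τ : FNSTrace M) (T : H →L[ℂ] H) : ℂ :=
  (((τ.toFun (realPart T : H →L[ℂ] H)⁺).toReal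
      - (τ.toFun (realPart T : H →L[ℂ] H)⁻).toReal : ℝ) : ℂ)
    + Complex.I * (((τ.toFun (imaginaryPart T : H →L[ℂ] H)⁺).toReal
      - (τ.toFun (imaginaryPart T : H →L[ℂ] H)⁻).toReal : ℝ) : ℂ)

/-- The `τ`-compact operators: the norm closed two-sided ideal of `M` generated by the projections
of `M` of finite trace. -/
def FNSTrace.compacts (τ : FNSTrace M) : Set (H →L[ℂ] H) :=
  closure (Submodule.span ℂ {T | ∃ x ∈ M, ∃ E ∈ M, ∃ y ∈ M,
    IsStarProjection E ∧ τ.toFun E < ∞ ∧ T = x * E * y} : Set (H →L[ℂ] H))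

/-! ### Unbounded operators -/

/-- The square `D²` on its natural domain `{x ∈ dom D : D x ∈ dom D}`. -/
def sq (D : H →ₗ.[ℂ] H) : H →ₗ.[ℂ] H where
  domain :=
    { carrier := {x | ∃ h : x ∈ D.domain, D ⟨x, h⟩ ∈ D.domain}
      add_mem' := by
        rintro x y ⟨hx, hx'⟩ ⟨hy, hy'⟩
        refine ⟨D.domain.add_mem hx hy, ?_⟩
        have : D ⟨x + y, D.domain.add_mem hx hy⟩ = D ⟨x, hx⟩ + D ⟨y, hy⟩ :=
          D.map_add ⟨x, hx⟩ ⟨y, hy⟩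
        rw [this]
        exact D.domain.add_mem hx' hy'
      zero_mem' := by
        refine ⟨D.domain.zero_mem, ?_⟩
        have : D ⟨0, D.domain.zero_mem⟩ = 0 := D.map_zero
        rw [this]
        exact D.domain.zero_mem
      smul_mem' := by
        rintro t x ⟨hx, hx'⟩
        refine ⟨D.domain.smul_mem t hx, ?_⟩
        have : D ⟨t • x, D.domain.smul_mem t hx⟩ = t • D ⟨x, hx⟩ := D.map_smul t ⟨x, hx⟩
        rw [this]
        exact D.domain.smul_mem t hx' }
  toFun :=
    { toFun := fun x => D ⟨D ⟨x, x.2.fst⟩, x.2.snd⟩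
      map_add' := by
        intro x y
        rw [← D.map_add]
        congr 1
        apply Subtype.ext
        exact D.map_add ⟨x, x.2.fst⟩ ⟨y, y.2.fst⟩
      map_smul' := by
        intro t x
        rw [RingHom.id_apply, ← D.map_smul]
        congr 1
        apply Subtype.ext
        exact D.map_smul t ⟨x, x.2.fst⟩ }

/-- `T = (z - S)⁻¹`: the bounded operator `T` is a two-sided inverse of `z - S`. -/
def IsResolventAt (S : H →ₗ.[ℂ] H) (z : ℂ) (T : H →L[ℂ] H) : Prop :=
  (∀ x : H, ∃ h : T x ∈ S.domain, z • T x - S ⟨T x, h⟩ = x) ∧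
    ∀ y : S.domain, T (z • (y : H) - S y) = y

open Classical in
/-- The (unique) bounded inverse `(z - S)⁻¹`, for `z` in the resolvent set of `S`. -/
def resolventOp (S : H →ₗ.[ℂ] H) (z : ℂ) : H →L[ℂ] H :=
  if h : ∃ T, IsResolventAt S z T then h.choose else 0

/-- `C = [D, T]`: `T` preserves `dom D`, and the bounded operator `C` extends `D T - T D`. -/
def IsCommutator (D : H →ₗ.[ℂ] H) (T C : H →L[ℂ] H) : Prop :=
  ∀ x : D.domain, ∃ h : T x ∈ D.domain, D ⟨T x, h⟩ - T (D x) = C x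

open Classical in
/-- The bounded extension of `[D, T]` (unique when `D` is densely defined), if there is one. -/
def comm (D : H →ₗ.[ℂ] H) (T : H →L[ℂ] H) : H →L[ℂ] H :=
  if h : ∃ C, IsCommutator D T C then h.choose else 0

/-- `D` is affiliated to `M`: `T D ⊆ D T` for all `T` in the commutant of `M`. -/
def IsAffiliated (M : VonNeumannAlgebra H) (D : H →ₗ.[ℂ] H) : Prop :=
  ∀ T ∈ M.commutant, ∀ x : D.domain, ∃ h : T x ∈ D.domain, D ⟨T x, h⟩ = T (D x)

/-- `P = |D|`: `P` is the positive self-adjoint operator with `P² = D²`. -/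
def IsAbs (D P : H →ₗ.[ℂ] H) : Prop :=
  IsSelfAdjoint P ∧ (∀ x : P.domain, 0 ≤ (inner ℂ (P x) (x : H)).re) ∧ sq P = sq D

/-- `T` is in the domain of the `n`-th power of the derivation `δ = [P, ·]`. -/
def MemDomDelta (P : H →ₗ.[ℂ] H) : ℕ → (H →L[ℂ] H) → Prop
  | 0, _ => True
  | n + 1, T => ∃ C, IsCommutator P T C ∧ MemDomDelta P n C

/-! ### Semifinite spectral triples -/

/-- `(𝓐, H, D)` is a unital (odd) semifinite spectral triple relative to `(M, τ)`. -/
structure IsSpectralTriple (M : VonNeumannAlgebra H) (τ : FNSTrace M)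
    (𝓐 : StarSubalgebra ℂ (H →L[ℂ] H)) (D : H →ₗ.[ℂ] H) : Prop where
  alg_le : ∀ a ∈ 𝓐, a ∈ M
  dense : Dense (D.domain : Set H)
  selfAdjoint : IsSelfAdjoint D
  affiliated : IsAffiliated M D
  bounded_comm : ∀ a ∈ 𝓐, ∃ C, IsCommutator D a C
  compact_resolvent : ∀ z : ℂ, z.im ≠ 0 → ∃ T ∈ τ.compacts, IsResolventAt D z T

/-- The triple is `QC^∞`: `a` and `[D, a]` lie in `dom δⁿ` for all `a ∈ 𝓐` and all `n`, where
`δ = [|D|, ·]`. -/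
def IsQCInfty (𝓐 : StarSubalgebra ℂ (H →L[ℂ] H)) (D : H →ₗ.[ℂ] H) : Prop :=
  ∃ P, IsAbs D P ∧ ∀ a ∈ 𝓐, ∀ n, MemDomDelta P n a ∧ MemDomDelta P n (comm D a)

/-- The bounded operator `(1 + D²)^{-k/2} = ((1 + D²)⁻¹)^{k/2}`, for real `k ≥ 0`. -/
def invPow (D : H →ₗ.[ℂ] H) (k : ℝ) : H →L[ℂ] H :=
  CFC.rpow (-resolventOp (sq D) (-1)) (k / 2)

/-- `p = inf {k : τ((1 + D²)^{-k/2}) < ∞}` is the spectral dimension (the set has to be non-empty).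
For `p > 0` it does not matter whether negative `k` are admitted, since `(1 + D²)^{-k/2} ≥ 1` for
them. -/
def IsSpectralDimension (τ : FNSTrace M) (D : H →ₗ.[ℂ] H) (p : ℝ) : Prop :=
  IsGLB {k : ℝ | 0 ≤ k ∧ τ.toFun (invPow D k) < ∞} p

/-! ### The operators `b` and `B` -/

/-- Complex functionals of `m + 1` variables from `𝓐`. -/
abbrev Cochain (𝓐 : StarSubalgebra ℂ (H →L[ℂ] H)) (m : ℕ) : Type _ :=
  (Fin (m + 1) → 𝓐) → ℂ

variable {𝓐 : StarSubalgebra ℂ (H →L[ℂ] H)}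

/-- `(Bφ)(a₀,…,a_m) = ∑_{j=0}^m (-1)^{mj} φ(1, a_j, …, a_m, a₀, …, a_{j-1})`
(addition in `Fin (m + 1)` is cyclic). -/
def opB {m : ℕ} (φ : Cochain 𝓐 (m + 1)) : Cochain 𝓐 m := fun a =>
  ∑ j : Fin (m + 1), (-1 : ℂ) ^ (m * (j : ℕ)) *
    φ (Fin.cons 1 fun i : Fin (m + 1) => a (j + i))

/-- `(bφ)(a₀,…,a_{m+1}) = ∑_{j=0}^m (-1)^j φ(a₀, …, a_j a_{j+1}, …, a_{m+1})
+ (-1)^{m+1} φ(a_{m+1} a₀, a₁, …, a_m)`. -/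
def opb {m : ℕ} (φ : Cochain 𝓐 m) : Cochain 𝓐 (m + 1) := fun a =>
  (∑ j : Fin (m + 1), (-1 : ℂ) ^ (j : ℕ) * φ (Fin.contractNth j.castSucc (· * ·) a))
    + (-1 : ℂ) ^ (m + 1) *
      φ (Fin.cons (a (Fin.last (m + 1)) * a 0) fun i : Fin m => a i.succ.castSucc)

/-! ### The resolvent cochain -/

/-- `R_s(λ) = (λ - (1 + s² + D²))⁻¹`. -/
def R (D : H →ₗ.[ℂ] H) (s : ℝ) (l : ℂ) : H →L[ℂ] H :=
  resolventOp (sq D) (l - (1 + (s : ℂ) ^ 2))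

/-- The product `a₀ R_s(λ) [D, a₁] R_s(λ) ⋯ [D, a_m] R_s(λ)`. -/
def resolventProd (D : H →ₗ.[ℂ] H) {m : ℕ} (a : Fin (m + 1) → 𝓐) (s : ℝ) (l : ℂ) : H →L[ℂ] H :=
  (List.ofFn fun i : Fin (m + 1) =>
    (Fin.cons (a 0 : H →L[ℂ] H) (fun j : Fin m => comm D (a j.succ)) :
      Fin (m + 1) → (H →L[ℂ] H)) i * R D s l).prod

/-- The integrand on the line `λ = c + i v`, with respect to `dv`
(so `dλ = i dv`, and `λ^z` is the principal branch). -/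
def lineIntegrand (D : H →ₗ.[ℂ] H) (p c : ℝ) (r : ℂ) {m : ℕ} (a : Fin (m + 1) → 𝓐) (s v : ℝ) :
    H →L[ℂ] H :=
  (((c : ℂ) + v * Complex.I) ^ (-(p : ℂ) / 2 - r) * Complex.I) •
    resolventProd D a s ((c : ℂ) + v * Complex.I)

/-- `(2πi)⁻¹ ∫_l λ^{-p/2-r} a₀ R_s(λ) [D, a₁] R_s(λ) ⋯ [D, a_m] R_s(λ) dλ`, an integral in the
operator norm over `l = {c + i v : v ∈ ℝ}`. -/
def lineIntegral (D : H →ₗ.[ℂ] H) (p c : ℝ) (r : ℂ) {m : ℕ} (a : Fin (m + 1) → 𝓐) (s : ℝ) :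
    H →L[ℂ] H :=
  (2 * (Real.pi : ℂ) * Complex.I)⁻¹ • ∫ v : ℝ, lineIntegrand D p c r a s v

/-- `C(m) = -2 √(2πi) / Γ((m + 1)/2)`. -/
def constC (m : ℕ) : ℂ :=
  -2 * (2 * (Real.pi : ℂ) * Complex.I) ^ (1 / 2 : ℂ) / Complex.Gamma (((m : ℂ) + 1) / 2)

/-- The resolvent cochain: `φ^r_m(a₀,…,a_m)` is `C(m)` times the integral over `s ∈ (0, ∞)` of `s^m`
times the trace of the line integral; it is meant for `Re r > (1 - m)/2`. -/
def phi (τ : FNSTrace M) (𝓐 : StarSubalgebra ℂ (H →L[ℂ] H)) (D : H →ₗ.[ℂ] H) (p c : ℝ) (r : ℂ)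
    (m : ℕ) : Cochain 𝓐 m := fun a =>
  constC m * ∫ s in Set.Ioi (0 : ℝ), (s : ℂ) ^ m * τ.trace (lineIntegral D p c r a s)

/-- All integrals and the trace in the definition of `φ^r_m(a₀,…,a_m)` exist. -/
def PhiConverges (τ : FNSTrace M) (D : H →ₗ.[ℂ] H) (p c : ℝ) (r : ℂ) {m : ℕ}
    (a : Fin (m + 1) → 𝓐) : Prop :=
  (∀ s : ℝ, 0 ≤ s → MeasureTheory.Integrable (lineIntegrand D p c r a s) ∧
    τ.MemL1 (lineIntegral D p c r a s)) ∧
  MeasureTheory.IntegrableOn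
    (fun s : ℝ => (s : ℂ) ^ m * τ.trace (lineIntegral D p c r a s)) (Set.Ioi 0)

end ResolventCocycle

end

noncomputable section

namespace ResolventCocycle

set_option linter.unusedSectionVars false

section

variable {H : Type*} [NormedAddCommGroup H] [InnerProductSpace ℂ H] [CompleteSpace H]
variable {M : VonNeumannAlgebra H}

/-! ### Von Neumann algebras -/

/-! Everything is reduced to scalar integrals built from the heat semigroup h(t) = e^{-t(1+D²)}.
Since R_s(λ) = -∫₀^∞ e^{(λ-s²)t} h(t) dt, a product of n factors bᵢ R_s(λ) is (-1)^n times the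
integral of e^{(λ-s²)σ} b₀h(t₀)b₁h(t₁)⋯ over the positive orthant, where σ = ∑ tᵢ (`prod_R_eq`). The
λ-integral of λ^{-z} e^{λσ} is an inverse Laplace transform and yields σ^{z-1}/Γ(z)
(`integral_line_cpow`, `lineInt_eq`). The s-integral of s^m e^{-s²σ} yields σ^{-(m+1)/2}
Γ((m+1)/2)/2, and this Gamma factor is the one in the normalization of the cochain. With z = p/2 + r
the cochain is therefore, up to sign and a constant independent of m, 1/Γ(z) times ∫ σ^{z-1-(m+1)/2}
τ(a₀h(t₀)[D,a₁]h(t₁)⋯) dt (`phi_eq`). Some tᵢ is at least σ/n, and τ(h(t)) = O(t^{-q}) as t → 0 for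
every q > p/2. So the trace is O(σ^{-q} e^{-σ/2}), which gives convergence and holomorphy on the
stated half-planes.

For B, an entry 1 lets two neighbouring heat operators merge under the trace. Merging weights one
variable by its length, and the sum over cyclic permutations turns the weights into a factor σ
(`sum_traceInt_cons_one`). For b, the identity [R,a] = DR[D,a]R + R[D,a]DR makes the Hochschild sum
telescope to a commutator with D plus the product [D,a₀]R⋯[D,a_{m+1}]R. The commutator has trace
zero once it is regularized by heat operators (`hochschild_telescope`, `trace_boundary`). Both
operations thus produce the same integral, with opposite signs (`opB_phi`, `opb_phi`). In lowest
degree the integral vanishes because τ([D,a]h(t)) = 0. In top degree the formula for b has one more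
heat operator than the cochain, so it converges on a half-plane further to the left, which gives the
holomorphic remainder.

The trace is only a normal weight on the positive cone, so its linear extension, its ideal and the
bound |τ(WT)| ≤ ‖W‖K are developed first. Interchanging the trace with operator norm integrals
(`integral_traceBound`) uses τ(E_n ·), with E_n of finite trace increasing to the identity, and then
dominated convergence. -/

theorem vN_mem_of_commute {x : H →L[ℂ] H} (h : ∀ y ∈ M.commutant, y * x = x * y) : x ∈ M := by
  rw [← M.commutant_commutant]
  exact VonNeumannAlgebra.mem_commutant_iff.2 h

theorem vN_commute {x y : H →L[ℂ] H} (hx : x ∈ M) (hy : y ∈ M.commutant) : Commute x y :=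
  VonNeumannAlgebra.mem_commutant_iff.1 hy x hx

theorem vN_smul_mem (c : ℂ) {x : H →L[ℂ] H} (hx : x ∈ M) : c • x ∈ M :=
  M.toStarSubalgebra.smul_mem hx c

theorem vN_rsmul_mem (c : ℝ) {x : H →L[ℂ] H} (hx : x ∈ M) : c • x ∈ M := by
  have := vN_smul_mem (c : ℂ) hx
  rwa [Complex.coe_smul] at this

theorem vN_cfc_mem (f : ℝ → ℝ) {x : H →L[ℂ] H} (hx : x ∈ M) : cfc f x ∈ M :=
  vN_mem_of_commute fun _ hy => ((vN_commute hx hy).cfc_real f).eq.symm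

theorem vN_cfcₙ_mem (f : ℝ → ℝ) {x : H →L[ℂ] H} (hx : x ∈ M) : cfcₙ f x ∈ M :=
  vN_mem_of_commute fun _ hy => ((vN_commute hx hy).cfcₙ_real f).eq.symm

theorem vN_posPart_mem {x : H →L[ℂ] H} (hx : x ∈ M) : x⁺ ∈ M := vN_cfcₙ_mem _ hx

theorem vN_negPart_mem {x : H →L[ℂ] H} (hx : x ∈ M) : x⁻ ∈ M := vN_cfcₙ_mem _ hx

theorem vN_sqrt_mem {x : H →L[ℂ] H} (hx : x ∈ M) : CFC.sqrt x ∈ M :=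
  vN_mem_of_commute fun _ hy => ((vN_commute hx hy).cfcₙ_nnreal _).eq.symm

theorem vN_abs_mem {x : H →L[ℂ] H} (hx : x ∈ M) : CFC.abs x ∈ M :=
  vN_sqrt_mem (mul_mem (star_mem hx) hx)

theorem vN_realPart_mem {x : H →L[ℂ] H} (hx : x ∈ M) : (realPart x : H →L[ℂ] H) ∈ M := by
  rw [realPart_apply_coe]
  exact vN_rsmul_mem _ (add_mem hx (star_mem hx))

theorem vN_imaginaryPart_mem {x : H →L[ℂ] H} (hx : x ∈ M) :
    (imaginaryPart x : H →L[ℂ] H) ∈ M := by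
  rw [imaginaryPart_apply_coe]
  exact vN_smul_mem _ (vN_rsmul_mem _ (sub_mem hx (star_mem hx)))

/-! ### The trace on the positive cone -/

namespace FNSTrace

variable (τ : FNSTrace M)

theorem mono {x y : H →L[ℂ] H} (hx : x ∈ M) (hy : y ∈ M) (h0 : 0 ≤ x) (h : x ≤ y) :
    τ.toFun x ≤ τ.toFun y := by
  have := τ.map_add x hx (y - x) (sub_mem hy hx) h0 (sub_nonneg.2 h)
  rw [add_sub_cancel] at this
  rw [this]
  exact le_self_add

theorem map_rsmul {t : ℝ} (ht : 0 ≤ t) {x : H →L[ℂ] H} (hx : x ∈ M) (h0 : 0 ≤ x) :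
    τ.toFun (t • x) = ENNReal.ofReal t * τ.toFun x := by
  rw [← Complex.coe_smul]
  exact τ.map_smul t ht x hx h0

theorem map_zero : τ.toFun 0 = 0 := by
  have := τ.map_smul 0 le_rfl 0 (zero_mem M) le_rfl
  simpa using this

/-- Conjugation by a bounded operator. -/
theorem conj_le {x c : H →L[ℂ] H} (hx : x ∈ M) (h0 : 0 ≤ x) (hc : c ∈ M) :
    τ.toFun (star c * x * c) ≤ ENNReal.ofReal (‖c‖ ^ 2) * τ.toFun x := by
  set y := CFC.sqrt x with hy
  have hyM : y ∈ M := vN_sqrt_mem hx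
  have hys : star y = y := (IsSelfAdjoint.of_nonneg (CFC.sqrt_nonneg x)).star_eq
  have hyy : y * y = x := CFC.sqrt_mul_sqrt_self x
  have e1 : star c * x * c = star (y * c) * (y * c) := by
    rw [star_mul, hys, ← hyy]; simp only [mul_assoc]
  have e2 : (y * c) * star (y * c) = star y * (c * star c) * y := by
    rw [star_mul, hys]; simp only [mul_assoc]
  -- Traciality exchanges c*xc = (yc)*(yc), where y = √x, for y(cc*)y, and this is at most ‖c‖²y² =
  -- ‖c‖²x.
  rw [e1, τ.tracial _ (mul_mem hyM hc), e2, ← τ.map_rsmul (sq_nonneg _) hx h0]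
  refine τ.mono (mul_mem (mul_mem (star_mem hyM) (mul_mem hc (star_mem hc))) hyM)
    (vN_rsmul_mem _ hx) ?_ ?_
  · exact star_left_conjugate_nonneg (mul_star_self_nonneg c) y
  · calc star y * (c * star c) * y ≤ star y * (algebraMap ℝ (H →L[ℂ] H) (‖c‖ ^ 2)) * y :=
          star_left_conjugate_le_conjugate CStarAlgebra.mul_star_le_algebraMap_norm_sq y
      _ = (‖c‖ ^ 2) • x := by
          rw [hys, Algebra.algebraMap_eq_smul_one, mul_smul_comm, mul_one, smul_mul_assoc, hyy]

/-- Normality for increasing sequences that converge weakly. -/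
theorem iSup_eq_of_tendsto {S : ℕ → H →L[ℂ] H} (hS : ∀ n, S n ∈ M) (h0 : ∀ n, 0 ≤ S n)
    (hmono : Monotone S) {T : H →L[ℂ] H}
    (hT : ∀ x, Filter.Tendsto (fun n => S n x) Filter.atTop (nhds (T x))) :
    (∀ n, S n ≤ T) ∧ τ.toFun T = ⨆ n, τ.toFun (S n) := by
  have hin : ∀ x, Filter.Tendsto (fun n => (S n).reApplyInnerSelf x) Filter.atTop
      (nhds (T.reApplyInnerSelf x)) := fun x => by
    simp only [ContinuousLinearMap.reApplyInnerSelf_apply]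
    exact (Complex.continuous_re.tendsto _).comp ((hT x).inner tendsto_const_nhds)
  have hsym : ∀ n, ((S n : H →L[ℂ] H) : H →ₗ[ℂ] H).IsSymmetric := fun n =>
    ((ContinuousLinearMap.nonneg_iff_isPositive _).1 (h0 n)).isSymmetric
  have hTs : ((T : H →L[ℂ] H) : H →ₗ[ℂ] H).IsSymmetric := fun x y => by
    have h1 : Filter.Tendsto (fun n => inner ℂ (S n x) y) Filter.atTop (nhds (inner ℂ (T x) y)) :=
      (hT x).inner tendsto_const_nhds
    have h2 : Filter.Tendsto (fun n => inner ℂ x (S n y)) Filter.atTop (nhds (inner ℂ x (T y))) :=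
      tendsto_const_nhds.inner (hT y)
    refine tendsto_nhds_unique h1 (h2.congr fun n => ?_)
    exact (hsym n x y).symm
  have hle : ∀ n, S n ≤ T := fun n => by
    rw [ContinuousLinearMap.le_def]
    refine ⟨by simpa using hTs.sub (hsym n), fun x => ?_⟩
    have : (S n).reApplyInnerSelf x ≤ T.reApplyInnerSelf x := by
      refine ge_of_tendsto (hin x) ?_
      filter_upwards [Filter.eventually_ge_atTop n] with k hk
      have := ((ContinuousLinearMap.le_def _ _).1 (hmono hk)).2 x
      simp only [ContinuousLinearMap.reApplyInnerSelf_apply, sub_apply,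
        inner_sub_left, map_sub] at this ⊢
      linarith
    simp only [ContinuousLinearMap.reApplyInnerSelf_apply, sub_apply,
        inner_sub_left, map_sub] at this ⊢
    linarith
  refine ⟨hle, ?_⟩
  -- An increasing sequence with a strong limit has that limit as its least upper bound, so
  -- normality applies to its range.
  have := τ.normal (Set.range S) (Set.range_nonempty S) (directedOn_range.2 hmono.directed_le)
    (by rintro _ ⟨n, rfl⟩; exact ⟨hS n, h0 n⟩) T ?_
  · rw [this, iSup_range]
  · refine ⟨by rintro _ ⟨n, rfl⟩; exact hle n, fun U hU => ?_⟩
    rw [ContinuousLinearMap.le_def]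
    have hSU : ∀ n, S n ≤ U := fun n => hU ⟨n, rfl⟩
    have hUs : (U : H →ₗ[ℂ] H).IsSymmetric :=
      ((ContinuousLinearMap.nonneg_iff_isPositive _).1 ((h0 0).trans (hSU 0))).isSymmetric
    refine ⟨by simpa using hUs.sub hTs, fun x => ?_⟩
    have : T.reApplyInnerSelf x ≤ U.reApplyInnerSelf x := by
      refine le_of_tendsto (hin x) (Filter.Eventually.of_forall fun n => ?_)
      have := ((ContinuousLinearMap.le_def _ _).1 (hSU n)).2 x
      simp only [ContinuousLinearMap.reApplyInnerSelf_apply, sub_apply,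
        inner_sub_left, map_sub] at this ⊢
      linarith
    simp only [ContinuousLinearMap.reApplyInnerSelf_apply, sub_apply,
        inner_sub_left, map_sub] at this ⊢
    linarith

end FNSTrace

end

section

variable {H : Type*} [NormedAddCommGroup H] [InnerProductSpace ℂ H] [CompleteSpace H]
variable {M : VonNeumannAlgebra H}

namespace FNSTrace

variable (τ : FNSTrace M)

/-! ### Continuity of the trace under functional calculus -/

/-- Normality replaces continuity of the trace: an increasing sequence of functions that converges
uniformly on the spectrum gives increasing operators, so the trace of the limit is the supremum of
the traces. -/
theorem cfc_le_of_approx {x : H →L[ℂ] H} (hx : x ∈ M) {f : ℕ → ℝ → ℝ}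
    {g : ℝ → ℝ} (hf : ∀ n, ContinuousOn (f n) (spectrum ℝ x))
    (h0 : ∀ n, ∀ t ∈ spectrum ℝ x, 0 ≤ f n t)
    (hmono : ∀ t ∈ spectrum ℝ x, Monotone fun n => f n t)
    (hlim : TendstoUniformlyOn f g Filter.atTop (spectrum ℝ x)) {C : ℝ≥0∞}
    (hC : ∀ n, τ.toFun (cfc (f n) x) ≤ C) : τ.toFun (cfc g x) ≤ C := by
  have ht : Filter.Tendsto (fun n => cfc (f n) x) Filter.atTop (nhds (cfc g x)) :=
    tendsto_cfc_fun hlim (Filter.Eventually.of_forall hf)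
  have := τ.iSup_eq_of_tendsto (S := fun n => cfc (f n) x) (T := cfc g x)
    (fun n => vN_cfc_mem _ hx) (fun n => cfc_nonneg (h0 n))
    (fun m n hmn => cfc_mono (fun t ht => hmono t ht hmn) (hf m) (hf n))
    (fun y => ((ContinuousLinearMap.apply ℂ H y).continuous.tendsto _).comp ht)
  rw [this.2]
  exact iSup_le hC

theorem tendstoUniformlyOn_of_le {f : ℕ → ℝ → ℝ} {g : ℝ → ℝ} {s : Set ℝ} {C : ℝ}
    (h : ∀ n, ∀ t ∈ s, |g t - f n t| ≤ C * (1 / ((n : ℝ) + 1))) :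
    TendstoUniformlyOn f g Filter.atTop s := by
  rw [Metric.tendstoUniformlyOn_iff]
  intro ε hε
  have : Filter.Tendsto (fun n : ℕ => C * (1 / ((n : ℝ) + 1))) Filter.atTop (nhds (C * 0)) :=
    tendsto_one_div_add_atTop_nhds_zero_nat.const_mul C
  rw [mul_zero] at this
  filter_upwards [this.eventually_lt_const hε] with n hn t ht
  rw [Real.dist_eq]
  exact (h n t ht).trans_lt hn

theorem posPart_eq_cfc (x : H →L[ℂ] H) : x⁺ = cfc (fun t : ℝ => t⁺) x := by
  rw [CFC.posPart_def, cfcₙ_eq_cfc]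

/-- A smooth approximation of the indicator function of `(0, ∞)`. -/
def cutoff (n : ℕ) (t : ℝ) : ℝ := t⁺ / (t⁺ + 1 / ((n : ℝ) + 1))

theorem posPart_add_pos (n : ℕ) (t : ℝ) : 0 < t⁺ + 1 / ((n : ℝ) + 1) :=
  add_pos_of_nonneg_of_pos (posPart_nonneg t) Nat.one_div_pos_of_nat

theorem continuous_real_posPart : Continuous fun t : ℝ => t⁺ := by
  simp only [posPart_def]; exact continuous_id.sup continuous_const

theorem continuous_cutoff (n : ℕ) : Continuous (cutoff n) :=
  continuous_real_posPart.div (continuous_real_posPart.add continuous_const)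
    fun t => (posPart_add_pos n t).ne'

theorem cutoff_nonneg (n : ℕ) (t : ℝ) : 0 ≤ cutoff n t :=
  div_nonneg (posPart_nonneg t) (posPart_add_pos n t).le

theorem cutoff_le_one (n : ℕ) (t : ℝ) : cutoff n t ≤ 1 :=
  (div_le_one (posPart_add_pos n t)).2 (le_add_of_nonneg_right Nat.one_div_pos_of_nat.le)

theorem cutoff_mul (n : ℕ) (t : ℝ) : cutoff n t * t = cutoff n t * t⁺ := by
  rcases le_total 0 t with h | h
  · rw [posPart_of_nonneg h]
  · simp only [cutoff, posPart_of_nonpos h, zero_div, zero_mul]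

theorem cutoff_mono (t : ℝ) : Monotone fun n => cutoff n t := fun m n hmn => by
  refine div_le_div_of_nonneg_left (posPart_nonneg t) (posPart_add_pos n t) ?_
  exact add_le_add le_rfl (Nat.one_div_le_one_div hmn)

/-- The difference equals `cutoff n t` divided by n + 1, so `cutoff n t * t` converges to t⁺
uniformly in t. -/
theorem posPart_sub_cutoff_mul (n : ℕ) (t : ℝ) :
    0 ≤ t⁺ - cutoff n t * t⁺ ∧ t⁺ - cutoff n t * t⁺ ≤ 1 / ((n : ℝ) + 1) := by
  have hd : (0 : ℝ) < 1 / ((n : ℝ) + 1) := Nat.one_div_pos_of_nat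
  have hp := posPart_add_pos n t
  have : t⁺ - cutoff n t * t⁺ = (1 / ((n : ℝ) + 1)) * cutoff n t := by
    simp only [cutoff]; field_simp; ring
  rw [this]
  exact ⟨mul_nonneg hd.le (cutoff_nonneg n t), mul_le_of_le_one_right hd.le (cutoff_le_one n t)⟩

/-- If `x = a - b` with `a, b ≥ 0`, then `τ(x⁺) ≤ τ(a)`. -/
theorem posPart_le {a b : H →L[ℂ] H} (ha : a ∈ M) (hb : b ∈ M) (ha0 : 0 ≤ a) (hb0 : 0 ≤ b) :
    τ.toFun (a - b)⁺ ≤ τ.toFun a := by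
  set x := a - b with hx
  have hxM : x ∈ M := sub_mem ha hb
  have hw := continuous_cutoff
  have hw0 := cutoff_nonneg
  have hw1 := cutoff_le_one
  have hwt := cutoff_mul
  rw [posPart_eq_cfc]
  -- The cutoff w appears on both sides so that the approximant is the conjugate w(x) x w(x). It is
  -- bounded by w(x) a w(x), whose trace is at most τ(a) since ‖w(x)‖ ≤ 1.
  refine τ.cfc_le_of_approx (f := fun n t => cutoff n t * t * cutoff n t) hxM
    (fun n => (((hw n).mul continuous_id).mul (hw n)).continuousOn) ?_ ?_ ?_ ?_
  · intro n t _
    simp only [hwt]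
    exact mul_nonneg (mul_nonneg (hw0 n t) (posPart_nonneg t)) (hw0 n t)
  · intro t _ m n hmn
    simp only [hwt]
    have : cutoff m t ≤ cutoff n t := cutoff_mono t hmn
    have h1 := posPart_nonneg t
    have h2 := hw0 m t
    gcongr
    exact mul_nonneg (hw0 n t) h1
  · refine tendstoUniformlyOn_of_le (C := 2) fun n t _ => ?_
    simp only [hwt]
    obtain ⟨h4, h3⟩ := posPart_sub_cutoff_mul n t
    have h5 : t⁺ - cutoff n t * t⁺ * cutoff n t = (t⁺ - cutoff n t * t⁺) * (1 + cutoff n t) := by ring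
    rw [h5, abs_of_nonneg (mul_nonneg h4 (by linarith [hw0 n t]))]
    nlinarith [hw1 n t, hw0 n t]
  · intro n
    have hwM : cfc (cutoff n) x ∈ M := vN_cfc_mem _ hxM
    have hws : star (cfc (cutoff n) x) = cfc (cutoff n) x := (cfc_predicate (cutoff n) x : IsSelfAdjoint _)
    have e1 : cfc (fun t => cutoff n t * t * cutoff n t) x = star (cfc (cutoff n) x) * x * cfc (cutoff n) x := by
      rw [cfc_mul (fun t => cutoff n t * t) (cutoff n) x (((hw n).mul continuous_id).continuousOn)
        (hw n).continuousOn, cfc_mul (cutoff n) (fun t => t) x (hw n).continuousOn continuousOn_id,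
        cfc_id' ℝ x, hws]
    have h0 : 0 ≤ cfc (fun t => cutoff n t * t * cutoff n t) x := cfc_nonneg fun t _ => by
      simp only [hwt]
      exact mul_nonneg (mul_nonneg (hw0 n t) (posPart_nonneg t)) (hw0 n t)
    rw [e1] at h0 ⊢
    refine (τ.mono (mul_mem (mul_mem (star_mem hwM) hxM) hwM)
      (mul_mem (mul_mem (star_mem hwM) ha) hwM) h0 (star_left_conjugate_le_conjugate
        (sub_le_self a hb0) _)).trans ((τ.conj_le ha ha0 hwM).trans ?_)
    refine mul_le_of_le_one_left' ?_
    rw [← ENNReal.ofReal_one]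
    refine ENNReal.ofReal_le_ofReal ?_
    have : ‖cfc (cutoff n) x‖ ≤ 1 := norm_cfc_le zero_le_one fun t _ => by
      rw [Real.norm_eq_abs, abs_of_nonneg (hw0 n t)]; exact hw1 n t
    nlinarith [norm_nonneg (cfc (cutoff n) x)]

/-! ### The ideal of definition of the trace -/

/-- The positive elements of `M` of finite trace. -/
def posFin : Set (H →L[ℂ] H) := {x | x ∈ M ∧ 0 ≤ x ∧ τ.toFun x < ∞}

/-- The linear span of the positive elements of finite trace. -/
def l1 : Submodule ℂ (H →L[ℂ] H) := Submodule.span ℂ τ.posFin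

/-- The real linear span of the positive elements of finite trace. -/
def l1sa : Submodule ℝ (H →L[ℂ] H) := Submodule.span ℝ τ.posFin

variable {τ}

theorem posFin_add {x y : H →L[ℂ] H} (hx : x ∈ τ.posFin) (hy : y ∈ τ.posFin) :
    x + y ∈ τ.posFin :=
  ⟨add_mem hx.1 hy.1, add_nonneg hx.2.1 hy.2.1, by
    rw [τ.map_add x hx.1 y hy.1 hx.2.1 hy.2.1]; exact ENNReal.add_lt_top.2 ⟨hx.2.2, hy.2.2⟩⟩

theorem posFin_rsmul {x : H →L[ℂ] H} (hx : x ∈ τ.posFin) {t : ℝ} (ht : 0 ≤ t) :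
    t • x ∈ τ.posFin :=
  ⟨vN_rsmul_mem t hx.1, smul_nonneg ht hx.2.1, by
    rw [τ.map_rsmul ht hx.1 hx.2.1]; exact ENNReal.mul_lt_top ENNReal.ofReal_lt_top hx.2.2⟩

theorem zero_mem_posFin : (0 : H →L[ℂ] H) ∈ τ.posFin :=
  ⟨zero_mem M, le_rfl, by rw [τ.map_zero]; exact ENNReal.zero_lt_top⟩

theorem posFin_of_le {x y : H →L[ℂ] H} (hx : x ∈ M) (h0 : 0 ≤ x) (hxy : x ≤ y)
    (hy : y ∈ τ.posFin) : x ∈ τ.posFin :=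
  ⟨hx, h0, (τ.mono hx hy.1 h0 hxy).trans_lt hy.2.2⟩

theorem posFin_conj {x c : H →L[ℂ] H} (hx : x ∈ τ.posFin) (hc : c ∈ M) :
    star c * x * c ∈ τ.posFin :=
  ⟨mul_mem (mul_mem (star_mem hc) hx.1) hc, star_left_conjugate_nonneg hx.2.1 c,
    (τ.conj_le hx.1 hx.2.1 hc).trans_lt (ENNReal.mul_lt_top ENNReal.ofReal_lt_top hx.2.2)⟩

theorem mem_l1sa_iff {x : H →L[ℂ] H} :
    x ∈ τ.l1sa ↔ ∃ a ∈ τ.posFin, ∃ b ∈ τ.posFin, x = a - b := by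
  constructor
  · intro h
    induction h using Submodule.span_induction with
    | mem x h => exact ⟨x, h, 0, zero_mem_posFin, by simp⟩
    | zero => exact ⟨0, zero_mem_posFin, 0, zero_mem_posFin, by simp⟩
    | add x y _ _ hx hy =>
      obtain ⟨a, ha, b, hb, rfl⟩ := hx
      obtain ⟨a', ha', b', hb', rfl⟩ := hy
      exact ⟨a + a', posFin_add ha ha', b + b', posFin_add hb hb', by abel⟩
    | smul t x _ hx =>
      obtain ⟨a, ha, b, hb, rfl⟩ := hx
      rcases le_total 0 t with h | h
      · exact ⟨t • a, posFin_rsmul ha h, t • b, posFin_rsmul hb h, smul_sub _ _ _⟩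
      · refine ⟨(-t) • b, posFin_rsmul hb (neg_nonneg.2 h), (-t) • a,
          posFin_rsmul ha (neg_nonneg.2 h), ?_⟩
        rw [smul_sub, neg_smul, neg_smul]; abel
  · rintro ⟨a, ha, b, hb, rfl⟩
    exact sub_mem (Submodule.subset_span ha) (Submodule.subset_span hb)

theorem posFin_subset_l1sa {x : H →L[ℂ] H} (hx : x ∈ τ.posFin) : x ∈ τ.l1sa :=
  Submodule.subset_span hx

theorem posFin_subset_l1 {x : H →L[ℂ] H} (hx : x ∈ τ.posFin) : x ∈ τ.l1 :=
  Submodule.subset_span hx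

theorem l1sa_le_l1 {x : H →L[ℂ] H} (hx : x ∈ τ.l1sa) : x ∈ τ.l1 := by
  obtain ⟨a, ha, b, hb, rfl⟩ := mem_l1sa_iff.1 hx
  exact sub_mem (posFin_subset_l1 ha) (posFin_subset_l1 hb)

theorem isSelfAdjoint_of_mem_l1sa {x : H →L[ℂ] H} (hx : x ∈ τ.l1sa) : IsSelfAdjoint x := by
  obtain ⟨a, ha, b, hb, rfl⟩ := mem_l1sa_iff.1 hx
  exact (IsSelfAdjoint.of_nonneg ha.2.1).sub (IsSelfAdjoint.of_nonneg hb.2.1)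

theorem mem_vN_of_mem_l1 {x : H →L[ℂ] H} (hx : x ∈ τ.l1) : x ∈ M := by
  induction hx using Submodule.span_induction with
  | mem x h => exact h.1
  | zero => exact zero_mem M
  | add x y _ _ hx hy => exact add_mem hx hy
  | smul t x _ hx => exact vN_smul_mem t hx

theorem realPart_imaginaryPart_mem {x : H →L[ℂ] H} (hx : x ∈ τ.l1) :
    (realPart x : H →L[ℂ] H) ∈ τ.l1sa ∧ (imaginaryPart x : H →L[ℂ] H) ∈ τ.l1sa := by
  induction hx using Submodule.span_induction with
  | mem x h =>
    have hs : IsSelfAdjoint x := IsSelfAdjoint.of_nonneg h.2.1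
    rw [hs.coe_realPart, hs.imaginaryPart]
    exact ⟨posFin_subset_l1sa h, zero_mem _⟩
  | zero => simp
  | add x y _ _ hx hy =>
    simp only [_root_.map_add, AddSubgroup.coe_add]
    exact ⟨add_mem hx.1 hy.1, add_mem hx.2 hy.2⟩
  | smul t x _ hx =>
    rw [realPart_smul, imaginaryPart_smul]
    exact ⟨sub_mem (Submodule.smul_mem _ _ hx.1) (Submodule.smul_mem _ _ hx.2),
      add_mem (Submodule.smul_mem _ _ hx.2) (Submodule.smul_mem _ _ hx.1)⟩

theorem posPart_mem_posFin {x : H →L[ℂ] H} (hx : x ∈ τ.l1sa) :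
    x⁺ ∈ τ.posFin ∧ x⁻ ∈ τ.posFin := by
  obtain ⟨a, ha, b, hb, rfl⟩ := mem_l1sa_iff.1 hx
  refine ⟨⟨vN_posPart_mem (sub_mem ha.1 hb.1), CFC.posPart_nonneg _,
    (τ.posPart_le ha.1 hb.1 ha.2.1 hb.2.1).trans_lt ha.2.2⟩,
    ⟨vN_negPart_mem (sub_mem ha.1 hb.1), CFC.negPart_nonneg _, ?_⟩⟩
  rw [← CFC.posPart_neg, neg_sub]
  exact (τ.posPart_le hb.1 ha.1 hb.2.1 ha.2.1).trans_lt hb.2.2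

theorem mem_posFin_of_mem_l1 {x : H →L[ℂ] H} (hx : x ∈ τ.l1) (h0 : 0 ≤ x) : x ∈ τ.posFin := by
  have h := (realPart_imaginaryPart_mem hx).1
  rw [(IsSelfAdjoint.of_nonneg h0).coe_realPart] at h
  have := (posPart_mem_posFin h).1
  rwa [(CFC.posPart_eq_self x).2 h0] at this

variable (τ)

/-- The trace on the self-adjoint part. -/
def traceR (x : H →L[ℂ] H) : ℝ := (τ.toFun x⁺).toReal - (τ.toFun x⁻).toReal

theorem trace_eq (T : H →L[ℂ] H) :
    τ.trace T = (τ.traceR (realPart T) : ℂ) + Complex.I * (τ.traceR (imaginaryPart T) : ℂ) := rfl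

variable {τ}

theorem toReal_add {x y : H →L[ℂ] H} (hx : x ∈ τ.posFin) (hy : y ∈ τ.posFin) :
    (τ.toFun (x + y)).toReal = (τ.toFun x).toReal + (τ.toFun y).toReal := by
  rw [τ.map_add x hx.1 y hy.1 hx.2.1 hy.2.1, ENNReal.toReal_add hx.2.2.ne hy.2.2.ne]

theorem toReal_rsmul {x : H →L[ℂ] H} (hx : x ∈ τ.posFin) {t : ℝ} (ht : 0 ≤ t) :
    (τ.toFun (t • x)).toReal = t * (τ.toFun x).toReal := by
  rw [τ.map_rsmul ht hx.1 hx.2.1, ENNReal.toReal_mul, ENNReal.toReal_ofReal ht]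

/-- The value does not depend on how a self-adjoint x is split: x⁺ + b = x⁻ + a, and the trace is
additive on both positive sums. Real linearity follows from this. -/
theorem traceR_sub {a b : H →L[ℂ] H} (ha : a ∈ τ.posFin) (hb : b ∈ τ.posFin) :
    τ.traceR (a - b) = (τ.toFun a).toReal - (τ.toFun b).toReal := by
  have hx := mem_l1sa_iff.2 ⟨a, ha, b, hb, rfl⟩
  obtain ⟨h1, h2⟩ := posPart_mem_posFin hx
  have e : (a - b)⁺ + b = (a - b)⁻ + a := by
    have := CFC.posPart_sub_negPart (a - b) (isSelfAdjoint_of_mem_l1sa hx)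
    rw [sub_eq_iff_eq_add] at this
    rw [this]; abel
  have := congrArg (fun x => (τ.toFun x).toReal) e
  simp only [toReal_add h1 hb, toReal_add h2 ha] at this
  rw [traceR]; linarith

theorem traceR_of_posFin {a : H →L[ℂ] H} (ha : a ∈ τ.posFin) :
    τ.traceR a = (τ.toFun a).toReal := by
  have := traceR_sub ha zero_mem_posFin
  rwa [sub_zero, τ.map_zero, ENNReal.toReal_zero, sub_zero] at this

theorem traceR_add {x y : H →L[ℂ] H} (hx : x ∈ τ.l1sa) (hy : y ∈ τ.l1sa) :
    τ.traceR (x + y) = τ.traceR x + τ.traceR y := by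
  obtain ⟨a, ha, b, hb, rfl⟩ := mem_l1sa_iff.1 hx
  obtain ⟨a', ha', b', hb', rfl⟩ := mem_l1sa_iff.1 hy
  have e : a - b + (a' - b') = (a + a') - (b + b') := by abel
  rw [e, traceR_sub (posFin_add ha ha') (posFin_add hb hb'), traceR_sub ha hb, traceR_sub ha' hb',
    toReal_add ha ha', toReal_add hb hb']
  ring

theorem traceR_smul (t : ℝ) {x : H →L[ℂ] H} (hx : x ∈ τ.l1sa) :
    τ.traceR (t • x) = t * τ.traceR x := by
  obtain ⟨a, ha, b, hb, rfl⟩ := mem_l1sa_iff.1 hx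
  rcases le_total 0 t with h | h
  · rw [smul_sub, traceR_sub (posFin_rsmul ha h) (posFin_rsmul hb h), traceR_sub ha hb, toReal_rsmul ha h,
      toReal_rsmul hb h]
    ring
  · have h' := neg_nonneg.2 h
    have e : t • (a - b) = (-t) • b - (-t) • a := by
      rw [smul_sub, neg_smul, neg_smul]; abel
    rw [e, traceR_sub (posFin_rsmul hb h') (posFin_rsmul ha h'), traceR_sub ha hb, toReal_rsmul ha h',
      toReal_rsmul hb h']
    ring

theorem traceR_nonneg {x : H →L[ℂ] H} (hx : x ∈ τ.l1sa) (h0 : 0 ≤ x) : 0 ≤ τ.traceR x := by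
  rw [traceR_of_posFin (mem_posFin_of_mem_l1 (l1sa_le_l1 hx) h0)]
  exact ENNReal.toReal_nonneg

theorem trace_add {x y : H →L[ℂ] H} (hx : x ∈ τ.l1) (hy : y ∈ τ.l1) :
    τ.trace (x + y) = τ.trace x + τ.trace y := by
  obtain ⟨h1, h2⟩ := realPart_imaginaryPart_mem hx
  obtain ⟨h3, h4⟩ := realPart_imaginaryPart_mem hy
  simp only [trace_eq, _root_.map_add, AddSubgroup.coe_add, traceR_add h1 h3, traceR_add h2 h4,
    Complex.ofReal_add]
  ring

theorem trace_smul (c : ℂ) {x : H →L[ℂ] H} (hx : x ∈ τ.l1) :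
    τ.trace (c • x) = c * τ.trace x := by
  obtain ⟨h1, h2⟩ := realPart_imaginaryPart_mem hx
  have e1 : τ.traceR (realPart (c • x)) = c.re * τ.traceR (realPart x) -
      c.im * τ.traceR (imaginaryPart x) := by
    rw [realPart_smul]
    have := traceR_add (τ := τ) (Submodule.smul_mem _ c.re h1) (Submodule.smul_mem _ (-c.im) h2)
    rw [traceR_smul _ h1, traceR_smul _ h2] at this
    rw [sub_eq_add_neg (_ * _), ← neg_mul, ← this]
    congr 1
    simp [sub_eq_add_neg]
  have e2 : τ.traceR (imaginaryPart (c • x)) = c.re * τ.traceR (imaginaryPart x) +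
      c.im * τ.traceR (realPart x) := by
    rw [imaginaryPart_smul]
    have := traceR_add (τ := τ) (Submodule.smul_mem _ c.re h2) (Submodule.smul_mem _ c.im h1)
    rw [traceR_smul _ h1, traceR_smul _ h2] at this
    rw [← this]
    congr 1
  rw [trace_eq, trace_eq, e1, e2]
  apply Complex.ext <;> simp

theorem trace_neg {x : H →L[ℂ] H} (hx : x ∈ τ.l1) : τ.trace (-x) = -τ.trace x := by
  rw [← neg_one_smul ℂ, trace_smul _ hx, neg_one_mul]

theorem trace_sub {x y : H →L[ℂ] H} (hx : x ∈ τ.l1) (hy : y ∈ τ.l1) :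
    τ.trace (x - y) = τ.trace x - τ.trace y := by
  rw [sub_eq_add_neg, trace_add hx (neg_mem hy), trace_neg hy, sub_eq_add_neg]

theorem trace_zero : τ.trace (0 : H →L[ℂ] H) = 0 := by
  have := trace_smul (τ := τ) 0 (zero_mem τ.l1)
  simpa using this

theorem trace_sum {ι : Type*} (s : Finset ι) {f : ι → H →L[ℂ] H} (hf : ∀ i ∈ s, f i ∈ τ.l1) :
    τ.trace (∑ i ∈ s, f i) = ∑ i ∈ s, τ.trace (f i) := by
  classical
  induction s using Finset.induction_on with
  | empty => simpa using trace_zero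
  | insert i s hi ih =>
    rw [Finset.sum_insert hi, Finset.sum_insert hi,
      trace_add (hf i (Finset.mem_insert_self i s))
        (sum_mem fun j hj => hf j (Finset.mem_insert_of_mem hj)),
      ih fun j hj => hf j (Finset.mem_insert_of_mem hj)]

theorem trace_of_posFin {x : H →L[ℂ] H} (hx : x ∈ τ.posFin) :
    τ.trace x = ((τ.toFun x).toReal : ℂ) := by
  have hs : IsSelfAdjoint x := IsSelfAdjoint.of_nonneg hx.2.1
  have : τ.traceR (0 : H →L[ℂ] H) = 0 := by
    have := traceR_smul (τ := τ) 0 (zero_mem τ.l1sa)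
    simpa using this
  rw [trace_eq, hs.coe_realPart, hs.imaginaryPart, traceR_of_posFin hx]
  simp [this]

end FNSTrace

end

/-! ### Hilbert-Schmidt elements, cyclicity of the trace and trace norm bounds -/

section

variable {H : Type*} [NormedAddCommGroup H] [InnerProductSpace ℂ H] [CompleteSpace H]
variable {M : VonNeumannAlgebra H}

namespace FNSTrace

variable {τ : FNSTrace M}

theorem star_mem_l1 {T : H →L[ℂ] H} (hT : T ∈ τ.l1) : star T ∈ τ.l1 := by
  induction hT using Submodule.span_induction with
  | mem x h => rw [(IsSelfAdjoint.of_nonneg h.2.1).star_eq]; exact posFin_subset_l1 h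
  | zero => simp
  | add x y _ _ hx hy => rw [star_add]; exact add_mem hx hy
  | smul t x _ hx => rw [star_smul]; exact Submodule.smul_mem _ _ hx

theorem trace_star {T : H →L[ℂ] H} (hT : T ∈ τ.l1) : τ.trace (star T) = star (τ.trace T) := by
  induction hT using Submodule.span_induction with
  | mem x h =>
    rw [(IsSelfAdjoint.of_nonneg h.2.1).star_eq, trace_of_posFin h]
    simp
  | zero => simp [trace_zero]
  | add x y hx' hy' hx hy =>
    rw [star_add, trace_add (star_mem_l1 hx') (star_mem_l1 hy'), hx, hy, trace_add hx' hy', star_add]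
  | smul t x hx' hx =>
    rw [star_smul, trace_smul _ (star_mem_l1 hx'), hx, trace_smul _ hx', star_mul']

/-- By the parallelogram law, 2(a*a + b*b) - (a+b)*(a+b) = (a-b)*(a-b) ≥ 0. -/
theorem posFin_star_mul_add {a b : H →L[ℂ] H} (ha : a ∈ M) (hb : b ∈ M)
    (ha' : star a * a ∈ τ.posFin) (hb' : star b * b ∈ τ.posFin) :
    star (a + b) * (a + b) ∈ τ.posFin := by
  have h2 := posFin_rsmul (posFin_add ha' hb') (zero_le_two (α := ℝ))
  refine posFin_of_le (mul_mem (star_mem (add_mem ha hb)) (add_mem ha hb))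
    (star_mul_self_nonneg _) ?_ h2
  rw [← sub_nonneg]
  have : (2 : ℝ) • (star a * a + star b * b) - star (a + b) * (a + b) =
      star (a - b) * (a - b) := by
    rw [two_smul, star_add, star_sub]; noncomm_ring
  rw [this]
  exact star_mul_self_nonneg _

theorem posFin_star_mul_smul {a : H →L[ℂ] H} (c : ℂ) (ha' : star a * a ∈ τ.posFin) :
    star (c • a) * (c • a) ∈ τ.posFin := by
  have : star (c • a) * (c • a) = (‖c‖ ^ 2 : ℝ) • (star a * a) := by
    rw [star_smul, smul_mul_smul_comm, ← Complex.coe_smul, Complex.star_def, mul_comm,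
      Complex.mul_conj, Complex.normSq_eq_norm_sq]
  rw [this]
  exact posFin_rsmul ha' (sq_nonneg _)

theorem posFin_mul_star {a : H →L[ℂ] H} (ha : a ∈ M) (ha' : star a * a ∈ τ.posFin) :
    a * star a ∈ τ.posFin :=
  ⟨mul_mem ha (star_mem ha), mul_star_self_nonneg a, by
    rw [← τ.tracial a ha]; exact ha'.2.2⟩

theorem polarization (a b : H →L[ℂ] H) :
    star b * a = (1 / 4 : ℂ) • (star (a + b) * (a + b)
      + Complex.I • (star (a + Complex.I • b) * (a + Complex.I • b))
      - star (a + (-1 : ℂ) • b) * (a + (-1 : ℂ) • b)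
      - Complex.I • (star (a + (-Complex.I) • b) * (a + (-Complex.I) • b))) := by
  simp only [star_add, star_smul, mul_add, add_mul, smul_mul_assoc, mul_smul_comm, smul_add,
    smul_smul, Complex.star_def, map_neg, Complex.conj_I, map_one]
  have h := Complex.I_mul_I
  match_scalars <;> simp
  ring

theorem polarization' (a b : H →L[ℂ] H) :
    a * star b = (1 / 4 : ℂ) • ((a + b) * star (a + b)
      + Complex.I • ((a + Complex.I • b) * star (a + Complex.I • b))
      - (a + (-1 : ℂ) • b) * star (a + (-1 : ℂ) • b)
      - Complex.I • ((a + (-Complex.I) • b) * star (a + (-Complex.I) • b))) := by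
  simp only [star_add, star_smul, mul_add, add_mul, smul_mul_assoc, mul_smul_comm, smul_add,
    smul_smul, Complex.star_def, map_neg, Complex.conj_I, map_one]
  have h := Complex.I_mul_I
  match_scalars <;> simp
  ring

/-- Products of two Hilbert-Schmidt operators. -/
theorem hilbertSchmidt_mul {a b : H →L[ℂ] H} (ha : a ∈ M) (hb : b ∈ M)
    (ha' : star a * a ∈ τ.posFin) (hb' : star b * b ∈ τ.posFin) :
    star b * a ∈ τ.l1 ∧ a * star b ∈ τ.l1 ∧ τ.trace (star b * a) = τ.trace (a * star b) := by
  have key : ∀ c : ℂ, star (a + c • b) * (a + c • b) ∈ τ.l1 ∧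
      (a + c • b) * star (a + c • b) ∈ τ.l1 ∧
      τ.trace (star (a + c • b) * (a + c • b)) = τ.trace ((a + c • b) * star (a + c • b)) := by
    intro c
    have h1 := posFin_star_mul_add ha (vN_smul_mem c hb) ha' (posFin_star_mul_smul c hb')
    have hm : a + c • b ∈ M := add_mem ha (vN_smul_mem c hb)
    have h2 := posFin_mul_star hm h1
    exact ⟨posFin_subset_l1 h1, posFin_subset_l1 h2, by
      rw [trace_of_posFin h1, trace_of_posFin h2, τ.tracial _ hm]⟩
  obtain ⟨p1, q1, r1⟩ := key 1
  obtain ⟨p2, q2, r2⟩ := key Complex.I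
  obtain ⟨p3, q3, r3⟩ := key (-1)
  obtain ⟨p4, q4, r4⟩ := key (-Complex.I)
  rw [one_smul] at p1 q1 r1
  have s2 := Submodule.smul_mem _ Complex.I p2
  have t2 := Submodule.smul_mem _ Complex.I q2
  have s4 := Submodule.smul_mem _ Complex.I p4
  have t4 := Submodule.smul_mem _ Complex.I q4
  -- The trace axiom is the diagonal case, for a + i^k b. Polarization expresses b*a and ab* by the
  -- same combination of diagonal terms.
  rw [polarization a b, polarization' a b]
  refine ⟨Submodule.smul_mem _ _ (sub_mem (sub_mem (add_mem p1 s2) p3) s4),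
    Submodule.smul_mem _ _ (sub_mem (sub_mem (add_mem q1 t2) q3) t4), ?_⟩
  rw [trace_smul _ (sub_mem (sub_mem (add_mem p1 s2) p3) s4),
    trace_smul _ (sub_mem (sub_mem (add_mem q1 t2) q3) t4),
    trace_sub (sub_mem (add_mem p1 s2) p3) s4, trace_sub (sub_mem (add_mem q1 t2) q3) t4,
    trace_sub (add_mem p1 s2) p3, trace_sub (add_mem q1 t2) q3, trace_add p1 s2, trace_add q1 t2,
    trace_smul _ p2, trace_smul _ q2, trace_smul _ p4, trace_smul _ q4, r1, r2, r3, r4]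

/-- Multiplication of a positive element of finite trace by an element of `M`. -/
theorem posFin_mul {x W : H →L[ℂ] H} (hx : x ∈ τ.posFin) (hW : W ∈ M) :
    W * x ∈ τ.l1 ∧ x * W ∈ τ.l1 ∧ CFC.sqrt x * W * CFC.sqrt x ∈ τ.l1 ∧
      τ.trace (W * x) = τ.trace (CFC.sqrt x * W * CFC.sqrt x) ∧
      τ.trace (x * W) = τ.trace (CFC.sqrt x * W * CFC.sqrt x) := by
  set y := CFC.sqrt x with hy
  have hyM : y ∈ M := vN_sqrt_mem hx.1
  have hys : star y = y := (IsSelfAdjoint.of_nonneg (CFC.sqrt_nonneg x)).star_eq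
  have hyy : y * y = x := CFC.sqrt_mul_sqrt_self x hx.2.1
  have h1 : star y * y ∈ τ.posFin := by rw [hys, hyy]; exact hx
  have h2 : ∀ V ∈ M, star (y * V) * (y * V) ∈ τ.posFin := fun V hV => by
    have := posFin_conj hx hV
    rwa [star_mul, hys, mul_assoc, ← mul_assoc y y V, hyy, ← mul_assoc]
  -- Wx = (yW*)*y and xW = y(yW) are products of Hilbert-Schmidt elements, and reversing the factors
  -- gives yWy in both cases.
  have a1 := hilbertSchmidt_mul hyM (mul_mem hyM (star_mem hW)) h1 (h2 _ (star_mem hW))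
  have a2 := hilbertSchmidt_mul (mul_mem hyM hW) hyM (h2 _ hW) h1
  rw [star_mul, star_star, hys, mul_assoc, hyy, ← mul_assoc] at a1
  rw [hys, ← mul_assoc, hyy] at a2
  exact ⟨a1.1, a2.1, a1.2.1, a1.2.2, a2.2.2⟩

theorem mul_mem_l1 {T W : H →L[ℂ] H} (hT : T ∈ τ.l1) (hW : W ∈ M) : W * T ∈ τ.l1 := by
  induction hT using Submodule.span_induction with
  | mem x h => exact (posFin_mul h hW).1
  | zero => simp
  | add x y _ _ hx hy => rw [mul_add]; exact add_mem hx hy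
  | smul t x _ hx => rw [mul_smul_comm]; exact Submodule.smul_mem _ _ hx

theorem mem_l1_mul {T W : H →L[ℂ] H} (hT : T ∈ τ.l1) (hW : W ∈ M) : T * W ∈ τ.l1 := by
  induction hT using Submodule.span_induction with
  | mem x h => exact (posFin_mul h hW).2.1
  | zero => simp
  | add x y _ _ hx hy => rw [add_mul]; exact add_mem hx hy
  | smul t x _ hx => rw [smul_mul_assoc]; exact Submodule.smul_mem _ _ hx

theorem trace_mul_comm {T W : H →L[ℂ] H} (hT : T ∈ τ.l1) (hW : W ∈ M) :
    τ.trace (W * T) = τ.trace (T * W) := by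
  induction hT using Submodule.span_induction with
  | mem x h =>
    obtain ⟨_, _, _, h1, h2⟩ := posFin_mul h hW
    rw [h1, h2]
  | zero => simp
  | add x y hx' hy' hx hy =>
    rw [mul_add, add_mul, trace_add (mul_mem_l1 hx' hW) (mul_mem_l1 hy' hW), hx, hy,
      trace_add (mem_l1_mul hx' hW) (mem_l1_mul hy' hW)]
  | smul t x hx' hx =>
    rw [mul_smul_comm, smul_mul_assoc, trace_smul _ (mul_mem_l1 hx' hW), hx,
      trace_smul _ (mem_l1_mul hx' hW)]

/-- With y = √x, the trace of Wx is that of yWy, whose real part y Re(W) y is at most ‖W‖x. -/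
theorem re_trace_mul_le {x W : H →L[ℂ] H} (hx : x ∈ τ.posFin) (hW : W ∈ M) :
    (τ.trace (W * x)).re ≤ ‖W‖ * (τ.toFun x).toReal := by
  obtain ⟨_, _, hl, h1, _⟩ := posFin_mul hx hW
  set y := CFC.sqrt x with hy
  have hyM : y ∈ M := vN_sqrt_mem hx.1
  have hys : star y = y := (IsSelfAdjoint.of_nonneg (CFC.sqrt_nonneg x)).star_eq
  have hyy : y * y = x := CFC.sqrt_mul_sqrt_self x hx.2.1
  have hre : (realPart (y * W * y) : H →L[ℂ] H) = star y * (realPart W : H →L[ℂ] H) * y := by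
    rw [realPart_apply_coe, realPart_apply_coe, star_mul, star_mul, hys, mul_smul_comm,
      smul_mul_assoc]
    congr 1
    noncomm_ring
  have hrel := (realPart_imaginaryPart_mem hl).1
  rw [h1, trace_eq]
  have e : ((τ.traceR (realPart (y * W * y)) : ℂ) +
      Complex.I * (τ.traceR (imaginaryPart (y * W * y)) : ℂ)).re =
      τ.traceR (realPart (y * W * y)) := by simp
  rw [e, ← traceR_of_posFin hx, ← traceR_smul _ (posFin_subset_l1sa hx)]
  have hs := Submodule.smul_mem _ ‖W‖ (posFin_subset_l1sa hx)
  have hle : (realPart (y * W * y) : H →L[ℂ] H) ≤ ‖W‖ • x := by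
    rw [hre]
    calc star y * (realPart W : H →L[ℂ] H) * y
        ≤ star y * (algebraMap ℝ (H →L[ℂ] H) ‖(realPart W : H →L[ℂ] H)‖) * y :=
          star_left_conjugate_le_conjugate
            (IsSelfAdjoint.le_algebraMap_norm_self (realPart W).2) y
      _ = ‖(realPart W : H →L[ℂ] H)‖ • x := by
          rw [hys, Algebra.algebraMap_eq_smul_one, mul_smul_comm, mul_one, smul_mul_assoc, hyy]
      _ ≤ ‖W‖ • x := smul_le_smul_of_nonneg_right (realPart.norm_le W) hx.2.1
  have h0 := traceR_nonneg (sub_mem hs hrel) (sub_nonneg.2 hle)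
  have := traceR_add (sub_mem hs hrel) hrel
  rw [sub_add_cancel] at this
  linarith

/-- Rotating W by a phase makes the trace real and nonnegative, so the bound on real parts suffices.
-/
theorem norm_trace_mul_le {x W : H →L[ℂ] H} (hx : x ∈ τ.posFin) (hW : W ∈ M) :
    ‖τ.trace (W * x)‖ ≤ ‖W‖ * (τ.toFun x).toReal := by
  obtain ⟨c, hc, h⟩ := RCLike.exists_norm_eq_mul_self (τ.trace (W * x))
  have h1 := re_trace_mul_le hx (vN_smul_mem c hW)
  rw [smul_mul_assoc, trace_smul _ (mul_mem_l1 (posFin_subset_l1 hx) hW), ← h, norm_smul, hc,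
    one_mul] at h1
  simpa using h1

variable (τ)

/-- `T` is trace class, with trace norm at most `K`. -/
def TraceBound (T : H →L[ℂ] H) (K : ℝ) : Prop :=
  T ∈ τ.l1 ∧ ∀ W ∈ M, ‖τ.trace (W * T)‖ ≤ ‖W‖ * K

variable {τ}

theorem TraceBound.of_posFin {x : H →L[ℂ] H} (hx : x ∈ τ.posFin) :
    τ.TraceBound x (τ.toFun x).toReal :=
  ⟨posFin_subset_l1 hx, fun _ hW => norm_trace_mul_le hx hW⟩

theorem TraceBound.mono {T : H →L[ℂ] H} {K K' : ℝ} (h : τ.TraceBound T K) (hK : K ≤ K') :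
    τ.TraceBound T K' :=
  ⟨h.1, fun W hW => (h.2 W hW).trans (mul_le_mul_of_nonneg_left hK (norm_nonneg _))⟩

theorem TraceBound.smul {T : H →L[ℂ] H} {K : ℝ} (h : τ.TraceBound T K) (c : ℂ) :
    τ.TraceBound (c • T) (‖c‖ * K) := by
  refine ⟨Submodule.smul_mem _ _ h.1, fun W hW => ?_⟩
  rw [mul_smul_comm, trace_smul _ (mul_mem_l1 h.1 hW), norm_mul]
  calc ‖c‖ * ‖τ.trace (W * T)‖ ≤ ‖c‖ * (‖W‖ * K) :=
        mul_le_mul_of_nonneg_left (h.2 W hW) (norm_nonneg _)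
    _ = ‖W‖ * (‖c‖ * K) := by ring

theorem norm_le_of_traceBound {T : H →L[ℂ] H} {K : ℝ} (h : τ.TraceBound T K) (hK : 0 ≤ K) :
    ‖τ.trace T‖ ≤ K := by
  have := h.2 1 (one_mem M)
  rw [one_mul] at this
  exact this.trans (mul_le_of_le_one_left hK ContinuousLinearMap.norm_id_le)

theorem TraceBound.mul_left {T V : H →L[ℂ] H} {K : ℝ} (h : τ.TraceBound T K) (hK : 0 ≤ K)
    (hV : V ∈ M) : τ.TraceBound (V * T) (‖V‖ * K) := by
  refine ⟨mul_mem_l1 h.1 hV, fun W hW => ?_⟩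
  rw [← mul_assoc, ← mul_assoc]
  exact (h.2 _ (mul_mem hW hV)).trans (mul_le_mul_of_nonneg_right (norm_mul_le _ _) hK)

theorem TraceBound.mul_right {T V : H →L[ℂ] H} {K : ℝ} (h : τ.TraceBound T K) (hK : 0 ≤ K)
    (hV : V ∈ M) : τ.TraceBound (T * V) (‖V‖ * K) := by
  refine ⟨mem_l1_mul h.1 hV, fun W hW => ?_⟩
  rw [← mul_assoc, ← trace_mul_comm (mul_mem_l1 h.1 hW) hV, ← mul_assoc, ← mul_assoc, mul_comm ‖W‖]
  exact (h.2 _ (mul_mem hV hW)).trans (mul_le_mul_of_nonneg_right (norm_mul_le _ _) hK)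

theorem exists_traceBound {T : H →L[ℂ] H} (hT : T ∈ τ.l1) : ∃ K, 0 ≤ K ∧ τ.TraceBound T K := by
  induction hT using Submodule.span_induction with
  | mem x h => exact ⟨_, ENNReal.toReal_nonneg, TraceBound.of_posFin h⟩
  | zero => exact ⟨0, le_rfl, zero_mem _, fun W _ => by simp [trace_zero]⟩
  | add x y hx' hy' hx hy =>
    obtain ⟨K, hK, h⟩ := hx
    obtain ⟨L, hL, h'⟩ := hy
    refine ⟨K + L, add_nonneg hK hL, add_mem hx' hy', fun W hW => ?_⟩
    rw [mul_add, trace_add (mul_mem_l1 hx' hW) (mul_mem_l1 hy' hW), mul_add]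
    exact (norm_add_le _ _).trans (add_le_add (h.2 W hW) (h'.2 W hW))
  | smul t x hx' hx =>
    obtain ⟨K, hK, h⟩ := hx
    exact ⟨_, mul_nonneg (norm_nonneg _) hK, h.smul t⟩

/-! ### Trace class operators have finite absolute value -/

set_option maxHeartbeats 400000 in
-- No polar decomposition is needed. With Y = |T| and g(t) = (t⁺ + 1/(n+1))⁻¹, the operator g(Y)T*
-- is a contraction and g(Y)T*T = g(Y)Y². This increases to Y, while its trace stays below the trace
-- bound K of T.
theorem memL1_of_mem_l1 {T : H →L[ℂ] H} (hT : T ∈ τ.l1) : τ.MemL1 T := by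
  have hTM := mem_vN_of_mem_l1 hT
  refine ⟨hTM, ?_⟩
  obtain ⟨K, hK, hb⟩ := exists_traceBound hT
  have hY0 : 0 ≤ CFC.abs T := CFC.abs_nonneg T
  have hYM : CFC.abs T ∈ M := vN_abs_mem hTM
  have hYY : CFC.abs T * CFC.abs T = star T * T := CFC.abs_mul_abs T
  generalize CFC.abs T = Y at hY0 hYM hYY ⊢
  have hYs : IsSelfAdjoint Y := IsSelfAdjoint.of_nonneg hY0
  have hsp : ∀ t ∈ spectrum ℝ Y, 0 ≤ t := fun t ht => spectrum_nonneg_of_nonneg hY0 ht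
  have hcf : Y = cfc (fun t : ℝ => t) Y := (cfc_id' ℝ Y hYs).symm
  refine lt_of_le_of_lt (b := ENNReal.ofReal K) ?_ ENNReal.ofReal_lt_top
  rw [hcf]
  refine τ.cfc_le_of_approx (f := fun n t => cutoff n t * t) hYM
    (fun n => ((continuous_cutoff n).mul continuous_id).continuousOn) ?_ ?_ ?_ ?_
  · exact fun n t ht => mul_nonneg (cutoff_nonneg n t) (hsp t ht)
  · exact fun t ht m n hmn => mul_le_mul_of_nonneg_right (cutoff_mono t hmn) (hsp t ht)
  · refine tendstoUniformlyOn_of_le (C := 1) fun n t ht => ?_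
    have := posPart_sub_cutoff_mul n t
    rw [posPart_of_nonneg (hsp t ht)] at this
    rw [abs_of_nonneg this.1, one_mul]
    exact this.2
  · intro n
    let g : ℝ → ℝ := fun t => (t⁺ + 1 / ((n : ℝ) + 1))⁻¹
    have hg : Continuous g := (continuous_real_posPart.add continuous_const).inv₀
      fun t => (posPart_add_pos n t).ne'
    have hgM : cfc g Y ∈ M := vN_cfc_mem _ hYM
    have hgs : star (cfc g Y) = cfc g Y := (cfc_predicate g Y : IsSelfAdjoint _)
    have hYid : ∀ f : ℝ → ℝ, Continuous f → cfc f Y * Y = cfc (fun t => f t * t) Y := by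
      intro f hf
      rw [cfc_mul f (fun t => t) Y hf.continuousOn continuousOn_id, cfc_id' ℝ Y hYs]
    have hct : cfc (fun t => cutoff n t * t) Y = cfc g Y * star T * T := by
      rw [mul_assoc, ← hYY, ← mul_assoc, hYid g hg, hYid (fun t => g t * t) (hg.mul continuous_id)]
      refine cfc_congr fun t ht => ?_
      simp only [cutoff, g]
      rw [posPart_of_nonneg (hsp t ht)]
      ring
    have hWM : cfc g Y * star T ∈ M := mul_mem hgM (star_mem hTM)
    have hW1 : ‖cfc g Y * star T‖ ≤ 1 := by
      have h1 : (cfc g Y * star T) * star (cfc g Y * star T) = cfc (fun t => g t * t * t * g t) Y := by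
        rw [star_mul, star_star, hgs]
        have : cfc g Y * star T * (T * cfc g Y) = cfc g Y * (star T * T) * cfc g Y := by
          simp only [mul_assoc]
        rw [this, ← hYY, ← mul_assoc, hYid g hg, hYid (fun t => g t * t) (hg.mul continuous_id),
          ← cfc_mul (fun t => g t * t * t) g Y
            (((hg.mul continuous_id).mul continuous_id).continuousOn) hg.continuousOn]
      have h2 : ‖cfc (fun t => g t * t * t * g t) Y‖ ≤ 1 := by
        refine norm_cfc_le zero_le_one fun t ht => ?_
        have : g t * t * t * g t = cutoff n t * cutoff n t := by
          simp only [cutoff, g]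
          rw [posPart_of_nonneg (hsp t ht)]
          ring
        rw [this, Real.norm_eq_abs, abs_of_nonneg (mul_self_nonneg _)]
        nlinarith [cutoff_nonneg n t, cutoff_le_one n t]
      rw [← h1, CStarRing.norm_self_mul_star] at h2
      nlinarith [norm_nonneg (cfc g Y * star T)]
    have h0 : 0 ≤ cfc (fun t => cutoff n t * t) Y :=
      cfc_nonneg fun t ht => mul_nonneg (cutoff_nonneg n t) (hsp t ht)
    have hfin := mem_posFin_of_mem_l1 (by rw [hct]; exact mul_mem_l1 hT hWM) h0
    have h3 := hb.2 _ hWM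
    rw [← hct, trace_of_posFin hfin, Complex.norm_real, Real.norm_of_nonneg ENNReal.toReal_nonneg]
      at h3
    rw [← ENNReal.ofReal_toReal hfin.2.2.ne]
    exact ENNReal.ofReal_le_ofReal (h3.trans (mul_le_of_le_one_left hK hW1))

end FNSTrace

end

/-! ### Approximate units and the interchange of trace and integral -/

section

open MeasureTheory Filter Topology

variable {H : Type*} [NormedAddCommGroup H] [InnerProductSpace ℂ H] [CompleteSpace H]
variable {M : VonNeumannAlgebra H}

theorem vN_integral_mem {α : Type*} [MeasurableSpace α] {μ : Measure α} {F : α → H →L[ℂ] H}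
    (hF : Integrable F μ) (hM : ∀ᵐ x ∂μ, F x ∈ M) : ∫ x, F x ∂μ ∈ M := by
  refine vN_mem_of_commute fun y hy => ?_
  have h1 := (ContinuousLinearMap.mul ℂ (H →L[ℂ] H) y).integral_comp_comm hF
  have h2 := ((ContinuousLinearMap.mul ℂ (H →L[ℂ] H)).flip y).integral_comp_comm hF
  simp only [ContinuousLinearMap.mul_apply', ContinuousLinearMap.flip_apply] at h1 h2
  rw [← h1, ← h2]
  refine integral_congr_ae ?_
  filter_upwards [hM] with x hx
  exact (vN_commute hx hy).eq.symm

/-- An increasing sequence of positive contractions of `M` of finite trace, converging strongly to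
the identity. -/
structure IsApproxUnit (τ : FNSTrace M) (E : ℕ → H →L[ℂ] H) : Prop where
  fin : ∀ n, E n ∈ τ.posFin
  norm_le : ∀ n, ‖E n‖ ≤ 1
  mono : Monotone E
  lim : ∀ x, Tendsto (fun n => E n x) atTop (𝓝 x)

namespace FNSTrace

variable {τ : FNSTrace M}

/-- The operators √x Eₙ √x increase strongly to x, so normality recovers τ(x) from them, even when
it is infinite. -/
theorem sqrt_conj_approx {E : ℕ → H →L[ℂ] H} (hE : IsApproxUnit τ E) {x : H →L[ℂ] H}
    (hx : x ∈ M) (h0 : 0 ≤ x) :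
    τ.toFun x = ⨆ n, τ.toFun (CFC.sqrt x * E n * CFC.sqrt x) ∧
      Monotone fun n => CFC.sqrt x * E n * CFC.sqrt x := by
  have hys : star (CFC.sqrt x) = CFC.sqrt x :=
    (IsSelfAdjoint.of_nonneg (CFC.sqrt_nonneg x)).star_eq
  have hyM : CFC.sqrt x ∈ M := vN_sqrt_mem hx
  have hm : Monotone fun n => CFC.sqrt x * E n * CFC.sqrt x := fun m n hmn => by
    have := star_left_conjugate_le_conjugate (hE.mono hmn) (CFC.sqrt x)
    rwa [hys] at this
  refine ⟨(τ.iSup_eq_of_tendsto (S := fun n => CFC.sqrt x * E n * CFC.sqrt x)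
    (fun n => mul_mem (mul_mem hyM (hE.fin n).1) hyM) (fun n => ?_) hm fun v => ?_).2, hm⟩
  · have := star_left_conjugate_nonneg (hE.fin n).2.1 (CFC.sqrt x)
    rwa [hys] at this
  · have := ((CFC.sqrt x).continuous.tendsto _).comp (hE.lim (CFC.sqrt x v))
    have e : CFC.sqrt x (CFC.sqrt x v) = x v := by
      conv_rhs => rw [← CFC.sqrt_mul_sqrt_self x h0]
      rfl
    rw [e] at this
    exact this

theorem trace_sqrt_conj {E x : H →L[ℂ] H} (hE : E ∈ τ.posFin) (hx : x ∈ M) (h0 : 0 ≤ x) :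
    CFC.sqrt x * E * CFC.sqrt x ∈ τ.posFin ∧
      τ.trace (E * x) = ((τ.toFun (CFC.sqrt x * E * CFC.sqrt x)).toReal : ℂ) := by
  have hys : star (CFC.sqrt x) = CFC.sqrt x :=
    (IsSelfAdjoint.of_nonneg (CFC.sqrt_nonneg x)).star_eq
  have hyM : CFC.sqrt x ∈ M := vN_sqrt_mem hx
  have h1 := posFin_conj hE hyM
  rw [hys] at h1
  refine ⟨h1, ?_⟩
  rw [← trace_of_posFin h1, mul_assoc, trace_mul_comm (mem_l1_mul (posFin_subset_l1 hE) hyM) hyM,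
    mul_assoc, CFC.sqrt_mul_sqrt_self x h0]

/-- Regularization of the trace. -/
theorem tendsto_trace_mul {E : ℕ → H →L[ℂ] H} (hE : IsApproxUnit τ E) {T : H →L[ℂ] H}
    (hT : T ∈ τ.l1) : Tendsto (fun n => τ.trace (E n * T)) atTop (𝓝 (τ.trace T)) := by
  induction hT using Submodule.span_induction with
  | mem x h =>
    obtain ⟨h1, h2⟩ := sqrt_conj_approx hE h.1 h.2.1
    have h3 : Tendsto (fun n => τ.toFun (CFC.sqrt x * E n * CFC.sqrt x)) atTop
        (𝓝 (τ.toFun x)) := by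
      rw [h1]
      refine tendsto_atTop_iSup fun m n hmn => ?_
      have a := (trace_sqrt_conj (hE.fin m) h.1 h.2.1).1
      exact τ.mono a.1 (trace_sqrt_conj (hE.fin n) h.1 h.2.1).1.1 a.2.1 (h2 hmn)
    have h4 := (ENNReal.tendsto_toReal h.2.2.ne).comp h3
    rw [trace_of_posFin h]
    refine ((Complex.continuous_ofReal.tendsto _).comp h4).congr fun n => ?_
    exact (trace_sqrt_conj (hE.fin n) h.1 h.2.1).2.symm
  | zero => simp [trace_zero]
  | add x y hx' hy' hx hy =>
    rw [trace_add hx' hy']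
    refine (hx.add hy).congr fun n => ?_
    rw [mul_add, trace_add (mul_mem_l1 hx' (hE.fin n).1) (mul_mem_l1 hy' (hE.fin n).1)]
  | smul t x hx' hx =>
    rw [trace_smul _ hx']
    refine (hx.const_mul t).congr fun n => ?_
    rw [mul_smul_comm, trace_smul _ (mul_mem_l1 hx' (hE.fin n).1)]

/-- Finiteness of τ(x) is a conclusion here: only traces regularized by Eₙ enter, and these are
always defined. -/
theorem toFun_le_of_approx {E : ℕ → H →L[ℂ] H} (hE : IsApproxUnit τ E) {x : H →L[ℂ] H}
    (hx : x ∈ M) (h0 : 0 ≤ x) {C : ℝ} (hC : ∀ n, ‖τ.trace (E n * x)‖ ≤ C) :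
    τ.toFun x ≤ ENNReal.ofReal C := by
  rw [(sqrt_conj_approx hE hx h0).1]
  refine iSup_le fun n => ?_
  obtain ⟨h1, h2⟩ := trace_sqrt_conj (hE.fin n) hx h0
  have := hC n
  rw [h2, Complex.norm_real, Real.norm_of_nonneg ENNReal.toReal_nonneg] at this
  rw [← ENNReal.ofReal_toReal h1.2.2.ne]
  exact ENNReal.ofReal_le_ofReal this

/-- Testing against V = `cutoff n` of x, a contraction, bounds the trace of Vx, and these operators
increase to x⁺. -/
theorem posPart_mem_of_approx {E : ℕ → H →L[ℂ] H} (hE : IsApproxUnit τ E) {x : H →L[ℂ] H}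
    (hx : x ∈ M) (hs : IsSelfAdjoint x) {C : ℝ} (hC0 : 0 ≤ C)
    (hC : ∀ n, ∀ V ∈ M, ‖τ.trace (E n * (V * x))‖ ≤ ‖V‖ * C) : x⁺ ∈ τ.posFin := by
  refine ⟨vN_posPart_mem hx, CFC.posPart_nonneg x,
    lt_of_le_of_lt (b := ENNReal.ofReal C) ?_ ENNReal.ofReal_lt_top⟩
  rw [posPart_eq_cfc]
  have h0 : ∀ n t, 0 ≤ cutoff n t * t := fun n t => by
    rw [cutoff_mul]; exact mul_nonneg (cutoff_nonneg n t) (posPart_nonneg t)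
  refine τ.cfc_le_of_approx (f := fun n t => cutoff n t * t) hx
    (fun n => ((continuous_cutoff n).mul continuous_id).continuousOn) (fun n t _ => h0 n t) ?_ ?_ ?_
  · intro t _ m n hmn
    simp only [cutoff_mul]
    exact mul_le_mul_of_nonneg_right (cutoff_mono t hmn) (posPart_nonneg t)
  · refine tendstoUniformlyOn_of_le (C := 1) fun n t _ => ?_
    have := posPart_sub_cutoff_mul n t
    rw [cutoff_mul, abs_of_nonneg this.1, one_mul]
    exact this.2
  · intro n
    refine toFun_le_of_approx hE (vN_cfc_mem _ hx) (cfc_nonneg fun t _ => h0 n t) fun k => ?_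
    rw [cfc_mul (cutoff n) (fun t => t) x (continuous_cutoff n).continuousOn continuousOn_id,
      cfc_id' ℝ x hs]
    refine (hC k _ (vN_cfc_mem _ hx)).trans (mul_le_of_le_one_left hC0 ?_)
    refine norm_cfc_le zero_le_one fun t _ => ?_
    rw [Real.norm_of_nonneg (cutoff_nonneg n t)]
    exact cutoff_le_one n t

theorem mem_l1_of_approx_of_isSelfAdjoint {E : ℕ → H →L[ℂ] H} (hE : IsApproxUnit τ E)
    {x : H →L[ℂ] H} (hx : x ∈ M) (hs : IsSelfAdjoint x) {C : ℝ} (hC0 : 0 ≤ C)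
    (hC : ∀ n, ∀ V ∈ M, ‖τ.trace (E n * (V * x))‖ ≤ ‖V‖ * C) : x ∈ τ.l1 := by
  have h1 := posPart_mem_of_approx hE hx hs hC0 hC
  have h2 := posPart_mem_of_approx hE (neg_mem hx) hs.neg hC0 fun n V hV => by
    have := hC n (-V) (neg_mem hV)
    rwa [norm_neg, neg_mul_comm] at this
  rw [CFC.posPart_neg] at h2
  rw [← CFC.posPart_sub_negPart x hs]
  exact sub_mem (posFin_subset_l1 h1) (posFin_subset_l1 h2)

/-- A criterion for being trace class. -/
theorem mem_l1_of_approx {E : ℕ → H →L[ℂ] H} (hE : IsApproxUnit τ E)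
    {T : H →L[ℂ] H} (hT : T ∈ M) {C : ℝ} (hC0 : 0 ≤ C)
    (hC : ∀ n, ∀ V ∈ M, ∀ W ∈ M, ‖τ.trace (E n * (V * T * W))‖ ≤ ‖V‖ * ‖W‖ * C) : T ∈ τ.l1 := by
  have hEl : ∀ n, E n ∈ τ.l1 := fun n => posFin_subset_l1 (hE.fin n)
  have h1 : ∀ n, ∀ V ∈ M, ‖τ.trace (E n * (V * T))‖ ≤ ‖V‖ * C := fun n V hV => by
    have := hC n V hV 1 (one_mem M)
    rw [mul_one] at this
    refine this.trans ?_
    gcongr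
    exact mul_le_of_le_one_right (norm_nonneg V) ContinuousLinearMap.norm_id_le
  -- The adjoint is reached by conjugating the trace, which moves V to the right of T. This is why
  -- the hypothesis allows factors on both sides.
  have h2 : ∀ n, ∀ V ∈ M, ‖τ.trace (E n * (V * star T))‖ ≤ ‖V‖ * C := fun n V hV => by
    have := hC n 1 (one_mem M) (star V) (star_mem hV)
    rw [one_mul, norm_star] at this
    have e : E n * (V * star T) = star (T * star V * E n) := by
      rw [star_mul, star_mul, star_star, (IsSelfAdjoint.of_nonneg (hE.fin n).2.1).star_eq]
    have hm : T * star V ∈ M := mul_mem hT (star_mem hV)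
    rw [e, trace_star (mul_mem_l1 (hEl n) hm), norm_star, trace_mul_comm (hEl n) hm]
    refine this.trans ?_
    gcongr
    exact mul_le_of_le_one_left (norm_nonneg V) ContinuousLinearMap.norm_id_le
  have hm1 : ∀ {V S : H →L[ℂ] H} (n), V ∈ M → S ∈ M → E n * (V * S) ∈ τ.l1 :=
    fun n hV hS => mem_l1_mul (hEl n) (mul_mem hV hS)
  rw [← realPart_add_I_smul_imaginaryPart T]
  refine add_mem ?_ (Submodule.smul_mem _ _ ?_)
  · refine mem_l1_of_approx_of_isSelfAdjoint hE (vN_realPart_mem hT) (realPart T).2 hC0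
      fun n V hV => ?_
    have e : E n * (V * (realPart T : H →L[ℂ] H)) =
        (2⁻¹ : ℂ) • (E n * (V * T) + E n * (V * star T)) := by
      rw [realPart_apply_coe, ← Complex.coe_smul]
      simp only [mul_add, smul_add, mul_smul_comm]
      norm_num
    rw [e, trace_smul _ (add_mem (hm1 n hV hT) (hm1 n hV (star_mem hT))),
      trace_add (hm1 n hV hT) (hm1 n hV (star_mem hT)), norm_mul]
    have := norm_add_le (τ.trace (E n * (V * T))) (τ.trace (E n * (V * star T)))
    have h3 := h1 n V hV
    have h4 := h2 n V hV
    norm_num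
    linarith
  · refine mem_l1_of_approx_of_isSelfAdjoint hE (vN_imaginaryPart_mem hT) (imaginaryPart T).2 hC0
      fun n V hV => ?_
    have e : E n * (V * (imaginaryPart T : H →L[ℂ] H)) =
        (-Complex.I * 2⁻¹ : ℂ) • (E n * (V * T) - E n * (V * star T)) := by
      rw [imaginaryPart_apply_coe, ← Complex.coe_smul, smul_smul]
      simp only [mul_sub, smul_sub, mul_smul_comm]
      norm_num
    rw [e, trace_smul _ (sub_mem (hm1 n hV hT) (hm1 n hV (star_mem hT))),
      trace_sub (hm1 n hV hT) (hm1 n hV (star_mem hT)), norm_mul]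
    have := norm_sub_le (τ.trace (E n * (V * T))) (τ.trace (E n * (V * star T)))
    have h3 := h1 n V hV
    have h4 := h2 n V hV
    norm_num
    linarith

/-- The functional `Y ↦ τ(S Y)` extends from `M` to a bounded functional. -/
theorem exists_extension {S : H →L[ℂ] H} (hS : S ∈ τ.posFin) :
    ∃ f : (H →L[ℂ] H) →L[ℂ] ℂ, ∀ Y ∈ M, f Y = τ.trace (S * Y) := by
  let p : Submodule ℂ (H →L[ℂ] H) := M.toStarSubalgebra.toSubalgebra.toSubmodule
  have hp : ∀ Y : p, (Y : H →L[ℂ] H) ∈ M := fun Y => Y.2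
  let f₀ : p →ₗ[ℂ] ℂ :=
    { toFun := fun Y => τ.trace (S * Y)
      map_add' := fun x y => by
        rw [Submodule.coe_add, mul_add, trace_add (mem_l1_mul (posFin_subset_l1 hS) (hp x))
          (mem_l1_mul (posFin_subset_l1 hS) (hp y))]
      map_smul' := fun c x => by
        rw [Submodule.coe_smul, mul_smul_comm,
          trace_smul _ (mem_l1_mul (posFin_subset_l1 hS) (hp x))]
        rfl }
  let f : p →L[ℂ] ℂ := f₀.mkContinuous (τ.toFun S).toReal fun Y => by
    have := norm_trace_mul_le hS (hp Y)
    rw [trace_mul_comm (posFin_subset_l1 hS) (hp Y), mul_comm] at this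
    exact this
  -- Hahn-Banach: the operator norm integrals take values in all bounded operators, while the trace
  -- functional is bounded only on `M`.
  obtain ⟨g, hg, _⟩ := exists_extension_norm_eq p f
  exact ⟨g, fun Y hY => hg ⟨Y, hY⟩⟩

/-- Interchange of the trace with an integral in the operator norm. -/
theorem integral_traceBound {α : Type*} [MeasurableSpace α] {μ : Measure α}
    {E : ℕ → H →L[ℂ] H} (hE : IsApproxUnit τ E) {F : α → H →L[ℂ] H} {g : α → ℝ}
    (hF : Integrable F μ) (hb : ∀ᵐ x ∂μ, τ.TraceBound (F x) (g x)) (hg : Integrable g μ)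
    (hg0 : ∀ x, 0 ≤ g x) :
    τ.TraceBound (∫ x, F x ∂μ) (∫ x, g x ∂μ) ∧ Integrable (fun x => τ.trace (F x)) μ ∧
      τ.trace (∫ x, F x ∂μ) = ∫ x, τ.trace (F x) ∂μ := by
  have hFM : ∀ᵐ x ∂μ, F x ∈ M := hb.mono fun x hx => mem_vN_of_mem_l1 hx.1
  have hTM := vN_integral_mem hF hFM
  have hEM : ∀ n, E n ∈ M := fun n => (hE.fin n).1
  have hI0 : 0 ≤ ∫ x, g x ∂μ := integral_nonneg hg0
  -- The trace need not be norm continuous, but τ(Eₙ ·) is and so commutes with the integral. The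
  -- index n goes to infinity only afterwards.
  choose f hf using fun n => exists_extension (hE.fin n)
  have key : ∀ n, ∀ V ∈ M, ∀ W ∈ M,
      τ.trace (E n * (V * (∫ x, F x ∂μ) * W)) = ∫ x, τ.trace (E n * (V * F x * W)) ∂μ := by
    intro n V hV W hW
    let L : (H →L[ℂ] H) →L[ℂ] ℂ := (f n).comp
      (((ContinuousLinearMap.mul ℂ (H →L[ℂ] H)).flip W).comp
        (ContinuousLinearMap.mul ℂ (H →L[ℂ] H) V))
    have hL : ∀ Y ∈ M, L Y = τ.trace (E n * (V * Y * W)) := fun Y hY =>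
      hf n _ (mul_mem (mul_mem hV hY) hW)
    rw [← hL _ hTM, ← L.integral_comp_comm hF]
    refine integral_congr_ae ?_
    filter_upwards [hFM] with x hx
    exact hL _ hx
  have hbd : ∀ n, ∀ V ∈ M, ∀ W ∈ M, ∀ᵐ x ∂μ,
      ‖τ.trace (E n * (V * F x * W))‖ ≤ ‖V‖ * ‖W‖ * g x := by
    intro n V hV W hW
    filter_upwards [hb] with x hx
    have h1 := (hx.mul_left (hg0 x) hV).mul_right (mul_nonneg (norm_nonneg V) (hg0 x)) hW
    refine (h1.2 (E n) (hEM n)).trans ?_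
    refine (mul_le_of_le_one_left ?_ (hE.norm_le n)).trans (le_of_eq (by ring))
    exact mul_nonneg (norm_nonneg _) (mul_nonneg (norm_nonneg _) (hg0 x))
  have hbI : ∀ n, ∀ V ∈ M, ∀ W ∈ M,
      ‖τ.trace (E n * (V * (∫ x, F x ∂μ) * W))‖ ≤ ‖V‖ * ‖W‖ * ∫ x, g x ∂μ := by
    intro n V hV W hW
    rw [key n V hV W hW, ← integral_const_mul]
    exact norm_integral_le_of_norm_le (hg.const_mul _) (hbd n V hV W hW)
  have hl := mem_l1_of_approx hE hTM hI0 hbI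
  have hlim := tendsto_trace_mul hE hl
  have hae : ∀ n, AEStronglyMeasurable (fun x => τ.trace (E n * F x)) μ := fun n =>
    (((f n).integrable_comp hF).1).congr (hFM.mono fun x hx => hf n _ hx)
  have hptw : ∀ᵐ x ∂μ, Tendsto (fun n => τ.trace (E n * F x)) atTop (𝓝 (τ.trace (F x))) :=
    hb.mono fun x hx => tendsto_trace_mul hE hx.1
  -- Measurability of the trace is not assumed; it is inherited as a pointwise limit.
  have hms : AEStronglyMeasurable (fun x => τ.trace (F x)) μ :=
    aestronglyMeasurable_of_tendsto_ae atTop hae hptw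
  have hone : ∀ n, ∀ᵐ x ∂μ, ‖τ.trace (E n * F x)‖ ≤ g x := fun n => by
    filter_upwards [hb] with x hx
    exact (hx.2 (E n) (hEM n)).trans (mul_le_of_le_one_left (hg0 x) (hE.norm_le n))
  refine ⟨⟨hl, fun W hW => ?_⟩, hg.mono' hms (hb.mono fun x hx => ?_), ?_⟩
  · refine le_of_tendsto ((tendsto_trace_mul hE (mul_mem_l1 hl hW)).norm)
      (Eventually.of_forall fun n => ?_)
    have := hbI n W hW 1 (one_mem M)
    rw [mul_one] at this
    refine this.trans ?_
    gcongr
    exact mul_le_of_le_one_right (norm_nonneg W) ContinuousLinearMap.norm_id_le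
  · exact norm_le_of_traceBound hx (hg0 x)
  · have h1 := tendsto_integral_of_dominated_convergence g hae hg hone hptw
    refine tendsto_nhds_unique hlim (h1.congr fun n => ?_)
    have := key n 1 (one_mem M) 1 (one_mem M)
    simp only [one_mul, mul_one] at this
    exact this.symm

end FNSTrace

end

section

open MeasureTheory Filter Topology

variable {H : Type*} [NormedAddCommGroup H] [InnerProductSpace ℂ H] [CompleteSpace H]
variable {M : VonNeumannAlgebra H}

theorem clm_mul_apply (S T : H →L[ℂ] H) (x : H) : (S * T) x = S (T x) := rfl

/-! ### Resolvents of `D²` and commutators through the graph of `D` -/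

/-- `D` is densely defined and symmetric. -/
structure IsDenseSymm (D : H →ₗ.[ℂ] H) : Prop where
  dense : Dense (D.domain : Set H)
  symm : ∀ x u y v, (x, u) ∈ D.graph → (y, v) ∈ D.graph → inner ℂ u y = inner ℂ x v

theorem isDenseSymm_of_isSelfAdjoint {D : H →ₗ.[ℂ] H} (hd : Dense (D.domain : Set H))
    (hs : IsSelfAdjoint D) : IsDenseSymm D := by
  refine ⟨hd, fun x u y v hx hy => ?_⟩
  have h := D.adjoint_isFormalAdjoint hd
  rw [LinearPMap.isSelfAdjoint_def.1 hs] at h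
  rw [LinearPMap.mem_graph_iff] at hx hy
  obtain ⟨x', hx', hu⟩ := hx
  obtain ⟨y', hy', hv⟩ := hy
  simp only at hx' hu hy' hv
  subst hx' hu hy' hv
  exact h x' y'

/-- `T = (z - D²)⁻¹`, in terms of the graph of `D`. -/
def IsSqResolvent (D : H →ₗ.[ℂ] H) (z : ℂ) (T : H →L[ℂ] H) : Prop :=
  (∀ x, ∃ u, (T x, u) ∈ D.graph ∧ (u, z • T x - x) ∈ D.graph) ∧
    ∀ y u v, (y, u) ∈ D.graph → (u, v) ∈ D.graph → T (z • y - v) = y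

/-- In graph form the resolvent identities can be combined linearly, without carrying proofs of
membership in the domains of D and D². -/
theorem isResolventAt_iff {D : H →ₗ.[ℂ] H} {z : ℂ} {T : H →L[ℂ] H} :
    IsResolventAt (sq D) z T ↔ IsSqResolvent D z T := by
  constructor
  · rintro ⟨h1, h2⟩
    refine ⟨fun x => ?_, fun y u v hy hu => ?_⟩
    · obtain ⟨⟨h, h'⟩, he⟩ := h1 x
      replace he : z • T x - D ⟨D ⟨T x, h⟩, h'⟩ = x := he
      refine ⟨D ⟨T x, h⟩, D.mem_graph ⟨T x, h⟩, ?_⟩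
      have : z • T x - x = D ⟨D ⟨T x, h⟩, h'⟩ := by
        rw [sub_eq_iff_eq_add] at he
        rw [he]; abel
      rw [this]
      exact D.mem_graph ⟨_, h'⟩
    · rw [LinearPMap.mem_graph_iff] at hy hu
      obtain ⟨y', hy', rfl⟩ := hy
      obtain ⟨u', hu', rfl⟩ := hu
      simp only at hy' hu'
      subst hy'
      have hm : D y' ∈ D.domain := hu' ▸ u'.2
      have : T (z • (y' : H) - D ⟨D ⟨y', y'.2⟩, hm⟩) = y' := h2 ⟨y', ⟨y'.2, hm⟩⟩
      have e : (⟨D ⟨(y' : H), y'.2⟩, hm⟩ : D.domain) = u' := Subtype.ext hu'.symm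
      rw [e] at this
      exact this
  · rintro ⟨h1, h2⟩
    refine ⟨fun x => ?_, fun y => ?_⟩
    · obtain ⟨u, hu, hv⟩ := h1 x
      rw [LinearPMap.mem_graph_iff] at hu hv
      obtain ⟨y', hy', hy''⟩ := hu
      obtain ⟨u', hu', hu''⟩ := hv
      simp only at hy' hu' hy'' hu''
      have m1 : T x ∈ D.domain := hy' ▸ y'.2
      have e1 : (⟨T x, m1⟩ : D.domain) = y' := Subtype.ext hy'.symm
      have m2 : D ⟨T x, m1⟩ ∈ D.domain := by rw [e1, hy'', ← hu']; exact u'.2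
      refine ⟨⟨m1, m2⟩, ?_⟩
      change z • T x - D ⟨D ⟨T x, m1⟩, m2⟩ = x
      have e3 : D ⟨T x, m1⟩ = D y' := congrArg D e1
      have e2 : (⟨D ⟨T x, m1⟩, m2⟩ : D.domain) = u' := Subtype.ext (by rw [hu', ← hy'']; exact e3)
      rw [e2, hu'']
      abel
    · obtain ⟨y, h, h'⟩ := y
      exact h2 y _ _ (D.mem_graph ⟨y, h⟩) (D.mem_graph ⟨_, h'⟩)

theorem IsSqResolvent.unique {D : H →ₗ.[ℂ] H} {z : ℂ} {T T' : H →L[ℂ] H}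
    (h : IsSqResolvent D z T) (h' : IsSqResolvent D z T') : T = T' := by
  ext x
  obtain ⟨u, hu, hv⟩ := h.1 x
  have := h'.2 _ _ _ hu hv
  rw [sub_sub_cancel] at this
  exact this.symm

theorem resolventOp_eq {D : H →ₗ.[ℂ] H} {z : ℂ} {T : H →L[ℂ] H} (h : IsSqResolvent D z T) :
    resolventOp (sq D) z = T := by
  have hex : ∃ T, IsResolventAt (sq D) z T := ⟨T, isResolventAt_iff.2 h⟩
  rw [resolventOp, dif_pos hex]
  exact (isResolventAt_iff.1 hex.choose_spec).unique h

theorem isCommutator_graph {D : H →ₗ.[ℂ] H} {a C : H →L[ℂ] H} (h : IsCommutator D a C)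
    {x u : H} (hx : (x, u) ∈ D.graph) : (a x, a u + C x) ∈ D.graph := by
  rw [LinearPMap.mem_graph_iff] at hx
  obtain ⟨x', hx', hu⟩ := hx
  simp only at hx' hu
  subst hx' hu
  obtain ⟨h1, h2⟩ := h x'
  rw [← h2]
  have := D.mem_graph ⟨_, h1⟩
  simpa using this

theorem isCommutator_unique {D : H →ₗ.[ℂ] H} (hd : Dense (D.domain : Set H))
    {a C C' : H →L[ℂ] H} (h : IsCommutator D a C) (h' : IsCommutator D a C') : C = C' := by
  refine ContinuousLinearMap.ext_on (s := (D.domain : Set H)) ?_ fun x hx => ?_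
  · rw [Submodule.span_eq]; exact hd
  · obtain ⟨h1, h2⟩ := h ⟨x, hx⟩
    obtain ⟨h1', h2'⟩ := h' ⟨x, hx⟩
    exact h2.symm.trans h2'

theorem comm_eq {D : H →ₗ.[ℂ] H} (hd : Dense (D.domain : Set H))
    {a C : H →L[ℂ] H} (h : IsCommutator D a C) : comm D a = C := by
  have hex : ∃ C, IsCommutator D a C := ⟨C, h⟩
  rw [comm, dif_pos hex]
  exact isCommutator_unique hd hex.choose_spec h

theorem isCommutator_comm {D : H →ₗ.[ℂ] H} {a : H →L[ℂ] H} (h : ∃ C, IsCommutator D a C) :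
    IsCommutator D a (comm D a) := by
  rw [comm, dif_pos h]
  exact h.choose_spec

theorem isCommutator_mul {D : H →ₗ.[ℂ] H} {a b C C' : H →L[ℂ] H}
    (h : IsCommutator D a C) (h' : IsCommutator D b C') :
    IsCommutator D (a * b) (C * b + a * C') := by
  intro x
  obtain ⟨h1, h2⟩ := h' x
  obtain ⟨h3, h4⟩ := h ⟨_, h1⟩
  refine ⟨h3, ?_⟩
  change D ⟨a (b x), h3⟩ - a (b (D x)) = C (b x) + a (C' x)
  have e : D ⟨b x, h1⟩ = C' x + b (D x) := by rw [← h2]; abel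
  rw [e, _root_.map_add, sub_eq_iff_eq_add] at h4
  rw [h4]
  abel

/-- An element of the commutant preserves dom D, commutes with D there and commutes with a. Hence it
commutes with [D, a] on a dense subspace. -/
theorem isCommutator_mem {D : H →ₗ.[ℂ] H} (hd : Dense (D.domain : Set H))
    (haff : IsAffiliated M D) {a C : H →L[ℂ] H} (ha : a ∈ M) (h : IsCommutator D a C) : C ∈ M := by
  refine vN_mem_of_commute fun S hS => ?_
  refine ContinuousLinearMap.ext_on (s := (D.domain : Set H)) ?_ fun x hx => ?_
  · rw [Submodule.span_eq]; exact hd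
  · obtain ⟨h1, h2⟩ := h ⟨x, hx⟩
    obtain ⟨h3, h4⟩ := haff S hS ⟨x, hx⟩
    obtain ⟨h5, h6⟩ := haff S hS ⟨a x, h1⟩
    obtain ⟨h7, h8⟩ := h ⟨S x, h3⟩
    have hc : ∀ y, S (a y) = a (S y) := fun y => by
      have := congrArg (fun T : H →L[ℂ] H => T y) (vN_commute ha hS).eq
      exact this.symm
    change S (C x) = C (S x)
    rw [← h2, ← h8]
    simp only [map_sub]
    have e : (⟨a (S x), h7⟩ : D.domain) = ⟨S (a x), h5⟩ := Subtype.ext (hc x).symm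
    rw [e, h6, hc, h4]

theorem graph_affiliated {D : H →ₗ.[ℂ] H} (haff : IsAffiliated M D) {S : H →L[ℂ] H}
    (hS : S ∈ M.commutant) {x u : H} (hx : (x, u) ∈ D.graph) : (S x, S u) ∈ D.graph := by
  rw [LinearPMap.mem_graph_iff] at hx
  obtain ⟨x', hx', hu⟩ := hx
  simp only at hx' hu
  subst hx' hu
  obtain ⟨h1, h2⟩ := haff S hS x'
  rw [← h2]
  exact D.mem_graph ⟨_, h1⟩

namespace IsSqResolvent

variable {D : H →ₗ.[ℂ] H} {z : ℂ} {T : H →L[ℂ] H}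

theorem mem (h : IsSqResolvent D z T) (haff : IsAffiliated M D) : T ∈ M := by
  refine vN_mem_of_commute fun S hS => ?_
  ext x
  obtain ⟨u, hu, hv⟩ := h.1 x
  have := h.2 _ _ _ (graph_affiliated haff hS hu) (graph_affiliated haff hS hv)
  rw [map_sub S, map_smul S, sub_sub_cancel] at this
  exact this.symm

/-- `D (z - D²)⁻¹` is bounded. -/
theorem exists_mul (h : IsSqResolvent D z T) (hD : IsDenseSymm D) :
    ∃ Q : H →L[ℂ] H, ∀ x, (T x, Q x) ∈ D.graph ∧ (Q x, z • T x - x) ∈ D.graph := by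
  choose q hq using h.1
  have hadd : ∀ x y, q (x + y) = q x + q y := fun x y => by
    refine D.mem_graph_snd_inj (hq (x + y)).1 (add_mem (hq x).1 (hq y).1) ?_
    simp
  have hsmul : ∀ (c : ℂ) x, q (c • x) = c • q x := fun c x => by
    refine D.mem_graph_snd_inj (hq (c • x)).1 (Submodule.smul_mem _ c (hq x).1) ?_
    simp
  let q' : H →ₗ[ℂ] H := { toFun := q, map_add' := hadd, map_smul' := hsmul }
  refine ⟨q'.mkContinuous (Real.sqrt (‖T‖ * (‖z‖ * ‖T‖ + 1))) fun x => ?_, hq⟩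
  -- With Q = DT, symmetry gives ‖Qx‖² = ⟨Tx, D²Tx⟩ = ⟨Tx, zTx - x⟩, which is bounded by a multiple
  -- of ‖x‖².
  have h1 := hD.symm _ _ _ _ (hq x).1 (hq x).2
  have h2 : ‖q x‖ ^ 2 = ‖inner ℂ (T x) (z • T x - x)‖ := by
    rw [← h1, inner_self_eq_norm_sq_to_K]
    simp
  have h3 : ‖inner ℂ (T x) (z • T x - x)‖ ≤ (‖T‖ * (‖z‖ * ‖T‖ + 1)) * ‖x‖ ^ 2 := by
    refine (norm_inner_le_norm _ _).trans ?_
    have a1 := T.le_opNorm x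
    have a2 : ‖z • T x - x‖ ≤ (‖z‖ * ‖T‖ + 1) * ‖x‖ := by
      refine (norm_sub_le _ _).trans ?_
      rw [norm_smul, add_mul, one_mul, mul_assoc]
      gcongr
    calc ‖T x‖ * ‖z • T x - x‖ ≤ (‖T‖ * ‖x‖) * ((‖z‖ * ‖T‖ + 1) * ‖x‖) := by gcongr
      _ = _ := by ring
  change ‖q x‖ ≤ _
  rw [← Real.sqrt_sq (norm_nonneg x), ← Real.sqrt_mul' _ (sq_nonneg _)]
  exact Real.le_sqrt_of_sq_le (h2 ▸ h3)

variable {Q : H →L[ℂ] H}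

/-- D commutes with its resolvent: D²Qx = zQx - u, so z - D² maps Qx to u, and T inverts it. -/
theorem mul_graph (h : IsSqResolvent D z T)
    (hQ : ∀ x, (T x, Q x) ∈ D.graph ∧ (Q x, z • T x - x) ∈ D.graph) {x u : H}
    (hx : (x, u) ∈ D.graph) : Q x = T u := by
  have h1 := sub_mem (Submodule.smul_mem _ z (hQ x).1) hx
  have := h.2 _ _ _ (hQ x).2 h1
  have e : z • Q x - ((z • (T x, Q x)).2 - u) = u := sub_sub_cancel _ _
  rw [← this]
  exact congrArg T e

/-- The commutator of a resolvent with a bounded operator. -/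
theorem commutator (h : IsSqResolvent D z T)
    (hQ : ∀ x, (T x, Q x) ∈ D.graph ∧ (Q x, z • T x - x) ∈ D.graph) {a C : H →L[ℂ] H}
    (ha : IsCommutator D a C) : T * a - a * T = Q * C * T + T * C * Q := by
  -- Formally Ta - aT = T[D², a]T = T(DC + CD)T. Each product is read through the graph, since aTx
  -- need not lie in dom D².
  ext x
  obtain ⟨h1, h2⟩ := hQ x
  have g1 := isCommutator_graph ha h1
  have g2 := isCommutator_graph ha h2
  -- `T(a D² y) = Q (a D y) - T (C D y)` and `Q (a D y) = Q (D (a y) - C y)`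
  have e1 := h.mul_graph hQ g2
  have e2 : Q (a (Q x) + C (T x)) = z • T (a (T x)) - a (T x) := by
    have b1 := (hQ (a (T x))).2
    rw [h.mul_graph hQ g1] at b1
    exact D.mem_graph_snd_inj (hQ (a (Q x) + C (T x))).1 b1 rfl
  simp only [map_add, map_sub, map_smul] at e1 e2
  change T (a x) - a (T x) = Q (C (T x)) + T (C (Q x))
  have : T (a x) - a (T x) = Q (C (T x)) + T (C (Q x)) := by
    have e3 : Q (a (Q x)) = z • T (a (T x)) - a (T x) - Q (C (T x)) := eq_sub_of_add_eq e2
    rw [e3] at e1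
    have e4 : T (a x) = z • T (a (T x)) + T (C (Q x)) -
        (z • T (a (T x)) - a (T x) - Q (C (T x))) := by rw [e1]; abel
    rw [e4]; abel
  exact this

theorem mul_mem (h : IsSqResolvent D z T) (haff : IsAffiliated M D)
    (hQ : ∀ x, (T x, Q x) ∈ D.graph ∧ (Q x, z • T x - x) ∈ D.graph) : Q ∈ M := by
  refine vN_mem_of_commute fun S hS => ?_
  ext x
  have h1 := graph_affiliated haff hS (hQ x).1
  have h2 : S (T x) = T (S x) := by
    have := congrArg (fun T : H →L[ℂ] H => T x) (vN_commute (h.mem haff) hS).eq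
    exact this.symm
  rw [h2] at h1
  exact D.mem_graph_snd_inj h1 (hQ (S x)).1 rfl

/-- The norm of the resolvent off the spectrum. -/
theorem norm_apply_le (hD : IsDenseSymm D) (h : IsSqResolvent D z T) (x : H) :
    ‖T x‖ * Real.sqrt (z.im ^ 2 + (max 0 (-z.re)) ^ 2) ≤ ‖x‖ := by
  obtain ⟨u, h1, h2⟩ := h.1 x
  have h3 := hD.symm _ _ _ _ h1 h2
  rw [inner_self_eq_norm_sq_to_K, inner_sub_right, inner_smul_right,
    inner_self_eq_norm_sq_to_K] at h3
  -- With u = DTx, the imaginary part is Im z ‖Tx‖² and the real part is at most Re z ‖Tx‖². The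
  -- square root in the statement is the distance from z to [0, ∞).
  have h4 : inner ℂ (T x) x = z * ((‖T x‖ : ℂ)) ^ 2 - (‖u‖ : ℂ) ^ 2 := by
    rw [eq_sub_iff_add_eq, ← eq_sub_iff_add_eq']
    exact h3
  rcases eq_or_ne (T x) 0 with h0 | h0
  · simp [h0]
  have hp : 0 < ‖T x‖ := norm_pos_iff.2 h0
  have h5 : (inner ℂ (T x) x).im = z.im * ‖T x‖ ^ 2 := by
    rw [h4, ← Complex.ofReal_pow, ← Complex.ofReal_pow]; simp [-Complex.ofReal_pow]
  have h6 : (inner ℂ (T x) x).re = z.re * ‖T x‖ ^ 2 - ‖u‖ ^ 2 := by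
    rw [h4, ← Complex.ofReal_pow, ← Complex.ofReal_pow]; simp [-Complex.ofReal_pow]
  have h7 : ‖inner ℂ (T x) x‖ ≤ ‖T x‖ * ‖x‖ := norm_inner_le_norm _ _
  have h8 : ‖inner ℂ (T x) x‖ ^ 2 = (inner ℂ (T x) x).re ^ 2 + (inner ℂ (T x) x).im ^ 2 := by
    rw [← Complex.normSq_eq_norm_sq, Complex.normSq_apply]; ring
  have h9 : (z.im ^ 2 + (max 0 (-z.re)) ^ 2) * ‖T x‖ ^ 4 ≤ ‖inner ℂ (T x) x‖ ^ 2 := by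
    rw [h8, h5, h6]
    have : (max 0 (-z.re)) ^ 2 * ‖T x‖ ^ 4 ≤ (z.re * ‖T x‖ ^ 2 - ‖u‖ ^ 2) ^ 2 := by
      rcases le_total 0 (-z.re) with hz | hz
      · rw [max_eq_right hz]
        have a1 : 0 ≤ -z.re * ‖T x‖ ^ 2 := by positivity
        nlinarith [sq_nonneg (‖u‖ ^ 2), sq_nonneg ‖u‖, mul_nonneg a1 (sq_nonneg ‖u‖)]
      · rw [max_eq_left hz]
        nlinarith [sq_nonneg (z.re * ‖T x‖ ^ 2 - ‖u‖ ^ 2)]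
    nlinarith
  have h10 : (‖T x‖ * Real.sqrt (z.im ^ 2 + (max 0 (-z.re)) ^ 2)) * ‖T x‖ ≤ ‖x‖ * ‖T x‖ := by
    refine le_trans ?_ ((mul_comm _ _).le.trans' h7)
    refine abs_le_of_sq_le_sq' ?_ (norm_nonneg _) |>.2
    refine le_trans (le_of_eq ?_) h9
    rw [mul_pow, mul_pow, Real.sq_sqrt (by positivity)]
    ring
  exact le_of_mul_le_mul_right h10 hp

end IsSqResolvent

/-- The resolvent of `D²` at `-1` from the resolvents of `D` at `± i`. -/
theorem exists_isSqResolvent_neg_one {D : H →ₗ.[ℂ] H} {T T' : H →L[ℂ] H}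
    (h : IsResolventAt D Complex.I T) (h' : IsResolventAt D (-Complex.I) T') :
    IsSqResolvent D (-1) (-(T' * T)) := by
  have key : ∀ {z : ℂ} {S : H →L[ℂ] H}, IsResolventAt D z S →
      (∀ x, (S x, z • S x - x) ∈ D.graph) ∧ ∀ x u, (x, u) ∈ D.graph → S (z • x - u) = x := by
    intro z S hS
    constructor
    · intro x
      obtain ⟨h1, h2⟩ := hS.1 x
      have : z • S x - x = D ⟨S x, h1⟩ := by
        nth_rewrite 2 [← h2]; abel
      rw [this]
      exact D.mem_graph ⟨_, h1⟩
    · intro x u hx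
      rw [LinearPMap.mem_graph_iff] at hx
      obtain ⟨x', hx', hu⟩ := hx
      simp only at hx' hu
      subst hx' hu
      exact hS.2 x'
  obtain ⟨a1, a2⟩ := key h
  obtain ⟨b1, b2⟩ := key h'
  -- The factorization used is (i - D)(-i - D) = 1 + D².
  refine ⟨fun x => ?_, fun y u v hy hu => ?_⟩
  · have c1 := neg_mem (b1 (T x))
    refine ⟨_, c1, ?_⟩
    have c2 := neg_mem (sub_mem (Submodule.smul_mem _ (-Complex.I) (b1 (T x))) (a1 x))
    convert c2 using 1
    simp only [neg_smul, smul_sub, smul_neg, smul_smul, Complex.I_mul_I, one_smul, neg_apply,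
      clm_mul_apply, Prod.mk_sub_mk, Prod.smul_mk, Prod.neg_mk, Prod.mk.injEq, true_and, neg_neg]
    abel
  · have c1 := sub_mem (Submodule.smul_mem _ (-Complex.I) hy) hu
    have c2 := a2 _ _ c1
    have c3 := b2 _ _ hy
    have e : Complex.I • ((-Complex.I) • y - u) - ((-Complex.I) • u - v) =
        -((-1 : ℂ) • y - v) := by
      simp only [neg_smul, smul_sub, smul_neg, smul_smul, Complex.I_mul_I, one_smul]
      abel
    simp only [Prod.smul_fst, Prod.smul_snd] at c2
    have c4 : T (-((-1 : ℂ) • y - v)) = (-Complex.I) • y - u := by rw [← e]; exact c2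
    change -T' (T ((-1 : ℂ) • y - v)) = y
    rw [← map_neg, ← map_neg, c4, c3]

end

section

open MeasureTheory Filter Topology

variable {H : Type*} [NormedAddCommGroup H] [InnerProductSpace ℂ H] [CompleteSpace H]
variable {M : VonNeumannAlgebra H}

/-! ### The heat semigroup `e^{-t(1+D²)}` as a function of `A = (1+D²)⁻¹` -/

/-- The function `a ↦ e^{-t/a}`, extended by zero. -/
def heatFun (t a : ℝ) : ℝ := expNegInvGlue (a / t)

theorem heatFun_of_pos {t a : ℝ} (ht : 0 < t) (ha : 0 < a) : heatFun t a = Real.exp (-(t / a)) := by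
  rw [heatFun, expNegInvGlue, if_neg (not_le.2 (div_pos ha ht)), inv_div]

theorem heatFun_zero (t : ℝ) : heatFun t 0 = 0 := by
  rw [heatFun, zero_div, expNegInvGlue.zero]

theorem continuous_heatFun (t : ℝ) : Continuous (heatFun t) :=
  (expNegInvGlue.contDiff (n := 0)).continuous.comp (continuous_id.div_const t)

/-- The exponential decay at a = 0 absorbs the factor a⁻¹. This makes A⁻¹e^{-tA⁻¹}, and later
De^{-tA⁻¹}, a bounded operator. -/
theorem continuous_inv_mul_heatFun (t : ℝ) : Continuous fun a => a⁻¹ * heatFun t a := by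
  rcases eq_or_ne t 0 with rfl | ht
  · simp only [heatFun, div_zero, expNegInvGlue.zero, mul_zero]
    exact continuous_const
  have h := (expNegInvGlue.continuous_polynomial_eval_inv_mul Polynomial.X).comp
    (continuous_id.div_const t)
  have h2 := h.const_mul t⁻¹
  refine h2.congr fun a => ?_
  simp only [Function.comp, Polynomial.eval_X, id, heatFun]
  rw [inv_div, ← mul_assoc]
  congr 1
  field_simp

theorem heatFun_nonneg (t a : ℝ) : 0 ≤ heatFun t a := expNegInvGlue.nonneg _

/-- `0 ≤ A ≤ 1`, and `A` has dense range. -/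
structure IsInvOneAdd (A : H →L[ℂ] H) : Prop where
  nonneg : 0 ≤ A
  norm_le : ‖A‖ ≤ 1
  dense : DenseRange A

/-- `e^{-t A⁻¹}`. -/
def heat (A : H →L[ℂ] H) (t : ℝ) : H →L[ℂ] H := cfc (heatFun t) A

namespace IsInvOneAdd

variable {A : H →L[ℂ] H}

theorem isSelfAdjoint (hA : IsInvOneAdd A) : IsSelfAdjoint A := IsSelfAdjoint.of_nonneg hA.nonneg

theorem mem_Icc (hA : IsInvOneAdd A) {a : ℝ} (ha : a ∈ spectrum ℝ A) : 0 ≤ a ∧ a ≤ 1 :=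
  ⟨spectrum_nonneg_of_nonneg hA.nonneg ha, (Real.le_norm_self a).trans
    ((spectrum.norm_le_norm_mul_of_mem ha).trans (mul_le_one₀ hA.norm_le (norm_nonneg _)
      ContinuousLinearMap.norm_id_le))⟩

theorem cases (hA : IsInvOneAdd A) {a : ℝ} (ha : a ∈ spectrum ℝ A) : a = 0 ∨ (0 < a ∧ a ≤ 1) := by
  obtain ⟨h0, h1⟩ := hA.mem_Icc ha
  rcases h0.eq_or_lt with h | h
  · exact Or.inl h.symm
  · exact Or.inr ⟨h, h1⟩

theorem heat_nonneg (A : H →L[ℂ] H) (t : ℝ) : 0 ≤ heat A t := cfc_nonneg fun _ _ => heatFun_nonneg _ _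

theorem heat_mul (hA : IsInvOneAdd A) {s t : ℝ} (hs : 0 < s) (ht : 0 < t) :
    heat A s * heat A t = heat A (s + t) := by
  rw [heat, heat, heat, ← cfc_mul _ _ _ (continuous_heatFun s).continuousOn
    (continuous_heatFun t).continuousOn]
  refine cfc_congr fun a ha => ?_
  rcases hA.cases ha with rfl | ⟨h0, h1⟩
  · simp [heatFun_zero]
  · simp only [heatFun_of_pos hs h0, heatFun_of_pos ht h0, heatFun_of_pos (add_pos hs ht) h0]
    rw [← Real.exp_add]; congr 1; ring

theorem heatFun_le (hA : IsInvOneAdd A) {t : ℝ} (ht : 0 < t) {a : ℝ} (ha : a ∈ spectrum ℝ A) :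
    heatFun t a ≤ Real.exp (-t) := by
  rcases hA.cases ha with rfl | ⟨h0, h1⟩
  · rw [heatFun_zero]; positivity
  · rw [heatFun_of_pos ht h0]
    refine Real.exp_le_exp.2 (neg_le_neg ?_)
    rw [le_div_iff₀ h0]
    exact mul_le_of_le_one_right ht.le h1

theorem norm_heat_le (hA : IsInvOneAdd A) {t : ℝ} (ht : 0 < t) : ‖heat A t‖ ≤ Real.exp (-t) := by
  refine norm_cfc_le (Real.exp_pos _).le fun a ha => ?_
  rw [Real.norm_of_nonneg (heatFun_nonneg _ _)]
  exact hA.heatFun_le ht ha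

theorem heat_anti (hA : IsInvOneAdd A) {s t : ℝ} (hs : 0 < s) (hst : s ≤ t) :
    heat A t ≤ heat A s := by
  refine cfc_mono (fun a ha => ?_) (continuous_heatFun t).continuousOn
    (continuous_heatFun s).continuousOn
  rcases hA.cases ha with rfl | ⟨h0, h1⟩
  · simp [heatFun_zero]
  · rw [heatFun_of_pos hs h0, heatFun_of_pos (hs.trans_le hst) h0]
    refine Real.exp_le_exp.2 (neg_le_neg ?_)
    gcongr

/-- On the spectrum e^{-s/a}(1 - e^{-(t-s)/a}) ≤ (a/s)((t-s)/a), and the cancellation of a makes the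
bound uniform. It gives norm continuity away from t = 0. -/
theorem norm_heat_sub_le (hA : IsInvOneAdd A) {s t : ℝ} (hs : 0 < s) (hst : s ≤ t) :
    ‖heat A s - heat A t‖ ≤ (t - s) / s := by
  have ht := hs.trans_le hst
  rw [heat, heat, ← cfc_sub _ _ _ (continuous_heatFun s).continuousOn
    (continuous_heatFun t).continuousOn]
  refine norm_cfc_le (div_nonneg (sub_nonneg.2 hst) hs.le) fun a ha => ?_
  rcases hA.cases ha with rfl | ⟨h0, h1⟩
  · simp only [heatFun_zero, sub_zero, norm_zero]
    exact div_nonneg (sub_nonneg.2 hst) hs.le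
  · rw [heatFun_of_pos hs h0, heatFun_of_pos ht h0]
    have e1 : Real.exp (-(t / a)) = Real.exp (-(s / a)) * Real.exp (-((t - s) / a)) := by
      rw [← Real.exp_add]; congr 1; ring
    have e2 : 1 - (t - s) / a ≤ Real.exp (-((t - s) / a)) := by
      have := Real.add_one_le_exp (-((t - s) / a)); linarith
    have e3 : Real.exp (-((t - s) / a)) ≤ 1 := by
      rw [Real.exp_le_one_iff]
      exact neg_nonpos.2 (div_nonneg (sub_nonneg.2 hst) h0.le)
    have e4 : Real.exp (-(s / a)) ≤ a / s := by
      rw [Real.exp_neg, ← inv_div s a]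
      refine inv_anti₀ (div_pos hs h0) ?_
      have := Real.add_one_le_exp (s / a); linarith
    have e5 := Real.exp_pos (-(s / a))
    rw [e1, Real.norm_eq_abs, abs_of_nonneg (by nlinarith)]
    calc Real.exp (-(s / a)) - Real.exp (-(s / a)) * Real.exp (-((t - s) / a))
        = Real.exp (-(s / a)) * (1 - Real.exp (-((t - s) / a))) := by ring
      _ ≤ (a / s) * ((t - s) / a) := by
          refine mul_le_mul e4 (by linarith) (by linarith) (div_nonneg h0.le hs.le)
      _ = (t - s) / s := by field_simp

theorem continuousOn_heat (hA : IsInvOneAdd A) : ContinuousOn (heat A) (Set.Ioi 0) := by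
  intro t ht
  refine ContinuousAt.continuousWithinAt ?_
  have ht' : (0 : ℝ) < t := ht
  have hb : ∀ᶠ s in 𝓝 t, dist (heat A s) (heat A t) ≤ |s - t| / (t / 2) := by
    filter_upwards [lt_mem_nhds (half_lt_self ht')] with s hs
    have hs0 : 0 < s := (half_pos ht').trans hs
    rw [dist_eq_norm]
    rcases le_total s t with h | h
    · refine (hA.norm_heat_sub_le hs0 h).trans ?_
      rw [abs_sub_comm, abs_of_nonneg (sub_nonneg.2 h)]
      exact div_le_div_of_nonneg_left (sub_nonneg.2 h) (half_pos ht') hs.le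
    · rw [norm_sub_rev]
      refine (hA.norm_heat_sub_le ht' h).trans ?_
      rw [abs_of_nonneg (sub_nonneg.2 h)]
      exact div_le_div_of_nonneg_left (sub_nonneg.2 h) (half_pos ht') (half_lt_self ht').le
  rw [ContinuousAt, tendsto_iff_dist_tendsto_zero]
  refine squeeze_zero' (Eventually.of_forall fun _ => dist_nonneg) hb ?_
  have : Continuous fun s : ℝ => |s - t| / (t / 2) := by fun_prop
  have h := this.tendsto t
  simpa using h

/-- `A⁻¹ e^{-t A⁻¹}`. -/
def heatInv (A : H →L[ℂ] H) (t : ℝ) : H →L[ℂ] H := cfc (fun a => a⁻¹ * heatFun t a) A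

theorem mul_heatInv (hA : IsInvOneAdd A) (t : ℝ) :
    A * heatInv A t = heat A t ∧ heatInv A t * A = heat A t := by
  have hc : heatInv A t * A = heat A t := by
    rw [heatInv]
    conv_lhs => enter [2]; rw [← cfc_id' ℝ A hA.isSelfAdjoint]
    rw [← cfc_mul (fun a => a⁻¹ * heatFun t a) (fun a => a) A
      (continuous_inv_mul_heatFun t).continuousOn continuousOn_id, heat]
    refine cfc_congr fun a ha => ?_
    rcases hA.cases ha with rfl | ⟨h0, h1⟩
    · simp [heatFun_zero]
    · field_simp
  refine ⟨?_, hc⟩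
  rw [← hc]
  exact ((Commute.refl A).cfc_real _).eq.symm

/-- On the dense range of A the convergence is quantitative, ‖e^{-δA⁻¹}A - A‖ ≤ δ, and contractivity
extends it to all vectors. -/
theorem tendsto_heat (hA : IsInvOneAdd A) (x : H) :
    Tendsto (fun n : ℕ => heat A (1 / ((n : ℝ) + 1)) x) atTop (𝓝 x) := by
  have hd : ∀ n : ℕ, (0 : ℝ) < 1 / ((n : ℝ) + 1) := fun n => Nat.one_div_pos_of_nat
  have h1 : ∀ n : ℕ, ‖heat A (1 / ((n : ℝ) + 1))‖ ≤ 1 := fun n =>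
    (hA.norm_heat_le (hd n)).trans (Real.exp_le_one_iff.2 (neg_nonpos.2 (hd n).le))
  have h2 : ∀ n : ℕ, ‖heat A (1 / ((n : ℝ) + 1)) * A - A‖ ≤ 1 / ((n : ℝ) + 1) := fun n => by
    have e : heat A (1 / ((n : ℝ) + 1)) * A - A =
        cfc (fun a => heatFun (1 / ((n : ℝ) + 1)) a * a - a) A := by
      rw [cfc_sub (fun a => heatFun (1 / ((n : ℝ) + 1)) a * a) (fun a => a) A
          ((continuous_heatFun _).mul continuous_id).continuousOn continuousOn_id,
        cfc_mul (heatFun (1 / ((n : ℝ) + 1))) (fun a => a) A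
          (continuous_heatFun _).continuousOn continuousOn_id,
        cfc_id' ℝ A hA.isSelfAdjoint, heat]
    rw [e]
    refine norm_cfc_le (hd n).le fun a ha => ?_
    rcases hA.cases ha with rfl | ⟨h0, -⟩
    · simp only [mul_zero, sub_zero, norm_zero, (hd n).le]
    · rw [heatFun_of_pos (hd n) h0]
      set δ : ℝ := 1 / ((n : ℝ) + 1)
      have e3 : Real.exp (-(δ / a)) ≤ 1 := by
        rw [Real.exp_le_one_iff]
        exact neg_nonpos.2 (div_nonneg (hd n).le h0.le)
      have e2 := Real.add_one_le_exp (-(δ / a))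
      have e4 : δ / a * a = δ := by field_simp
      rw [Real.norm_eq_abs, abs_of_nonpos (by nlinarith)]
      nlinarith
  rw [Metric.tendsto_atTop]
  intro ε hε
  obtain ⟨y, hy⟩ := hA.dense.exists_dist_lt x (ε := ε / 3) (by positivity)
  have h3 : Tendsto (fun n : ℕ => (1 / ((n : ℝ) + 1)) * ‖y‖) atTop (𝓝 (0 * ‖y‖)) :=
    tendsto_one_div_add_atTop_nhds_zero_nat.mul_const _
  rw [zero_mul] at h3
  obtain ⟨N, hN⟩ := eventually_atTop.1 (h3.eventually_lt_const (show (0 : ℝ) < ε / 3 by positivity))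
  refine ⟨N, fun n hn => ?_⟩
  rw [dist_eq_norm] at hy ⊢
  set E := heat A (1 / ((n : ℝ) + 1)) with hE
  have e : E x - x = E (x - A y) + (E * A - A) y + (A y - x) := by
    change E x - x = E (x - A y) + (E (A y) - A y) + (A y - x)
    rw [map_sub]; abel
  have b1 : ‖E (x - A y)‖ ≤ ‖x - A y‖ := E.le_of_opNorm_le (h1 n) _ |>.trans (by rw [one_mul])
  have b2 : ‖(E * A - A) y‖ < ε / 3 := ((E * A - A).le_of_opNorm_le (h2 n) y).trans_lt (hN n hn)
  have b3 : ‖A y - x‖ < ε / 3 := by rw [norm_sub_rev]; exact hy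
  rw [e]
  refine (norm_add₃_le).trans_lt ?_
  linarith

/-! ### The Laplace transform of the heat semigroup -/

theorem integral_exp_heatFun {m : ℂ} (hm : m.re < 1) {a : ℝ} (ha : 0 ≤ a ∧ a ≤ 1) :
    ∫ t in Set.Ioi (0 : ℝ), Complex.exp (m * t) * (heatFun t a : ℂ) = a / (1 - m * a) := by
  rcases ha.1.eq_or_lt with h | h
  · simp [← h, heatFun_zero]
  · have hne : (a : ℂ) ≠ 0 := by exact_mod_cast h.ne'
    have hre : (m - 1 / (a : ℂ)).re < 0 := by
      have : (1 / (a : ℂ)).re = 1 / a := by rw [← Complex.ofReal_one, ← Complex.ofReal_div]; simp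
      rw [Complex.sub_re, this, sub_neg]
      exact hm.trans_le ((one_le_div h).2 ha.2)
    have e1 : ∫ t in Set.Ioi (0 : ℝ), Complex.exp (m * t) * (heatFun t a : ℂ) =
        ∫ t in Set.Ioi (0 : ℝ), Complex.exp ((m - 1 / (a : ℂ)) * t) := by
      refine setIntegral_congr_fun measurableSet_Ioi fun t ht => ?_
      rw [heatFun_of_pos ht h, Complex.ofReal_exp, ← Complex.exp_add]
      congr 1
      push_cast
      field_simp
      ring
    rw [e1, integral_exp_mul_complex_Ioi hre]
    have h2 : m - 1 / (a : ℂ) ≠ 0 := fun h0 => by rw [h0] at hre; exact lt_irrefl _ hre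
    have h3 : 1 - m * a ≠ 0 := fun h0 => h2 (by field_simp; linear_combination -h0)
    simp only [Complex.ofReal_zero, mul_zero, Complex.exp_zero]
    rw [div_eq_div_iff h2 h3]
    field_simp
    ring

theorem heat_eq_complex (hA : IsInvOneAdd A) (t : ℝ) :
    heat A t = cfc (fun z : ℂ => (heatFun t z.re : ℂ)) A :=
  cfc_real_eq_complex (heatFun t) hA.isSelfAdjoint

theorem spectrum_complex (hA : IsInvOneAdd A) {z : ℂ} (hz : z ∈ spectrum ℂ A) :
    z = (z.re : ℂ) ∧ 0 ≤ z.re ∧ z.re ≤ 1 := by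
  have h1 : z = z.re := hA.isSelfAdjoint.mem_spectrum_eq_re hz
  refine ⟨h1, hA.mem_Icc ?_⟩
  rw [h1] at hz
  exact spectrum.of_algebraMap_mem ℂ hz

theorem integrableOn_exp_smul_heat (hA : IsInvOneAdd A) {m : ℂ} (hm : m.re < 1) :
    IntegrableOn (fun t : ℝ => Complex.exp (m * t) • heat A t) (Set.Ioi 0) := by
  have hc : ContinuousOn (fun t : ℝ => Complex.exp (m * t) • heat A t) (Set.Ioi 0) :=
    ContinuousOn.smul (f := fun t : ℝ => Complex.exp (m * t)) (by fun_prop) hA.continuousOn_heat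
  have hg : IntegrableOn (fun t : ℝ => Real.exp ((m.re - 1) * t)) (Set.Ioi 0) :=
    integrableOn_exp_mul_Ioi (by linarith) 0
  refine Integrable.mono' hg (hc.aestronglyMeasurable measurableSet_Ioi) ?_
  filter_upwards [ae_restrict_mem measurableSet_Ioi] with t ht
  rw [norm_smul, Complex.norm_exp]
  refine (mul_le_mul_of_nonneg_left (hA.norm_heat_le ht) (Real.exp_pos _).le).trans ?_
  rw [← Real.exp_add]
  refine le_of_eq (congrArg _ ?_)
  simp
  ring

/-- `∫ e^{mt} e^{-tA⁻¹} dt = (A⁻¹ - m)⁻¹`. -/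
def laplace (A : H →L[ℂ] H) (m : ℂ) : H →L[ℂ] H :=
  ∫ t in Set.Ioi (0 : ℝ), Complex.exp (m * t) • heat A t

/-- The functional calculus commutes with the integral. It is taken over ℂ because m is complex,
although the spectrum lies in [0, 1]. -/
theorem laplace_eq_cfc (hA : IsInvOneAdd A) {m : ℂ} (hm : m.re < 1) :
    laplace A m = cfc (fun z : ℂ => z / (1 - m * z)) A := by
  have hn : IsStarNormal A := hA.isSelfAdjoint.isStarNormal
  have hcont : ContinuousOn (fun x : ℝ × ℂ => Complex.exp (m * x.1) * (heatFun x.1 x.2.re : ℂ))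
      (Set.Ioi 0 ×ˢ spectrum ℂ A) := by
    refine ContinuousOn.mul (by fun_prop) (Complex.continuous_ofReal.comp_continuousOn ?_)
    refine (expNegInvGlue.contDiff (n := 0)).continuous.comp_continuousOn
      (ContinuousOn.div (by fun_prop) (by fun_prop) ?_)
    rintro ⟨t, z⟩ ⟨ht, -⟩
    exact (Set.mem_Ioi.1 ht).ne'
  have hg : IntegrableOn (fun t : ℝ => Real.exp ((m.re - 1) * t)) (Set.Ioi 0) :=
    integrableOn_exp_mul_Ioi (by linarith) 0
  have h := cfc_setIntegral (μ := volume) (s := Set.Ioi (0 : ℝ)) measurableSet_Ioi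
    (fun (t : ℝ) (z : ℂ) => Complex.exp (m * t) * (heatFun t z.re : ℂ))
    (fun t => Real.exp ((m.re - 1) * t)) A hcont ?_ hg.2 hn
  · rw [laplace]
    have e : ∀ t : ℝ, Complex.exp (m * t) • heat A t =
        cfc (fun z : ℂ => Complex.exp (m * t) * (heatFun t z.re : ℂ)) A := fun t => by
      rw [hA.heat_eq_complex, cfc_const_mul _ (fun z : ℂ => (heatFun t z.re : ℂ)) A
        (Complex.continuous_ofReal.comp ((continuous_heatFun t).comp
          Complex.continuous_re)).continuousOn]
    simp only [e]
    rw [← h]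
    refine cfc_congr fun z hz => ?_
    obtain ⟨h1, h2⟩ := hA.spectrum_complex hz
    rw [integral_exp_heatFun hm h2, ← h1]
  · filter_upwards [ae_restrict_mem measurableSet_Ioi] with t ht z hz
    obtain ⟨h1, h2⟩ := hA.spectrum_complex hz
    rw [norm_mul, Complex.norm_exp, Complex.norm_real, Real.norm_of_nonneg (heatFun_nonneg _ _)]
    have : heatFun t z.re ≤ Real.exp (-t) :=
      hA.heatFun_le ht (spectrum.of_algebraMap_mem ℂ (by rw [h1] at hz; exact hz))
    refine (mul_le_mul_of_nonneg_left this (Real.exp_pos _).le).trans ?_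
    rw [← Real.exp_add]
    refine le_of_eq (congrArg _ ?_)
    simp
    ring

/-- These relations say L = (A⁻¹ - m)⁻¹ without mentioning the unbounded A⁻¹. On the spectrum they
reduce to z + mz · z/(1 - mz) = z/(1 - mz). -/
theorem laplace_mul (hA : IsInvOneAdd A) {m : ℂ} (hm : m.re < 1) :
    A + m • (A * laplace A m) = laplace A m ∧ A + m • (laplace A m * A) = laplace A m := by
  have hn : IsStarNormal A := hA.isSelfAdjoint.isStarNormal
  have hne : ∀ z ∈ spectrum ℂ A, 1 - m * z ≠ 0 := fun z hz h0 => by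
    obtain ⟨h1, h2⟩ := hA.spectrum_complex hz
    rw [h1] at h0
    have := congrArg Complex.re h0
    simp at this
    rcases h2.1.eq_or_lt with h | h
    · rw [← h] at this; simp at this
    · nlinarith [h2.2]
  have hc : ContinuousOn (fun z : ℂ => z / (1 - m * z)) (spectrum ℂ A) :=
    ContinuousOn.div (by fun_prop) (by fun_prop) hne
  have e1 : A * laplace A m = cfc (fun z : ℂ => z * (z / (1 - m * z))) A := by
    rw [hA.laplace_eq_cfc hm, cfc_mul (fun z : ℂ => z) _ A continuousOn_id hc, cfc_id' ℂ A]
  have e2 : laplace A m * A = A * laplace A m := by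
    have h1 := cfc_mul (fun z : ℂ => z / (1 - m * z)) (fun z : ℂ => z) A hc continuousOn_id
    rw [cfc_id' ℂ A] at h1
    rw [e1, hA.laplace_eq_cfc hm, ← h1]
    refine cfc_congr fun z _ => mul_comm _ _
  rw [e2]
  refine ⟨?_, ?_⟩ <;>
  · rw [e1, ← cfc_const_mul m (fun z : ℂ => z * (z / (1 - m * z))) A (continuousOn_id.mul hc)]
    nth_rewrite 1 [← cfc_id' ℂ A]
    rw [← cfc_add (a := A) (fun z : ℂ => z) (fun z : ℂ => m * (z * (z / (1 - m * z)))) continuousOn_id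
      (continuousOn_const.mul (continuousOn_id.mul hc)), hA.laplace_eq_cfc hm]
    refine cfc_congr fun z hz => ?_
    have h0 := hne z hz
    have e : z / (1 - m * z) * (1 - m * z) = z := div_mul_cancel₀ z h0
    change z + m * (z * (z / (1 - m * z))) = z / (1 - m * z)
    linear_combination -e

end IsInvOneAdd

end

section

open MeasureTheory Filter Topology

variable {H : Type*} [NormedAddCommGroup H] [InnerProductSpace ℂ H] [CompleteSpace H]
variable {M : VonNeumannAlgebra H}

/-! ### The heat semigroup of `1 + D²` -/

namespace IsSqResolvent

variable {D : H →ₗ.[ℂ] H} {A : H →L[ℂ] H}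

theorem graph_neg (h : IsSqResolvent D (-1) (-A)) (x : H) :
    ∃ w, (A x, w) ∈ D.graph ∧ (w, x - A x) ∈ D.graph := by
  obtain ⟨u, h1, h2⟩ := h.1 x
  refine ⟨-u, ?_, ?_⟩
  · simpa using neg_mem h1
  · have := neg_mem h2
    convert this using 1
    simp only [neg_smul, one_smul, Prod.neg_mk, neg_apply]
    congr 1
    abel

theorem mul_add_apply (h : IsSqResolvent D (-1) (-A)) {y u v : H} (hy : (y, u) ∈ D.graph)
    (hu : (u, v) ∈ D.graph) : A (y + v) = y := by
  have := h.2 y u v hy hu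
  have e : (-1 : ℂ) • y - v = -(y + v) := by rw [neg_smul, one_smul]; abel
  rw [e, neg_apply, map_neg, neg_neg] at this
  exact this

/-- Symmetry of D gives ⟨Ax, x'⟩ = ⟨Ax, Ax'⟩ + ⟨DAx, DAx'⟩, hence positivity and ‖A‖ ≤ 1. Since A is
self-adjoint and injective, its range is dense. -/
theorem isInvOneAdd (hD : IsDenseSymm D) (h : IsSqResolvent D (-1) (-A)) : IsInvOneAdd A := by
  choose w hw1 hw2 using h.graph_neg
  have hin : ∀ x x', inner ℂ (A x) x' = inner ℂ (A x) (A x') + inner ℂ (w x) (w x') := fun x x' => by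
    rw [hD.symm _ _ _ _ (hw1 x) (hw2 x'), ← inner_add_right]
    congr 1; abel
  have hin' : ∀ x x', inner ℂ x (A x') = inner ℂ (A x) (A x') + inner ℂ (w x) (w x') :=
    fun x x' => by
    rw [← hD.symm _ _ _ _ (hw2 x) (hw1 x'), ← inner_add_left]
    congr 1; abel
  have hre : ∀ x, (inner ℂ (A x) x).re = ‖A x‖ ^ 2 + ‖w x‖ ^ 2 := fun x => by
    rw [hin, inner_self_eq_norm_sq_to_K, inner_self_eq_norm_sq_to_K]
    simp only [Complex.coe_algebraMap, ← Complex.ofReal_pow, ← Complex.ofReal_add,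
      Complex.ofReal_re]
  have hpos : 0 ≤ A := by
    rw [ContinuousLinearMap.nonneg_iff_isPositive]
    refine ⟨fun x x' => (hin x x').trans (hin' x x').symm, fun x => ?_⟩
    rw [ContinuousLinearMap.reApplyInnerSelf_apply]
    change 0 ≤ (inner ℂ (A x) x).re
    rw [hre]
    positivity
  refine ⟨hpos, ?_, ?_⟩
  · refine A.opNorm_le_bound zero_le_one fun x => ?_
    rw [one_mul]
    have h1 : ‖A x‖ ^ 2 ≤ ‖A x‖ * ‖x‖ := by
      have := (Complex.re_le_norm _).trans (norm_inner_le_norm (𝕜 := ℂ) (A x) x)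
      rw [hre] at this
      nlinarith [sq_nonneg ‖w x‖]
    rcases (norm_nonneg (A x)).eq_or_lt with h0 | h0
    · rw [← h0]; exact norm_nonneg x
    · nlinarith
  · have hker : ∀ x, A x = 0 → x = 0 := fun x hx => by
      have h1 := hw1 x
      rw [hx] at h1
      have h2 := D.graph_fst_eq_zero_snd h1 rfl
      have h3 := hw2 x
      rw [h2] at h3
      have h4 := D.graph_fst_eq_zero_snd h3 rfl
      rwa [hx, sub_zero] at h4
    have h1 : (A : H →ₗ[ℂ] H).rangeᗮ = ⊥ := by
      rw [ContinuousLinearMap.orthogonal_range, (IsSelfAdjoint.of_nonneg hpos).adjoint_eq,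
        LinearMap.ker_eq_bot']
      exact hker
    have h2 := (Submodule.topologicalClosure_eq_top_iff).2 h1
    rw [← Submodule.dense_iff_topologicalClosure_eq_top] at h2
    exact h2

/-- Here A⁻¹ - m = -((m - 1) - D²), so the Laplace transform of the heat semigroup is minus a
resolvent of D². -/
theorem laplace (hA : IsInvOneAdd A) (h : IsSqResolvent D (-1) (-A)) {m : ℂ} (hm : m.re < 1) :
    IsSqResolvent D (m - 1) (-(IsInvOneAdd.laplace A m)) := by
  obtain ⟨e1, e2⟩ := hA.laplace_mul hm
  set L := IsInvOneAdd.laplace A m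
  refine ⟨fun x => ?_, fun y u v hy hu => ?_⟩
  · have e : L x = A (x + m • L x) := by
      nth_rewrite 1 [← e1]
      change A x + m • A (L x) = _
      rw [map_add, map_smul]
    obtain ⟨w, h1, h2⟩ := h.graph_neg (x + m • L x)
    rw [← e] at h1 h2
    refine ⟨-w, neg_mem h1, ?_⟩
    have := neg_mem h2
    convert this using 1
    simp only [Prod.neg_mk, Prod.mk.injEq, true_and, sub_smul, one_smul, neg_apply, smul_neg]
    abel
  · have e := h.mul_add_apply hy hu
    have e3 : L (y + v) = y + m • L y := by
      nth_rewrite 1 [← e2]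
      change A (y + v) + m • L (A (y + v)) = _
      rw [e]
    have e4 : (m - 1) • y - v = m • y - (y + v) := by rw [sub_smul, one_smul]; abel
    rw [e4, neg_apply, map_sub, e3, map_smul]
    abel

/-- `D e^{-t(1+D²)}` is bounded. -/
theorem exists_heat_graph (hD : IsDenseSymm D) (haff : IsAffiliated M D)
    (h : IsSqResolvent D (-1) (-A)) (t : ℝ) :
    ∃ B ∈ M, (∀ x, (heat A t x, B x) ∈ D.graph) ∧ ∀ x u, (x, u) ∈ D.graph → B x = heat A t u := by
  have hA := h.isInvOneAdd hD
  obtain ⟨Q, hQ⟩ := h.exists_mul hD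
  have hAM : A ∈ M := by
    have := h.mem haff
    rw [← neg_neg A]
    exact neg_mem this
  have hK1 : ∀ x, (A x, -Q x) ∈ D.graph := fun x => by
    have := neg_mem (hQ x).1
    simpa using this
  have hK2 : ∀ x u, (x, u) ∈ D.graph → -Q x = A u := fun x u hx => by
    rw [h.mul_graph hQ hx]; simp
  have hcomm : Commute A (-Q) := by
    ext x
    exact (hK2 _ _ (hK1 x)).symm
  have hc2 : Commute (IsInvOneAdd.heatInv A t) (-Q) := hcomm.cfc_real _
  obtain ⟨m1, m2⟩ := hA.mul_heatInv t
  -- -Q is the bounded operator DA, so De^{-tA⁻¹} = (DA)(A⁻¹e^{-tA⁻¹}). It also extends e^{-tA⁻¹}D,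
  -- because DA commutes with functions of A.
  refine ⟨-Q * IsInvOneAdd.heatInv A t, M.mul_mem (neg_mem (h.mul_mem haff hQ)) (vN_cfc_mem _ hAM),
    fun x => ?_, fun x u hx => ?_⟩
  · rw [← m1]
    exact hK1 (IsInvOneAdd.heatInv A t x)
  · rw [← hc2.eq, ← m2]
    change IsInvOneAdd.heatInv A t (-Q x) = IsInvOneAdd.heatInv A t (A u)
    rw [hK2 x u hx]

end IsSqResolvent

/-! ### Trace estimates and semigroup properties of the heat operators -/

namespace IsInvOneAdd

variable {A : H →L[ℂ] H}

/-- The exponential is split in halves: one factor e^{-t/(2a)} is traded for the power (a/t)^q up to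
a constant, the other is at most e^{-t/2} since a ≤ 1. -/
theorem heatFun_le_rpow (hA : IsInvOneAdd A) {q t : ℝ} (hq : 0 < q) (ht : 0 < t) {a : ℝ}
    (ha : a ∈ spectrum ℝ A) :
    heatFun t a ≤ ((2 * q) ^ q * (t ^ (-q) * Real.exp (-(t / 2)))) * a ^ q := by
  rcases hA.cases ha with rfl | ⟨h0, h1⟩
  · rw [heatFun_zero, Real.zero_rpow hq.ne', mul_zero]
  · rw [heatFun_of_pos ht h0]
    have hx : 0 < t / a := div_pos ht h0
    have e1 : (t / a / (2 * q)) ^ q ≤ Real.exp (t / a / 2) := by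
      have : t / a / (2 * q) ≤ Real.exp (t / a / (2 * q)) := by
        have := Real.add_one_le_exp (t / a / (2 * q)); linarith
      refine (Real.rpow_le_rpow (by positivity) this hq.le).trans (le_of_eq ?_)
      rw [← Real.exp_mul]
      congr 1
      field_simp
    have e2 : Real.exp (-(t / a)) ≤ Real.exp (-(t / a / 2)) * Real.exp (-(t / 2)) := by
      rw [← Real.exp_add]
      refine Real.exp_le_exp.2 ?_
      have : t ≤ t / a := by
        rw [le_div_iff₀ h0]
        exact mul_le_of_le_one_right ht.le h1
      linarith
    refine e2.trans ?_
    have e3 : Real.exp (-(t / a / 2)) ≤ (2 * q) ^ q * t ^ (-q) * a ^ q := by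
      rw [Real.exp_neg]
      have e4 : (2 * q) ^ q * t ^ (-q) * a ^ q = ((t / a / (2 * q)) ^ q)⁻¹ := by
        rw [Real.div_rpow (by positivity) (by positivity), Real.div_rpow ht.le h0.le,
          Real.rpow_neg ht.le]
        have := (Real.rpow_pos_of_pos ht q).ne'
        have := (Real.rpow_pos_of_pos h0 q).ne'
        have := (Real.rpow_pos_of_pos (show (0 : ℝ) < 2 * q by positivity) q).ne'
        field_simp
      rw [e4]
      exact inv_anti₀ (by positivity) e1
    calc Real.exp (-(t / a / 2)) * Real.exp (-(t / 2))
        ≤ ((2 * q) ^ q * t ^ (-q) * a ^ q) * Real.exp (-(t / 2)) := by gcongr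
      _ = _ := by ring

/-- Trace estimate for the heat operators. -/
theorem heat_posFin (hA : IsInvOneAdd A) {τ : FNSTrace M} (hAM : A ∈ M) {q : ℝ} (hq : 0 < q)
    (hfin : τ.toFun (cfc (fun a : ℝ => a ^ q) A) < ∞) {t : ℝ} (ht : 0 < t) :
    heat A t ∈ τ.posFin ∧ (τ.toFun (heat A t)).toReal ≤
      ((2 * q) ^ q * (τ.toFun (cfc (fun a : ℝ => a ^ q) A)).toReal) *
        (t ^ (-q) * Real.exp (-(t / 2))) := by
  have hcq : ContinuousOn (fun a : ℝ => a ^ q) (spectrum ℝ A) := fun a _ =>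
    (Real.continuousAt_rpow_const a q (Or.inr hq.le)).continuousWithinAt
  have h0 : 0 ≤ cfc (fun a : ℝ => a ^ q) A :=
    cfc_nonneg fun a ha => Real.rpow_nonneg (hA.mem_Icc ha).1 _
  have hS : cfc (fun a : ℝ => a ^ q) A ∈ τ.posFin := ⟨vN_cfc_mem _ hAM, h0, hfin⟩
  have hc : 0 ≤ (2 * q) ^ q * (t ^ (-q) * Real.exp (-(t / 2))) := by positivity
  have hS' := FNSTrace.posFin_rsmul hS hc
  have hle : heat A t ≤ ((2 * q) ^ q * (t ^ (-q) * Real.exp (-(t / 2)))) •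
      cfc (fun a : ℝ => a ^ q) A := by
    rw [← cfc_const_mul _ _ A hcq]
    exact cfc_mono (fun a ha => hA.heatFun_le_rpow hq ht ha) (continuous_heatFun t).continuousOn
      (continuousOn_const.mul hcq)
  have hM : heat A t ∈ M := vN_cfc_mem _ hAM
  refine ⟨FNSTrace.posFin_of_le hM (heat_nonneg A t) hle hS', ?_⟩
  have := ENNReal.toReal_mono hS'.2.2.ne (τ.mono hM hS'.1 (heat_nonneg A t) hle)
  rw [FNSTrace.toReal_rsmul hS hc] at this
  refine this.trans (le_of_eq ?_)
  ring

end IsInvOneAdd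

/-- `h` is a norm continuous semigroup of trace class contractions, converging strongly to the
identity at zero. -/
structure IsHeatSemigroup (τ : FNSTrace M) (h : ℝ → H →L[ℂ] H) : Prop where
  cont : ContinuousOn h (Set.Ioi 0)
  mul : ∀ {s t : ℝ}, 0 < s → 0 < t → h s * h t = h (s + t)
  norm_le : ∀ {t : ℝ}, 0 < t → ‖h t‖ ≤ Real.exp (-t)
  fin : ∀ {t : ℝ}, 0 < t → h t ∈ τ.posFin
  approx : IsApproxUnit τ fun n => h (1 / ((n : ℝ) + 1))

theorem isHeatSemigroup_heat {A : H →L[ℂ] H} (hA : IsInvOneAdd A) {τ : FNSTrace M} (hAM : A ∈ M)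
    {q : ℝ} (hq : 0 < q) (hfin : τ.toFun (cfc (fun a : ℝ => a ^ q) A) < ∞) :
    IsHeatSemigroup τ (heat A) where
  cont := hA.continuousOn_heat
  mul := hA.heat_mul
  norm_le := hA.norm_heat_le
  fin := fun ht => (hA.heat_posFin hAM hq hfin ht).1
  approx :=
    { fin := fun _ => (hA.heat_posFin hAM hq hfin Nat.one_div_pos_of_nat).1
      norm_le := fun _ => (hA.norm_heat_le Nat.one_div_pos_of_nat).trans
        (Real.exp_le_one_iff.2 (neg_nonpos.2 Nat.one_div_pos_of_nat.le))
      mono := fun _ _ hmn => hA.heat_anti Nat.one_div_pos_of_nat (Nat.one_div_le_one_div hmn)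
      lim := hA.tendsto_heat }

/-- `τ(h(t)) ≤ K t^{-q} e^{-t/2}`. -/
def HeatBound (τ : FNSTrace M) (h : ℝ → H →L[ℂ] H) (q K : ℝ) : Prop :=
  ∀ {t : ℝ}, 0 < t → (τ.toFun (h t)).toReal ≤ K * (t ^ (-q) * Real.exp (-(t / 2)))

end

section

open MeasureTheory Filter Topology

/-! ### Integration over the positive orthant -/

/-- Lebesgue measure on the positive orthant of `ℝⁿ`. -/
abbrev orthant (n : ℕ) : Measure (Fin n → ℝ) := Measure.pi fun _ => volume.restrict (Set.Ioi 0)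

theorem ae_orthant_pos (n : ℕ) : ∀ᵐ t ∂orthant n, ∀ i, 0 < t i := by
  refine ae_all_iff.2 fun i => ?_
  exact (Measure.tendsto_eval_ae_ae (μ := fun _ : Fin n => volume.restrict (Set.Ioi (0 : ℝ)))
    (i := i)).eventually (ae_restrict_mem measurableSet_Ioi)

theorem sum_pos_of_pos {n : ℕ} (hn : 0 < n) {t : Fin n → ℝ} (ht : ∀ i, 0 < t i) : 0 < ∑ i, t i := by
  have : NeZero n := ⟨hn.ne'⟩
  exact Finset.sum_pos (fun i _ => ht i) Finset.univ_nonempty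

/-- For a negative exponent, σ^β is the product of n factors σ^{β/n} ≤ tᵢ^{β/n}, so the integrand is
dominated by a product of one-variable Gamma integrands with β/n > -1. -/
theorem integrable_sum_rpow_of_neg {n : ℕ} {β c : ℝ} (h1 : -(n : ℝ) < β) (h2 : β < 0) (hc : 0 < c) :
    Integrable (fun t : Fin n → ℝ => (∑ i, t i) ^ β * Real.exp (-(c * ∑ i, t i))) (orthant n) := by
  have hn : 0 < n := by
    rcases Nat.eq_zero_or_pos n with rfl | h
    · simp at h1; linarith
    · exact h
  have hn' : (0 : ℝ) < n := by exact_mod_cast hn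
  have h1d : IntegrableOn (fun x : ℝ => x ^ (β / n) * Real.exp (-(c * x))) (Set.Ioi 0) := by
    have := integrableOn_rpow_mul_exp_neg_mul_rpow (p := 1) (s := β / n) (b := c)
      (by rw [lt_div_iff₀ hn']; linarith) one_pos hc
    simpa [neg_mul] using this
  have hp := Integrable.fintype_prod (ι := Fin n) (μ := fun _ => volume.restrict (Set.Ioi (0 : ℝ)))
    fun _ => h1d
  refine hp.mono' (by fun_prop) ?_
  filter_upwards [ae_orthant_pos n] with t ht
  have hs := sum_pos_of_pos hn ht
  rw [Real.norm_of_nonneg (by positivity), Finset.prod_mul_distrib, ← Real.exp_sum,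
    Finset.sum_neg_distrib, ← Finset.mul_sum]
  refine mul_le_mul_of_nonneg_right ?_ (Real.exp_pos _).le
  have e : (∑ i, t i) ^ β = ∏ _i : Fin n, (∑ i, t i) ^ (β / n) := by
    rw [Finset.prod_const, Finset.card_univ, Fintype.card_fin, ← Real.rpow_natCast,
      ← Real.rpow_mul hs.le, div_mul_cancel₀ _ hn'.ne']
  rw [e]
  refine Finset.prod_le_prod (fun i _ => by positivity) fun i _ => ?_
  exact Real.rpow_le_rpow_of_nonpos (ht i) (Finset.single_le_sum (fun j _ => (ht j).le)
    (Finset.mem_univ i)) (div_nonpos_of_nonpos_of_nonneg h2.le hn'.le)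

theorem integrable_sum_rpow {n : ℕ} (hn : 0 < n) {α c : ℝ} (h1 : -(n : ℝ) < α) (hc : 0 < c) :
    Integrable (fun t : Fin n → ℝ => (∑ i, t i) ^ α * Real.exp (-(c * ∑ i, t i))) (orthant n) := by
  rcases lt_or_ge α 0 with h | h
  · exact integrable_sum_rpow_of_neg h1 h hc
  have hn' : (1 : ℝ) ≤ n := by exact_mod_cast hn
  -- Half of the exponential decay pays for σ^γ. The power -1/2 that remains lies in (-n, 0) for
  -- every n ≥ 1.
  set γ := α + 1 / 2 with hγ
  have hγ0 : 0 < γ := by linarith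
  have hi := (integrable_sum_rpow_of_neg (n := n) (β := -(1 / 2)) (c := c / 2) (by linarith)
    (by norm_num) (half_pos hc)).const_mul ((2 * γ / c) ^ γ)
  refine hi.mono' (by fun_prop) ?_
  filter_upwards [ae_orthant_pos n] with t ht
  have hs := sum_pos_of_pos hn ht
  set σ := ∑ i, t i
  rw [Real.norm_of_nonneg (by positivity)]
  have e1 : (c * σ / (2 * γ)) ^ γ ≤ Real.exp (c / 2 * σ) := by
    have : c * σ / (2 * γ) ≤ Real.exp (c * σ / (2 * γ)) := by
      have := Real.add_one_le_exp (c * σ / (2 * γ)); linarith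
    refine (Real.rpow_le_rpow (by positivity) this hγ0.le).trans (le_of_eq ?_)
    rw [← Real.exp_mul]
    congr 1
    field_simp
  have e2 : σ ^ α = (2 * γ / c) ^ γ * σ ^ (-(1 / 2) : ℝ) * (c * σ / (2 * γ)) ^ γ := by
    rw [show c * σ / (2 * γ) = (2 * γ / c)⁻¹ * σ by field_simp,
      Real.mul_rpow (by positivity) hs.le, Real.inv_rpow (by positivity),
      show α = -(1 / 2) + γ by rw [hγ]; ring, Real.rpow_add hs]
    have := (Real.rpow_pos_of_pos (show (0 : ℝ) < 2 * γ / c by positivity) γ).ne'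
    field_simp
  calc σ ^ α * Real.exp (-(c * σ))
      = (2 * γ / c) ^ γ * σ ^ (-(1 / 2) : ℝ) * (c * σ / (2 * γ)) ^ γ * Real.exp (-(c * σ)) := by
        rw [e2]
    _ ≤ (2 * γ / c) ^ γ * σ ^ (-(1 / 2) : ℝ) * Real.exp (c / 2 * σ) * Real.exp (-(c * σ)) := by
        gcongr
    _ = _ := by
        rw [mul_assoc _ (Real.exp _), ← Real.exp_add, mul_assoc]
        congr 4
        ring

theorem measurePreserving_orthant_cons (n : ℕ) (i : Fin (n + 1)) :
    MeasurePreserving (MeasurableEquiv.piFinSuccAbove (fun _ : Fin (n + 1) => ℝ) i)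
      (orthant (n + 1)) ((volume.restrict (Set.Ioi 0)).prod (orthant n)) :=
  measurePreserving_piFinSuccAbove (fun _ => volume.restrict (Set.Ioi (0 : ℝ))) i

theorem measurePreserving_orthant_comp {n : ℕ} (e : Fin n ≃ Fin n) :
    MeasurePreserving (MeasurableEquiv.arrowCongr' e.symm (MeasurableEquiv.refl ℝ))
      (orthant n) (orthant n) :=
  measurePreserving_arrowCongr' (fun _ => volume.restrict (Set.Ioi (0 : ℝ)))
    (fun _ => volume.restrict (Set.Ioi (0 : ℝ))) _ _ fun _ => MeasurePreserving.id _

section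

variable {E : Type*} [NormedAddCommGroup E] [NormedSpace ℝ E]

theorem integral_orthant_comp {n : ℕ} (e : Fin n ≃ Fin n) (f : (Fin n → ℝ) → E) :
    ∫ t, f (fun i => t (e i)) ∂orthant n = ∫ t, f t ∂orthant n :=
  (measurePreserving_orthant_comp e).integral_comp' f

/-- Fubini for ordered products in a noncommutative algebra: the first variable is split off and
multiplication is used as a bounded bilinear map. -/
theorem integral_list_prod {A : Type*} [NormedRing A] [NormedAlgebra ℝ A] [CompleteSpace A] :
    ∀ {n : ℕ} (f : Fin n → ℝ → A), (∀ i, IntegrableOn (f i) (Set.Ioi 0)) →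
    Integrable (fun t : Fin n → ℝ => (List.ofFn fun i => f i (t i)).prod) (orthant n) ∧
    ∫ t, (List.ofFn fun i => f i (t i)).prod ∂orthant n =
      (List.ofFn fun i => ∫ x in Set.Ioi 0, f i x).prod := by
  intro n
  induction n with
  | zero =>
    intro f _
    have h : orthant 0 = Measure.dirac isEmptyElim := Measure.pi_of_empty _
    rw [h]
    refine ⟨integrable_dirac (by simp), by simp⟩
  | succ n ih =>
    intro f hf
    obtain ⟨h1, h2⟩ := ih (fun i => f i.succ) fun i => hf i.succ
    have hmp := measurePreserving_orthant_cons n 0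
    have e : (fun t : Fin (n + 1) → ℝ => (List.ofFn fun i => f i (t i)).prod) =
        (fun p : ℝ × (Fin n → ℝ) => f 0 p.1 * (List.ofFn fun i : Fin n => f i.succ (p.2 i)).prod) ∘
          MeasurableEquiv.piFinSuccAbove (fun _ : Fin (n + 1) => ℝ) 0 := by
      ext t
      simp only [List.ofFn_succ, List.prod_cons, Function.comp]
      rfl
    constructor
    · rw [e, hmp.integrable_comp_emb (MeasurableEquiv.measurableEmbedding _)]
      exact (hf 0).mul_prod h1
    · rw [e]
      refine (hmp.integral_comp' (g := fun p : ℝ × (Fin n → ℝ) => f 0 p.1 *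
        (List.ofFn fun i : Fin n => f i.succ (p.2 i)).prod)).trans ?_
      rw [List.ofFn_succ, List.prod_cons, ← h2]
      exact integral_prod_bilin (ContinuousLinearMap.mul ℝ A) (hf 0) h1

/-- After a shear, the fibre of (x, y) ↦ x + y over w > 0 is the interval (0, w), of length w. -/
theorem integral_add_prod {φ : ℝ → E} 
    (hφ : Integrable (fun p : ℝ × ℝ => φ (p.1 + p.2))
      ((volume.restrict (Set.Ioi 0)).prod (volume.restrict (Set.Ioi 0)))) :
    ∫ p : ℝ × ℝ, φ (p.1 + p.2) ∂((volume.restrict (Set.Ioi 0)).prod (volume.restrict (Set.Ioi 0))) =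
      ∫ w in Set.Ioi (0 : ℝ), w • φ w := by
  -- In an incomplete space both integrals are zero by convention.
  by_cases hE : CompleteSpace E
  swap
  · simp [integral, hE]
  have hmp : MeasurePreserving (MeasurableEquiv.shearAddRight ℝ) (volume.prod volume)
    (volume.prod volume) := measurePreserving_prod_add volume volume
  let S : Set (ℝ × ℝ) := {p | 0 < p.1 ∧ p.1 < p.2}
  have hS : MeasurableSet S := by
    apply MeasurableSet.inter
    · exact measurableSet_lt measurable_const measurable_fst
    · exact measurableSet_lt measurable_fst measurable_snd
  have hpre : MeasurableEquiv.shearAddRight ℝ ⁻¹' S = Set.Ioi (0 : ℝ) ×ˢ Set.Ioi (0 : ℝ) := by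
    ext p
    change (0 < p.1 ∧ p.1 < p.1 + p.2) ↔ _
    simp
  rw [Measure.prod_restrict, ← hpre] at hφ ⊢
  have hi : IntegrableOn (fun p : ℝ × ℝ => φ p.2) S (volume.prod volume) := by
    rw [← hmp.integrableOn_comp_preimage (MeasurableEquiv.measurableEmbedding _)]
    exact hφ
  have h1 := hmp.setIntegral_preimage_emb (MeasurableEquiv.measurableEmbedding _)
    (fun p : ℝ × ℝ => φ p.2) S
  refine h1.trans ?_
  rw [← integral_indicator hS, integral_prod_symm _ (hi.integrable_indicator hS),
    ← integral_indicator measurableSet_Ioi]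
  refine integral_congr_ae (Eventually.of_forall fun w => ?_)
  have e : ∀ x : ℝ, S.indicator (fun p : ℝ × ℝ => φ p.2) (x, w) =
      (Set.Ioo 0 w).indicator (fun _ => φ w) x := fun x => by
    by_cases hx : 0 < x ∧ x < w
    · rw [Set.indicator_of_mem (show (x, w) ∈ S from hx), Set.indicator_of_mem (show x ∈ Set.Ioo 0 w from hx)]
    · rw [Set.indicator_of_notMem (show (x, w) ∉ S from hx), Set.indicator_of_notMem (show x ∉ Set.Ioo 0 w from hx)]
  simp only [e]
  rw [integral_indicator measurableSet_Ioo, setIntegral_const]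
  by_cases hw : 0 < w
  · rw [Set.indicator_of_mem (show w ∈ Set.Ioi 0 from hw)]
    simp [Measure.real, hw.le]
  · rw [Set.indicator_of_notMem (show w ∉ Set.Ioi 0 from hw)]
    simp [hw]

end

end

section

open MeasureTheory Filter Topology

/-! ### Holomorphic parameter integrals and the inverse Laplace transform of a power -/

/-- It dominates the derivative of w ↦ e^{wg}, uniformly for w near z, by the values |e^{wg}| at the
four points z ± 4ε, z ± 4εi. -/
theorem mul_exp_le_sum_exp {ε : ℝ} (hε : 0 < ε) (a b : ℝ) :
    (|a| + |b|) * Real.exp (ε * (|a| + |b|)) ≤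
      ε⁻¹ * (Real.exp (4 * ε * a) + Real.exp (-(4 * ε * a)) + (Real.exp (4 * ε * b) +
        Real.exp (-(4 * ε * b)))) := by
  have key : ∀ x y : ℝ, |y| ≤ |x| → (|x| + |y|) * Real.exp (ε * (|x| + |y|)) ≤
      ε⁻¹ * (Real.exp (4 * ε * x) + Real.exp (-(4 * ε * x))) := fun x y h => by
    have h1 : |x| + |y| ≤ ε⁻¹ * Real.exp (ε * (|x| + |y|)) := by
      rw [le_inv_mul_iff₀ hε]
      have := Real.add_one_le_exp (ε * (|x| + |y|)); linarith
    have h2 : Real.exp (ε * (|x| + |y|)) * Real.exp (ε * (|x| + |y|)) ≤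
        Real.exp (4 * ε * x) + Real.exp (-(4 * ε * x)) := by
      rw [← Real.exp_add]
      have h3 : ε * (|x| + |y|) + ε * (|x| + |y|) ≤ 4 * ε * |x| := by nlinarith
      refine (Real.exp_le_exp.2 h3).trans ?_
      rcases abs_cases x with ⟨h, _⟩ | ⟨h, _⟩
      · rw [h]; linarith [Real.exp_pos (-(4 * ε * x))]
      · rw [h, mul_neg]; linarith [Real.exp_pos (4 * ε * x)]
    calc _ ≤ ε⁻¹ * Real.exp (ε * (|x| + |y|)) * Real.exp (ε * (|x| + |y|)) :=
          mul_le_mul_of_nonneg_right h1 (Real.exp_pos _).le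
      _ ≤ _ := by rw [mul_assoc]; exact mul_le_mul_of_nonneg_left h2 (inv_pos.2 hε).le
  have hp := inv_pos.2 hε
  rcases le_total |b| |a| with h | h
  · refine (key a b h).trans (mul_le_mul_of_nonneg_left ?_ hp.le)
    linarith [Real.exp_pos (-(4 * ε * b)), Real.exp_pos (4 * ε * b)]
  · rw [add_comm |a|]
    refine (key b a h).trans (mul_le_mul_of_nonneg_left ?_ hp.le)
    linarith [Real.exp_pos (-(4 * ε * a)), Real.exp_pos (4 * ε * a)]

/-- For exponential dependence on the parameter, integrability at each point of an open set is
enough: four nearby points supply an integrable bound for the derivative. -/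
theorem differentiableOn_integral_exp {X E : Type*} [MeasurableSpace X] {μ : Measure X}
    [NormedAddCommGroup E] [NormedSpace ℂ E] {U : Set ℂ} (hU : IsOpen U)
    {g : X → ℂ} {f : X → E} (hg : AEStronglyMeasurable g μ)
    (hf : AEStronglyMeasurable f μ)
    (h : ∀ z ∈ U, Integrable (fun x => Complex.exp (z * g x) • f x) μ) :
    DifferentiableOn ℂ (fun z => ∫ x, Complex.exp (z * g x) • f x ∂μ) U := by
  intro z hz
  obtain ⟨ρ, hρ, hball⟩ := Metric.isOpen_iff.1 hU z hz
  -- The four comparison points lie at distance 4ε = ρ/2 from z, inside the ball.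
  set ε := ρ / 8 with hεdef
  have hε : 0 < ε := by positivity
  have hmem : ∀ w : ℂ, ‖w‖ = 4 * ε → Integrable (fun x => Complex.exp ((z + w) * g x) • f x) μ :=
    fun w hw => h _ (hball (by rw [Metric.mem_ball, dist_eq_norm, add_sub_cancel_left, hw]; linarith))
  have hexp : ∀ z : ℂ, AEStronglyMeasurable (fun x => Complex.exp (z * g x)) μ := fun z =>
    Complex.continuous_exp.comp_aestronglyMeasurable (hg.const_mul z)
  have i1 := (hmem ((4 * ε : ℝ) : ℂ) (by rw [Complex.norm_real, Real.norm_of_nonneg (by positivity)])).norm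
  have i2 := (hmem (-((4 * ε : ℝ) : ℂ)) (by rw [norm_neg, Complex.norm_real, Real.norm_of_nonneg (by positivity)])).norm
  have i3 := (hmem (-(((4 * ε : ℝ) : ℂ) * Complex.I)) (by
    rw [norm_neg, norm_mul, Complex.norm_I, mul_one, Complex.norm_real, Real.norm_of_nonneg (by positivity)])).norm
  have i4 := (hmem (((4 * ε : ℝ) : ℂ) * Complex.I) (by
    rw [norm_mul, Complex.norm_I, mul_one, Complex.norm_real, Real.norm_of_nonneg (by positivity)])).norm
  have hd := hasDerivAt_integral_of_dominated_loc_of_deriv_le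
    (F := fun z x => Complex.exp (z * g x) • f x)
    (F' := fun z x => (Complex.exp (z * g x) * g x) • f x) (x₀ := z) (s := Metric.ball z ε) (μ := μ)
    (Metric.ball_mem_nhds z hε) (Eventually.of_forall fun z => (hexp z).smul hf) (h z hz)
    (((hexp z).mul hg).smul hf) (bound := fun x => _) (Eventually.of_forall fun x w hw => ?_)
    (((i1.add i2).add (i3.add i4)).const_mul ε⁻¹)
    (Eventually.of_forall fun x w _ => ?_)
  · exact hd.2.differentiableAt.differentiableWithinAt
  · rw [Metric.mem_ball, dist_eq_norm] at hw
    have e : ∀ y : ℂ, ‖Complex.exp ((z + y) * g x) • f x‖ =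
        Real.exp ((y * g x).re) * (Real.exp ((z * g x).re) * ‖f x‖) := fun y => by
      rw [norm_smul, Complex.norm_exp, add_mul, Complex.add_re, Real.exp_add]; ring
    simp only [Pi.add_apply, e]
    have hb := mul_exp_le_sum_exp hε (g x).re (g x).im
    have hg1 := Complex.norm_le_abs_re_add_abs_im (g x)
    have h5 : (w * g x).re ≤ (z * g x).re + ε * (|(g x).re| + |(g x).im|) := by
      have : w * g x = z * g x + (w - z) * g x := by ring
      rw [this, Complex.add_re]
      have h6 := Complex.re_le_norm ((w - z) * g x)
      rw [norm_mul] at h6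
      have := mul_le_mul hw.le hg1 (norm_nonneg _) hε.le
      linarith
    rw [norm_smul, norm_mul, Complex.norm_exp]
    have h7 : Real.exp ((w * g x).re) * ‖g x‖ ≤ Real.exp ((z * g x).re) *
        ((|(g x).re| + |(g x).im|) * Real.exp (ε * (|(g x).re| + |(g x).im|))) := by
      have := Real.exp_le_exp.2 h5
      rw [Real.exp_add] at this
      calc _ ≤ (Real.exp ((z * g x).re) * Real.exp (ε * (|(g x).re| + |(g x).im|))) *
            (|(g x).re| + |(g x).im|) := mul_le_mul this hg1 (norm_nonneg _) (by positivity)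
        _ = _ := by ring
    calc _ ≤ Real.exp ((z * g x).re) * (ε⁻¹ * (Real.exp (4 * ε * (g x).re) +
          Real.exp (-(4 * ε * (g x).re)) + (Real.exp (4 * ε * (g x).im) +
          Real.exp (-(4 * ε * (g x).im))))) * ‖f x‖ :=
          mul_le_mul_of_nonneg_right (h7.trans (mul_le_mul_of_nonneg_left hb (Real.exp_pos _).le))
            (norm_nonneg _)
      _ = _ := by
        have r1 : (((4 * ε : ℝ) : ℂ) * g x).re = 4 * ε * (g x).re := by simp
        have r2 : (-((4 * ε : ℝ) : ℂ) * g x).re = -(4 * ε * (g x).re) := by simp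
        have r3 : (-(((4 * ε : ℝ) : ℂ) * Complex.I) * g x).re = 4 * ε * (g x).im := by simp
        have r4 : ((((4 * ε : ℝ) : ℂ) * Complex.I) * g x).re = -(4 * ε * (g x).im) := by simp
        rw [r1, r2, r3, r4]
        ring
  · have := ((((hasDerivAt_id w).mul_const (g x)).cexp).smul_const (f x))
    simpa using this

theorem isOpen_re_gt (a : ℝ) : IsOpen {z : ℂ | a < z.re} :=
  isOpen_lt continuous_const Complex.continuous_re

theorem isPreconnected_re_gt (a : ℝ) : IsPreconnected {z : ℂ | a < z.re} :=
  (convex_halfSpace_re_gt a).isPreconnected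

theorem ofReal_cpow_eq_exp {t : ℝ} (ht : 0 < t) (a : ℂ) :
    (t : ℂ) ^ a = Complex.exp (a * (Real.log t : ℂ)) := by
  rw [Complex.cpow_def_of_ne_zero (by exact_mod_cast ht.ne'), Complex.ofReal_log ht.le, mul_comm]

theorem integrableOn_cpow_mul_exp {a l : ℂ} (ha : 0 < a.re) (hl : 0 < l.re) :
    IntegrableOn (fun t : ℝ => Complex.exp (l * (-(t : ℂ))) * (t : ℂ) ^ (a - 1)) (Set.Ioi 0) := by
  have hi : IntegrableOn (fun x : ℝ => x ^ (a.re - 1) * Real.exp (-(l.re * x))) (Set.Ioi 0) := by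
    have := integrableOn_rpow_mul_exp_neg_mul_rpow (p := 1) (s := a.re - 1) (b := l.re)
      (by linarith) one_pos hl
    simpa [neg_mul] using this
  refine hi.mono' (Measurable.aestronglyMeasurable (by fun_prop)) ?_
  filter_upwards [ae_restrict_mem measurableSet_Ioi] with t ht
  rw [norm_mul, Complex.norm_cpow_eq_rpow_re_of_pos ht, Complex.norm_exp, mul_comm]
  simp

/-- Both sides are holomorphic in l on the right half-plane and agree at the real points 1 +
1/(n+1), which accumulate at 1. -/
theorem integral_cpow_mul_exp {a l : ℂ} (ha : 0 < a.re) (hl : 0 < l.re) :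
    ∫ t : ℝ in Set.Ioi 0, Complex.exp (l * (-(t : ℂ))) * (t : ℂ) ^ (a - 1) =
      l ^ (-a) * Complex.Gamma a := by
  have hd := differentiableOn_integral_exp (μ := volume.restrict (Set.Ioi (0 : ℝ)))
    (isOpen_re_gt 0) (g := fun t : ℝ => -(t : ℂ)) (f := fun t : ℝ => (t : ℂ) ^ (a - 1))
    (Continuous.aestronglyMeasurable (by fun_prop)) (Measurable.aestronglyMeasurable (by fun_prop))
    fun l hl => integrableOn_cpow_mul_exp ha hl
  have hd2 : DifferentiableOn ℂ (fun l : ℂ => l ^ (-a) * Complex.Gamma a) {z : ℂ | 0 < z.re} :=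
    fun l hl => ((differentiableAt_id.cpow (differentiableAt_const _)
      (Or.inl hl)).mul_const _).differentiableWithinAt
  have h1 : (1 : ℂ) ∈ {z : ℂ | 0 < z.re} := by simp
  refine (hd.analyticOnNhd (isOpen_re_gt 0)).eqOn_of_preconnected_of_frequently_eq
    (hd2.analyticOnNhd (isOpen_re_gt 0)) (isPreconnected_re_gt 0) h1 ?_ hl
  have ht : Tendsto (fun n : ℕ => ((1 + 1 / ((n : ℝ) + 1) : ℝ) : ℂ)) atTop (𝓝[≠] 1) := by
    refine tendsto_nhdsWithin_iff.2 ⟨?_, Eventually.of_forall fun n => ?_⟩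
    · have := (tendsto_one_div_add_atTop_nhds_zero_nat (𝕜 := ℝ)).const_add 1
      rw [add_zero] at this
      have := (Complex.continuous_ofReal.tendsto 1).comp this
      rwa [Complex.ofReal_one] at this
    · have : (0 : ℝ) < 1 / ((n : ℝ) + 1) := Nat.one_div_pos_of_nat
      intro h
      have h := Set.mem_singleton_iff.1 h
      rw [Complex.ofReal_eq_one] at h
      linarith
  refine ht.frequently (Frequently.of_forall fun n => ?_)
  have hr : (0 : ℝ) < 1 + 1 / ((n : ℝ) + 1) := by positivity
  generalize 1 + 1 / ((n : ℝ) + 1) = r at hr ⊢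
  have := Complex.integral_cpow_mul_exp_neg_mul_Ioi ha hr
  rw [one_div, Complex.inv_cpow _ _ (by rw [Complex.arg_ofReal_of_nonneg hr.le]; exact Real.pi_pos.ne),
    ← Complex.cpow_neg] at this
  rw [← this]
  refine integral_congr_ae (Eventually.of_forall fun t => ?_)
  simp only [mul_neg, smul_eq_mul]
  rw [mul_comm]

theorem line_ne_zero {c : ℝ} (hc : 0 < c) (v : ℝ) : (c : ℂ) + v * Complex.I ≠ 0 := fun h => by
  have := congrArg Complex.re h
  simp at this
  exact hc.ne' this

theorem norm_line_ge (c v : ℝ) :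
    min c 1 / 2 * (1 + ‖v‖) ≤ ‖(c : ℂ) + v * Complex.I‖ := by
  have h1 := Complex.re_le_norm ((c : ℂ) + v * Complex.I)
  have h2 := Complex.abs_im_le_norm ((c : ℂ) + v * Complex.I)
  simp at h1 h2
  have h3 := min_le_left c 1
  have h4 := min_le_right c 1
  rw [Real.norm_eq_abs]
  nlinarith [abs_nonneg v]

theorem norm_line_cpow_le {c : ℝ} (hc : 0 < c) {z : ℂ} (hz : 0 ≤ z.re) (v : ℝ) :
    ‖((c : ℂ) + v * Complex.I) ^ (-z)‖ ≤
      Real.exp (Real.pi * |z.im|) * (min c 1 / 2) ^ (-z.re) * (1 + ‖v‖) ^ (-z.re) := by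
  have hm : 0 < min c 1 / 2 := half_pos (lt_min hc one_pos)
  rw [Complex.norm_cpow_of_ne_zero (line_ne_zero hc v), mul_assoc,
    ← Real.mul_rpow hm.le (by positivity), div_eq_inv_mul, ← Real.exp_neg]
  refine mul_le_mul (Real.exp_le_exp.2 ?_) ?_ (by positivity) (Real.exp_pos _).le
  · have h1 := Complex.abs_arg_le_pi ((c : ℂ) + v * Complex.I)
    refine (le_abs_self _).trans ?_
    rw [Complex.neg_im, mul_neg, neg_neg, abs_mul]
    gcongr
  · rw [Complex.neg_re]
    exact Real.rpow_le_rpow_of_nonpos (by positivity) (norm_line_ge c v) (neg_nonpos.2 hz)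

theorem continuous_line_cpow {c : ℝ} (hc : 0 < c) (z : ℂ) :
    Continuous fun v : ℝ => ((c : ℂ) + v * Complex.I) ^ z := by
  refine continuous_iff_continuousAt.2 fun v => ContinuousAt.cpow (by fun_prop) (by fun_prop)
    (Or.inl ?_)
  simpa using hc

theorem integrable_line_cpow {c : ℝ} (hc : 0 < c) {z : ℂ} (hz : 1 < z.re) :
    Integrable fun v : ℝ => ((c : ℂ) + v * Complex.I) ^ (-z) := by
  have hi := (integrable_one_add_norm (E := ℝ) (μ := volume) (r := z.re) (by simpa using hz)).const_mul
    (Real.exp (Real.pi * |z.im|) * (min c 1 / 2) ^ (-z.re))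
  exact hi.mono' (continuous_line_cpow hc _).aestronglyMeasurable
    (Eventually.of_forall fun v => norm_line_cpow_le hc (by linarith) v)

theorem fourier_cpow_mul_exp {c : ℝ} (hc : 0 < c) {z : ℂ} (hz : 0 < z.re) (w : ℝ) :
    FourierTransform.fourier ((Set.Ioi (0 : ℝ)).indicator
      fun t : ℝ => Complex.exp (c * (-(t : ℂ))) * (t : ℂ) ^ (z - 1)) w =
      ((c : ℂ) + (2 * Real.pi * w : ℝ) * Complex.I) ^ (-z) * Complex.Gamma z := by
  rw [Real.fourier_eq', ← integral_cpow_mul_exp hz (by simpa using hc),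
    ← integral_indicator measurableSet_Ioi]
  refine integral_congr_ae (Eventually.of_forall fun t => ?_)
  by_cases ht : t ∈ Set.Ioi (0 : ℝ)
  · simp only [Set.indicator_of_mem ht]
    rw [smul_eq_mul, ← mul_assoc, ← Complex.exp_add]
    congr 2
    simp
    ring
  · simp only [Set.indicator_of_notMem ht, smul_zero]

/-- Fourier inversion for t^{z-1}e^{-ct} on (0, ∞), whose transform Γ(z)(c + 2πiw)^{-z} is
integrable precisely because Re z > 1. -/
theorem integral_line_cpow {c : ℝ} (hc : 0 < c) {z : ℂ} (hz : 1 < z.re) {σ : ℝ} (hσ : 0 < σ) :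
    ∫ v : ℝ, ((c : ℂ) + v * Complex.I) ^ (-z) * Complex.exp (((c : ℂ) + v * Complex.I) * σ) =
      2 * Real.pi * ((σ : ℂ) ^ (z - 1) / Complex.Gamma z) := by
  have hz0 : 0 < z.re := by linarith
  have h2pi : (2 * Real.pi) ≠ 0 := by positivity
  set f : ℝ → ℂ := (Set.Ioi (0 : ℝ)).indicator
      fun t : ℝ => Complex.exp (c * (-(t : ℂ))) * (t : ℂ) ^ (z - 1) with hf
  have hFf : FourierTransform.fourier f = fun w : ℝ =>
      ((c : ℂ) + (2 * Real.pi * w : ℝ) * Complex.I) ^ (-z) * Complex.Gamma z :=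
    funext fun w => fourier_cpow_mul_exp hc hz0 w
  have hfi : Integrable f := by
    rw [hf, integrable_indicator_iff measurableSet_Ioi]
    exact integrableOn_cpow_mul_exp hz0 (by simpa using hc)
  have hFi : Integrable (FourierTransform.fourier f) := by
    rw [hFf]
    exact ((integrable_line_cpow hc hz).comp_mul_left' h2pi).mul_const _
  have hcont : ContinuousAt f σ := by
    have h1 : ContinuousAt (fun t : ℝ => Complex.exp (c * (-(t : ℂ))) * (t : ℂ) ^ (z - 1)) σ := by
      refine ContinuousAt.mul (by fun_prop) ?_
      exact (Complex.continuous_ofReal.continuousAt).cpow continuousAt_const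
        (Or.inl (by simpa using hσ))
    refine h1.congr ?_
    filter_upwards [Ioi_mem_nhds hσ] with t ht
    rw [hf, Set.indicator_of_mem ht]
  have hinv := hfi.fourierInv_fourier_eq hFi hcont
  rw [Real.fourierInv_eq', hFf, hf, Set.indicator_of_mem (show σ ∈ Set.Ioi 0 from hσ)] at hinv
  have hG : Complex.Gamma z ≠ 0 := Complex.Gamma_ne_zero_of_re_pos hz0
  have hsub := Measure.integral_comp_mul_left (fun v : ℝ => ((c : ℂ) + v * Complex.I) ^ (-z) *
    Complex.exp (((c : ℂ) + v * Complex.I) * σ)) (2 * Real.pi)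
  have e : ∀ w : ℝ, ((c : ℂ) + (2 * Real.pi * w : ℝ) * Complex.I) ^ (-z) *
      Complex.exp (((c : ℂ) + (2 * Real.pi * w : ℝ) * Complex.I) * σ) =
      (Complex.exp (c * σ) / Complex.Gamma z) * (Complex.exp (((2 * Real.pi * inner ℝ w σ : ℝ) : ℂ) * Complex.I) •
        (((c : ℂ) + (2 * Real.pi * w : ℝ) * Complex.I) ^ (-z) * Complex.Gamma z)) := fun w => by
    rw [add_mul, Complex.exp_add, smul_eq_mul]
    have : ((2 * Real.pi * w : ℝ) : ℂ) * Complex.I * σ = ((2 * Real.pi * inner ℝ w σ : ℝ) : ℂ) * Complex.I := by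
      simp; ring
    rw [this]
    field_simp
  simp only [e] at hsub
  rw [integral_const_mul, hinv] at hsub
  have h3 : Complex.exp (c * σ) * Complex.exp (c * -(σ : ℂ)) = 1 := by
    rw [← Complex.exp_add, mul_neg, add_neg_cancel, Complex.exp_zero]
  have h4 : ∫ v : ℝ, ((c : ℂ) + v * Complex.I) ^ (-z) * Complex.exp (((c : ℂ) + v * Complex.I) * σ) =
      (2 * Real.pi : ℝ) • ((Complex.exp (c * σ) / Complex.Gamma z) *
        (Complex.exp (c * -(σ : ℂ)) * (σ : ℂ) ^ (z - 1))) := by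
    rw [hsub, smul_smul, abs_of_pos (by positivity), mul_inv_cancel₀ h2pi, one_smul]
  rw [h4, Complex.real_smul]
  push_cast
  linear_combination (2 * Real.pi * ((σ : ℂ) ^ (z - 1) / Complex.Gamma z)) * h3

end

section

open MeasureTheory Filter Topology

variable {H : Type*} [NormedAddCommGroup H] [InnerProductSpace ℂ H] [CompleteSpace H]
variable {M : VonNeumannAlgebra H}

/-! ### Riesz type integrals over the orthant -/

section

variable {E : Type*} [NormedAddCommGroup E] [NormedSpace ℂ E] {n : ℕ} {F : (Fin n → ℝ) → E}
  {K q c : ℝ}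

/-- The singularity σ^{Re w - q} at the corner of an n-dimensional orthant is integrable when Re w -
q > -n. The half-planes for the traces all come from this condition. -/
theorem integrable_cpow_smul (hn : 0 < n) (hF : AEStronglyMeasurable F (orthant n)) (hc : 0 < c)
    (hb : ∀ t, (∀ i, 0 < t i) → ‖F t‖ ≤ K * ((∑ i, t i) ^ (-q) * Real.exp (-(c * ∑ i, t i))))
    {w : ℂ} (hw : q - n < w.re) :
    Integrable (fun t => ((∑ i, t i : ℝ) : ℂ) ^ w • F t) (orthant n) := by
  have hi := (integrable_sum_rpow hn (α := w.re - q) (c := c) (by linarith) hc).const_mul K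
  refine hi.mono' (AEStronglyMeasurable.smul (Measurable.aestronglyMeasurable (by fun_prop)) hF) ?_
  filter_upwards [ae_orthant_pos n] with t ht
  have hs := sum_pos_of_pos hn ht
  rw [norm_smul, Complex.norm_cpow_eq_rpow_re_of_pos hs]
  calc _ ≤ (∑ i, t i) ^ w.re * (K * ((∑ i, t i) ^ (-q) * Real.exp (-(c * ∑ i, t i)))) :=
        mul_le_mul_of_nonneg_left (hb t ht) (by positivity)
    _ = _ := by
      rw [sub_eq_add_neg, Real.rpow_add hs]
      ring

theorem differentiableOn_integral_cpow_smul (hn : 0 < n) (hF : AEStronglyMeasurable F (orthant n))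
    (hc : 0 < c)
    (hb : ∀ t, (∀ i, 0 < t i) → ‖F t‖ ≤ K * ((∑ i, t i) ^ (-q) * Real.exp (-(c * ∑ i, t i)))) :
    DifferentiableOn ℂ (fun w : ℂ => ∫ t, ((∑ i, t i : ℝ) : ℂ) ^ w • F t ∂orthant n)
      {w | q - n < w.re} := by
  have e : ∀ w : ℂ, (fun t => ((∑ i, t i : ℝ) : ℂ) ^ w • F t) =ᵐ[orthant n]
      fun t => Complex.exp (w * ((Real.log (∑ i, t i) : ℝ) : ℂ)) • F t := fun w => by
    filter_upwards [ae_orthant_pos n] with t ht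
    rw [ofReal_cpow_eq_exp (sum_pos_of_pos hn ht)]
  have := differentiableOn_integral_exp (μ := orthant n) (isOpen_re_gt (q - n))
    (g := fun t => ((Real.log (∑ i, t i) : ℝ) : ℂ)) (f := F)
    (Measurable.aestronglyMeasurable (by fun_prop)) hF fun w hw =>
      (integrable_cpow_smul hn hF hc hb hw).congr (e w)
  exact this.congr fun w _ => integral_congr_ae (e w)

end

theorem prod_ofFn_smul {𝕜 A : Type*} [CommSemiring 𝕜] [Semiring A] [Algebra 𝕜 A] : ∀ {n : ℕ}
    (c : Fin n → 𝕜) (x : Fin n → A),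
    (List.ofFn fun i => c i • x i).prod = (∏ i, c i) • (List.ofFn x).prod := by
  intro n
  induction n with
  | zero => intro c x; simp
  | succ n ih =>
    intro c x
    rw [List.ofFn_succ, List.prod_cons, ih (fun i => c i.succ) (fun i => x i.succ), Fin.prod_univ_succ,
      List.ofFn_succ, List.prod_cons, smul_mul_smul_comm]

theorem norm_prod_ofFn_le : ∀ {n : ℕ} (x : Fin n → H →L[ℂ] H) (y : Fin n → ℝ)
    (_ : ∀ i, ‖x i‖ ≤ y i), ‖(List.ofFn x).prod‖ ≤ ∏ i, y i := by
  intro n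
  induction n with
  | zero => intro x y _; simp only [List.ofFn_zero, List.prod_nil, Finset.univ_eq_empty, Finset.prod_empty]; exact ContinuousLinearMap.norm_id_le
  | succ n ih =>
    intro x y h
    rw [List.ofFn_succ, List.prod_cons, Fin.prod_univ_succ]
    exact (norm_mul_le _ _).trans (mul_le_mul (h 0) (ih _ _ fun i => h i.succ) (norm_nonneg _)
      ((norm_nonneg _).trans (h 0)))

/-! ### Products of heat operators and the line integral -/

/-- `b₀ h(t₀) b₁ h(t₁) ⋯`. -/
def heatProd (h : ℝ → H →L[ℂ] H) {n : ℕ} (b : Fin n → H →L[ℂ] H) (t : Fin n → ℝ) : H →L[ℂ] H :=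
  (List.ofFn fun i => b i * h (t i)).prod

/-- The integrand of the line integral, for arbitrary bounded operators. -/
def lineFun (D : H →ₗ.[ℂ] H) (c : ℝ) (z : ℂ) {n : ℕ} (b : Fin n → H →L[ℂ] H) (s v : ℝ) :
    H →L[ℂ] H :=
  (((c : ℂ) + v * Complex.I) ^ (-z) * Complex.I) •
    (List.ofFn fun i => b i * R D s ((c : ℂ) + v * Complex.I)).prod

/-- The line integral, for arbitrary bounded operators. -/
def lineInt (D : H →ₗ.[ℂ] H) (c : ℝ) (z : ℂ) {n : ℕ} (b : Fin n → H →L[ℂ] H) (s : ℝ) :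
    H →L[ℂ] H :=
  (2 * (Real.pi : ℂ) * Complex.I)⁻¹ • ∫ v : ℝ, lineFun D c z b s v

theorem norm_heatProd_le {h : ℝ → H →L[ℂ] H} (hh : ∀ {t : ℝ}, 0 < t → ‖h t‖ ≤ Real.exp (-t))
    {n : ℕ} (b : Fin n → H →L[ℂ] H) {t : Fin n → ℝ} (ht : ∀ i, 0 < t i) :
    ‖heatProd h b t‖ ≤ (∏ i, ‖b i‖) * Real.exp (-∑ i, t i) := by
  have := norm_prod_ofFn_le (fun i => b i * h (t i)) (fun i => ‖b i‖ * Real.exp (-(t i)))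
    fun i => (norm_mul_le _ _).trans (mul_le_mul_of_nonneg_left (hh (ht i)) (norm_nonneg _))
  rwa [Finset.prod_mul_distrib, ← Real.exp_sum, Finset.sum_neg_distrib] at this

theorem aestronglyMeasurable_heatProd {h : ℝ → H →L[ℂ] H} (hc : ContinuousOn h (Set.Ioi 0))
    (hh : ∀ {t : ℝ}, 0 < t → ‖h t‖ ≤ Real.exp (-t)) {n : ℕ} (b : Fin n → H →L[ℂ] H) :
    AEStronglyMeasurable (heatProd h b) (orthant n) := by
  refine (integral_list_prod (A := H →L[ℂ] H) (fun i x => b i * h x) fun i => ?_).1.aestronglyMeasurable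
  refine Integrable.const_mul ?_ (b i)
  refine (integrableOn_exp_neg_Ioi 0).mono' (hc.aestronglyMeasurable measurableSet_Ioi) ?_
  filter_upwards [ae_restrict_mem measurableSet_Ioi] with t ht using hh ht

section

variable {D : H →ₗ.[ℂ] H} {A : H →L[ℂ] H} {c s : ℝ} {n : ℕ}

theorem R_eq (hA : IsInvOneAdd A) (hR : IsSqResolvent D (-1) (-A)) {l : ℂ} (hl : l.re < 1) (s : ℝ) :
    R D s l = -(IsInvOneAdd.laplace A (l - (s : ℂ) ^ 2)) ∧
      IsSqResolvent D (l - (1 + (s : ℂ) ^ 2)) (R D s l) := by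
  have hre : (l - (s : ℂ) ^ 2).re < 1 := by
    rw [Complex.sub_re, ← Complex.ofReal_pow, Complex.ofReal_re]
    nlinarith [sq_nonneg s]
  have h := hR.laplace hA hre
  have e : l - (s : ℂ) ^ 2 - 1 = l - (1 + (s : ℂ) ^ 2) := by ring
  rw [e] at h
  have h2 := resolventOp_eq h
  rw [R, h2]
  exact ⟨rfl, h⟩

/-- As c < 1/2, the point λ - 1 - s² has real part below -1/2, so its distance to the spectrum of D²
is at least (1 + |v|)/4. -/
theorem norm_R_le (hD : IsDenseSymm D) (hA : IsInvOneAdd A) (hR : IsSqResolvent D (-1) (-A))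
    (hc : c < 1 / 2) (s v : ℝ) :
    ‖R D s ((c : ℂ) + v * Complex.I)‖ ≤ 4 * (1 + ‖v‖) ^ (-1 : ℝ) := by
  have h := (R_eq hA hR (l := (c : ℂ) + v * Complex.I) (by simp; linarith) s).2
  refine ContinuousLinearMap.opNorm_le_bound _ (by positivity) fun x => ?_
  have h1 := h.norm_apply_le hD x
  have e1 : ((c : ℂ) + v * Complex.I - (1 + (s : ℂ) ^ 2)).im = v := by
    rw [← Complex.ofReal_pow]; simp [-Complex.ofReal_pow]
  have e2 : ((c : ℂ) + v * Complex.I - (1 + (s : ℂ) ^ 2)).re = c - (1 + s ^ 2) := by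
    rw [← Complex.ofReal_pow]; simp [-Complex.ofReal_pow]
  rw [e1, e2] at h1
  have h2 : (1 + ‖v‖) / 4 ≤ Real.sqrt (v ^ 2 + (max 0 (-(c - (1 + s ^ 2)))) ^ 2) := by
    apply Real.le_sqrt_of_sq_le
    have h3 : 1 / 2 ≤ max 0 (-(c - (1 + s ^ 2))) := le_max_of_le_right (by nlinarith [sq_nonneg s])
    have h4 : ‖v‖ ^ 2 = v ^ 2 := by rw [Real.norm_eq_abs, sq_abs]
    nlinarith [sq_nonneg (1 - ‖v‖), norm_nonneg v]
  rw [Real.rpow_neg_one]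
  have h5 : ‖R D s ((c : ℂ) + v * Complex.I) x‖ * ((1 + ‖v‖) / 4) ≤ ‖x‖ :=
    (mul_le_mul_of_nonneg_left h2 (norm_nonneg _)).trans h1
  have h6 : (0 : ℝ) < 1 + ‖v‖ := by positivity
  calc _ = 4 * (1 + ‖v‖)⁻¹ * (‖R D s ((c : ℂ) + v * Complex.I) x‖ * ((1 + ‖v‖) / 4)) := by
        field_simp
    _ ≤ _ := mul_le_mul_of_nonneg_left h5 (by positivity)

/-- Each resolvent is minus a Laplace transform, and the product of the one-variable integrals is a
single integral over the orthant. -/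
theorem prod_R_eq (hA : IsInvOneAdd A) (hR : IsSqResolvent D (-1) (-A)) {l : ℂ} (hl : l.re < 1)
    (s : ℝ) (b : Fin n → H →L[ℂ] H) :
    (List.ofFn fun i => b i * R D s l).prod = (-1 : ℂ) ^ n •
      ∫ t, Complex.exp ((l - (s : ℂ) ^ 2) * (∑ i, t i : ℝ)) • heatProd (heat A) b t ∂orthant n := by
  have hre : (l - (s : ℂ) ^ 2).re < 1 := by
    rw [Complex.sub_re, ← Complex.ofReal_pow, Complex.ofReal_re]
    nlinarith [sq_nonneg s]
  have hi := hA.integrableOn_exp_smul_heat hre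
  have h := (integral_list_prod (A := H →L[ℂ] H)
    (fun i x => b i * Complex.exp ((l - (s : ℂ) ^ 2) * x) • heat A x) fun i => hi.const_mul (b i)).2
  have e1 : ∀ i, b i * R D s l = (-1 : ℂ) • ∫ x in Set.Ioi (0 : ℝ),
      b i * Complex.exp ((l - (s : ℂ) ^ 2) * x) • heat A x := fun i => by
    have := (ContinuousLinearMap.mul ℂ (H →L[ℂ] H) (b i)).integral_comp_comm hi
    simp only [ContinuousLinearMap.mul_apply'] at this
    rw [this, (R_eq hA hR hl s).1, neg_one_smul, mul_neg]
    rfl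
  simp only [e1]
  rw [prod_ofFn_smul, ← h, Finset.prod_const, Finset.card_univ, Fintype.card_fin]
  congr 1
  refine integral_congr_ae (Eventually.of_forall fun t => ?_)
  simp only [mul_smul_comm]
  rw [prod_ofFn_smul, ← Complex.exp_sum, ← Finset.mul_sum, Complex.ofReal_sum]
  rfl

end

end

section

open MeasureTheory Filter Topology

variable {H : Type*} [NormedAddCommGroup H] [InnerProductSpace ℂ H] [CompleteSpace H]
variable {M : VonNeumannAlgebra H}
variable {D : H →ₗ.[ℂ] H} {A : H →L[ℂ] H} {c s : ℝ} {n : ℕ}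

/-! ### The line integral as an integral of heat operators -/

/-- Measurability in v is read off the heat representation, as that of a parameter integral. -/
theorem aestronglyMeasurable_prod_R (hA : IsInvOneAdd A) (hR : IsSqResolvent D (-1) (-A))
    (hc : c < 1 / 2) (s : ℝ) (b : Fin n → H →L[ℂ] H) :
    AEStronglyMeasurable
      (fun v : ℝ => (List.ofFn fun i => b i * R D s ((c : ℂ) + v * Complex.I)).prod) := by
  have e : (fun v : ℝ => (List.ofFn fun i => b i * R D s ((c : ℂ) + v * Complex.I)).prod) =
      fun v : ℝ => (-1 : ℂ) ^ n • ∫ t, Complex.exp (((c : ℂ) + v * Complex.I - (s : ℂ) ^ 2) *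
        (∑ i, t i : ℝ)) • heatProd (heat A) b t ∂orthant n :=
    funext fun v => prod_R_eq hA hR (by simp; linarith) s b
  rw [e]
  have h : AEStronglyMeasurable (fun p : ℝ × (Fin n → ℝ) =>
      Complex.exp (((c : ℂ) + p.1 * Complex.I - (s : ℂ) ^ 2) * (∑ i, p.2 i : ℝ)) •
        heatProd (heat A) b p.2) (volume.prod (orthant n)) :=
    AEStronglyMeasurable.smul (f := fun p : ℝ × (Fin n → ℝ) =>
      Complex.exp (((c : ℂ) + p.1 * Complex.I - (s : ℂ) ^ 2) * (∑ i, p.2 i : ℝ)))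
      (Continuous.aestronglyMeasurable (by fun_prop))
      (aestronglyMeasurable_heatProd hA.continuousOn_heat hA.norm_heat_le b).comp_snd
  exact AEStronglyMeasurable.const_smul h.integral_prod_right' ((-1 : ℂ) ^ n)

theorem norm_prod_R_le (hD : IsDenseSymm D) (hA : IsInvOneAdd A) (hR : IsSqResolvent D (-1) (-A))
    (hc : c < 1 / 2) (s : ℝ) (b : Fin n → H →L[ℂ] H) (v : ℝ) :
    ‖(List.ofFn fun i => b i * R D s ((c : ℂ) + v * Complex.I)).prod‖ ≤
      (∏ i, ‖b i‖) * 4 ^ n * (1 + ‖v‖) ^ (-(n : ℝ)) := by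
  refine (norm_prod_ofFn_le (fun i => b i * R D s ((c : ℂ) + v * Complex.I))
    (fun i => ‖b i‖ * (4 * (1 + ‖v‖) ^ (-1 : ℝ))) fun i => (norm_mul_le _ _).trans
      (mul_le_mul_of_nonneg_left (norm_R_le hD hA hR hc s v) (norm_nonneg _))).trans (le_of_eq ?_)
  rw [Finset.prod_mul_distrib, Finset.prod_const, Finset.card_univ, Fintype.card_fin, mul_pow,
    ← mul_assoc, ← Real.rpow_mul_natCast (by positivity), neg_one_mul]

/-- Each resolvent is O(1/(1 + |v|)), so two of them give integrability without help from the power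
of λ. -/
theorem integrable_lineFun (hD : IsDenseSymm D) (hA : IsInvOneAdd A)
    (hR : IsSqResolvent D (-1) (-A)) (hc0 : 0 < c) (hc : c < 1 / 2) (hn : 2 ≤ n) (s : ℝ)
    (b : Fin n → H →L[ℂ] H) {z : ℂ} (hz : 0 < z.re) : Integrable (lineFun D c z b s) := by
  have hn' : (2 : ℝ) ≤ n := by exact_mod_cast hn
  have hi := (integrable_one_add_norm (E := ℝ) (μ := volume) (r := n) (by simp; linarith)).const_mul
    (Real.exp (Real.pi * |z.im|) * (min c 1 / 2) ^ (-z.re) * ((∏ i, ‖b i‖) * 4 ^ n))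
  refine hi.mono' (AEStronglyMeasurable.smul (Continuous.aestronglyMeasurable
    ((continuous_line_cpow hc0 _).mul continuous_const)) (aestronglyMeasurable_prod_R hA hR hc s b))
    (Eventually.of_forall fun v => ?_)
  rw [lineFun, norm_smul, norm_mul, Complex.norm_I, mul_one]
  have h1 := norm_line_cpow_le hc0 hz.le v
  have h2 := norm_prod_R_le hD hA hR hc s b v
  have h3 : (1 + ‖v‖) ^ (-z.re) ≤ 1 :=
    Real.rpow_le_one_of_one_le_of_nonpos (by linarith [norm_nonneg v]) (by linarith)
  have hm : 0 < min c 1 / 2 := half_pos (lt_min hc0 one_pos)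
  have h4 : ‖((c : ℂ) + v * Complex.I) ^ (-z)‖ ≤
      Real.exp (Real.pi * |z.im|) * (min c 1 / 2) ^ (-z.re) :=
    h1.trans (mul_le_of_le_one_right (by positivity) h3)
  calc _ ≤ (Real.exp (Real.pi * |z.im|) * (min c 1 / 2) ^ (-z.re)) *
        ((∏ i, ‖b i‖) * 4 ^ n * (1 + ‖v‖) ^ (-(n : ℝ))) :=
        mul_le_mul h4 h2 (norm_nonneg _) (by positivity)
    _ = _ := by ring

/-- The kernel obtained by integrating over the line. -/
def heatKernel (A : H →L[ℂ] H) (s : ℝ) (b : Fin n → H →L[ℂ] H) (t : Fin n → ℝ) : H →L[ℂ] H :=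
  Complex.exp (-((s : ℂ) ^ 2 * (∑ i, t i : ℝ))) • heatProd (heat A) b t

theorem aestronglyMeasurable_heatKernel (hA : IsInvOneAdd A) (s : ℝ) (b : Fin n → H →L[ℂ] H) :
    AEStronglyMeasurable (heatKernel A s b) (orthant n) :=
  AEStronglyMeasurable.smul (f := fun t : Fin n → ℝ => Complex.exp (-((s : ℂ) ^ 2 * (∑ i, t i : ℝ))))
    (Continuous.aestronglyMeasurable (by fun_prop))
    (aestronglyMeasurable_heatProd hA.continuousOn_heat hA.norm_heat_le b)

theorem norm_exp_sq_le (s : ℝ) {σ : ℝ} (hσ : 0 ≤ σ) :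
    ‖Complex.exp (-((s : ℂ) ^ 2 * σ))‖ = Real.exp (-(s ^ 2 * σ)) ∧
    ‖Complex.exp (-((s : ℂ) ^ 2 * σ))‖ ≤ 1 := by
  have : ‖Complex.exp (-((s : ℂ) ^ 2 * σ))‖ = Real.exp (-(s ^ 2 * σ)) := by
    rw [Complex.norm_exp, ← Complex.ofReal_pow, ← Complex.ofReal_mul, ← Complex.ofReal_neg,
      Complex.ofReal_re]
  refine ⟨this, ?_⟩
  rw [this, Real.exp_le_one_iff]
  have := mul_nonneg (sq_nonneg s) hσ
  linarith

/-- The trivial power with exponent `-0` puts the bound in the form required by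
`integrable_cpow_smul`, with q = 0. -/
theorem norm_heatKernel_le (hA : IsInvOneAdd A) (s : ℝ) (b : Fin n → H →L[ℂ] H) {t : Fin n → ℝ}
    (ht : ∀ i, 0 < t i) :
    ‖heatKernel A s b t‖ ≤ (∏ i, ‖b i‖) * ((∑ i, t i) ^ (-0 : ℝ) * Real.exp (-(1 * ∑ i, t i))) := by
  rw [heatKernel, norm_smul, neg_zero, Real.rpow_zero, one_mul, one_mul]
  exact (mul_le_of_le_one_left (norm_nonneg _) (norm_exp_sq_le s (Finset.sum_nonneg fun i _ => (ht i).le)).2).trans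
    (norm_heatProd_le hA.norm_heat_le b ht)

/-- For Re z > 1 the power of λ is integrable by itself, so Fubini applies to line times orthant and
the inner integral is the inverse Laplace transform. -/
theorem lineInt_eq_of_one_lt (hA : IsInvOneAdd A) (hR : IsSqResolvent D (-1) (-A))
    (hc0 : 0 < c) (hc : c < 1 / 2) (hn : 0 < n) (s : ℝ) (b : Fin n → H →L[ℂ] H) {z : ℂ}
    (hz : 1 < z.re) : lineInt D c z b s = ((-1 : ℂ) ^ n * (Complex.Gamma z)⁻¹) •
      ∫ t, ((∑ i, t i : ℝ) : ℂ) ^ (z - 1) • heatKernel A s b t ∂orthant n := by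
  let G : ℝ → (Fin n → ℝ) → H →L[ℂ] H := fun v t =>
    (((c : ℂ) + v * Complex.I) ^ (-z) * Complex.exp (((c : ℂ) + v * Complex.I) * (∑ i, t i : ℝ))) •
      heatKernel A s b t
  have hGm : AEStronglyMeasurable (Function.uncurry G) (volume.prod (orthant n)) := by
    have h1 : Continuous fun p : ℝ × (Fin n → ℝ) => ((c : ℂ) + p.1 * Complex.I) ^ (-z) *
        Complex.exp (((c : ℂ) + p.1 * Complex.I) * (∑ i, p.2 i : ℝ)) :=
      ((continuous_line_cpow hc0 _).comp continuous_fst).mul (by fun_prop)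
    exact h1.aestronglyMeasurable.smul (aestronglyMeasurable_heatKernel hA s b).comp_snd
  have hGi : Integrable (Function.uncurry G) (volume.prod (orthant n)) := by
    have h1 := integrable_sum_rpow (n := n) hn (α := 0) (c := 1 / 2) (by simpa using hn) (by norm_num)
    refine ((integrable_line_cpow hc0 hz).norm.mul_prod (h1.const_mul (∏ i, ‖b i‖))).mono' hGm ?_
    have hpos : ∀ᵐ p : ℝ × (Fin n → ℝ) ∂(volume.prod (orthant n)), ∀ i, 0 < p.2 i :=
      Measure.quasiMeasurePreserving_snd.ae (ae_orthant_pos n)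
    filter_upwards [hpos] with p hp
    have hs := sum_pos_of_pos hn hp
    change ‖(((c : ℂ) + p.1 * Complex.I) ^ (-z) *
      Complex.exp (((c : ℂ) + p.1 * Complex.I) * (∑ i, p.2 i : ℝ))) • heatKernel A s b p.2‖ ≤ _
    rw [norm_smul, norm_mul, mul_assoc]
    refine mul_le_mul_of_nonneg_left ?_ (norm_nonneg _)
    have h2 := norm_heatKernel_le hA s b hp
    have h3 : ‖Complex.exp (((c : ℂ) + p.1 * Complex.I) * (∑ i, p.2 i : ℝ))‖ ≤
        Real.exp (1 / 2 * ∑ i, p.2 i) := by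
      rw [Complex.norm_exp, Complex.re_mul_ofReal]
      refine Real.exp_le_exp.2 (mul_le_mul_of_nonneg_right ?_ hs.le)
      simpa using by linarith
    refine (mul_le_mul h3 h2 (norm_nonneg _) (Real.exp_pos _).le).trans (le_of_eq ?_)
    rw [neg_zero, Real.rpow_zero, one_mul, one_mul, mul_left_comm, ← Real.exp_add]
    congr 2
    ring_nf
  have hsw := integral_integral_swap hGi
  have e1 : ∀ v, ∫ t, G v t ∂orthant n = (Complex.I⁻¹ * (-1 : ℂ) ^ n) • lineFun D c z b s v := fun v => by
    rw [lineFun, prod_R_eq hA hR (by simp; linarith) s b, smul_smul, smul_smul, ← integral_smul]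
    refine integral_congr_ae (Eventually.of_forall fun t => ?_)
    simp only [G, heatKernel, smul_smul]
    congr 1
    have h1 : ((-1 : ℂ) ^ n) * (-1 : ℂ) ^ n = 1 := by rw [← mul_pow]; simp
    have h2 := inv_mul_cancel₀ Complex.I_ne_zero
    rw [sub_mul, sub_eq_add_neg, Complex.exp_add]
    generalize Complex.exp (((c : ℂ) + v * Complex.I) * (∑ i, t i : ℝ)) = X
    generalize Complex.exp (-((s : ℂ) ^ 2 * (∑ i, t i : ℝ))) = Y
    linear_combination (-(((c : ℂ) + v * Complex.I) ^ (-z) * X * Y * ((-1 : ℂ) ^ n) * (-1 : ℂ) ^ n)) * h2 -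
      (((c : ℂ) + v * Complex.I) ^ (-z) * X * Y) * h1
  have e2 : ∀ᵐ t ∂orthant n, ∫ v, G v t = (2 * (Real.pi : ℂ) * (Complex.Gamma z)⁻¹) •
      (((∑ i, t i : ℝ) : ℂ) ^ (z - 1) • heatKernel A s b t) := by
    filter_upwards [ae_orthant_pos n] with t ht
    simp only [G]
    rw [integral_smul_const, integral_line_cpow hc0 hz (sum_pos_of_pos hn ht), smul_smul]
    congr 1
    ring
  simp only [e1] at hsw
  rw [integral_smul, integral_congr_ae e2, integral_smul] at hsw
  have h1 : ((-1 : ℂ) ^ n) * (-1 : ℂ) ^ n = 1 := by rw [← mul_pow]; simp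
  have hpi : (Real.pi : ℂ) ≠ 0 := by exact_mod_cast Real.pi_ne_zero
  rw [lineInt]
  have h3 : (2 * (Real.pi : ℂ) * Complex.I)⁻¹ • ∫ v, lineFun D c z b s v =
      ((2 * (Real.pi : ℂ))⁻¹ * (-1 : ℂ) ^ n) • ((Complex.I⁻¹ * (-1 : ℂ) ^ n) •
        ∫ v, lineFun D c z b s v) := by
    rw [smul_smul]
    congr 1
    rw [mul_inv _ Complex.I]
    linear_combination (-(2 * (Real.pi : ℂ))⁻¹ * Complex.I⁻¹) * h1
  rw [h3, hsw, smul_smul]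
  congr 1
  field_simp

/-- Fubini is not available for 0 < Re z ≤ 1. The formula extends there by the identity theorem, as
both sides are holomorphic when n ≥ 2. -/
theorem lineInt_eq (hD : IsDenseSymm D) (hA : IsInvOneAdd A) (hR : IsSqResolvent D (-1) (-A))
    (hc0 : 0 < c) (hc : c < 1 / 2) (hn : 2 ≤ n) (s : ℝ) (b : Fin n → H →L[ℂ] H) {z : ℂ}
    (hz : 0 < z.re) : lineInt D c z b s = ((-1 : ℂ) ^ n * (Complex.Gamma z)⁻¹) •
      ∫ t, ((∑ i, t i : ℝ) : ℂ) ^ (z - 1) • heatKernel A s b t ∂orthant n := by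
  have hn' : (2 : ℝ) ≤ n := by exact_mod_cast hn
  have e : ∀ z : ℂ, ∀ v, lineFun D c z b s v = Complex.exp (z * (-Complex.log ((c : ℂ) + v * Complex.I))) •
      (Complex.I • (List.ofFn fun i => b i * R D s ((c : ℂ) + v * Complex.I)).prod) := fun z v => by
    rw [lineFun, Complex.cpow_def_of_ne_zero (line_ne_zero hc0 v), smul_smul]
    congr 3
    ring
  have d1 : DifferentiableOn ℂ (fun z => lineInt D c z b s) {z : ℂ | 0 < z.re} := by
    have := differentiableOn_integral_exp (μ := volume) (isOpen_re_gt 0)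
      (g := fun v : ℝ => -Complex.log ((c : ℂ) + v * Complex.I))
      (f := fun v : ℝ => Complex.I • (List.ofFn fun i => b i * R D s ((c : ℂ) + v * Complex.I)).prod)
      (Measurable.aestronglyMeasurable (by fun_prop))
      ((aestronglyMeasurable_prod_R hA hR hc s b).const_smul Complex.I :) fun z hz =>
        (integrable_lineFun hD hA hR hc0 hc hn s b hz).congr (Eventually.of_forall (e z))
    refine (this.const_smul ((2 * (Real.pi : ℂ) * Complex.I)⁻¹)).congr fun z _ => ?_
    simp only [lineInt, e]
    rfl
  have d2 : DifferentiableOn ℂ (fun z => ((-1 : ℂ) ^ n * (Complex.Gamma z)⁻¹) •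
      ∫ t, ((∑ i, t i : ℝ) : ℂ) ^ (z - 1) • heatKernel A s b t ∂orthant n) {z : ℂ | 0 < z.re} := by
    have h := differentiableOn_integral_cpow_smul (n := n) (by omega)
      (aestronglyMeasurable_heatKernel hA s b) one_pos fun t ht => norm_heatKernel_le hA s b ht
    have h2 : DifferentiableOn ℂ (fun z : ℂ => ∫ t, ((∑ i, t i : ℝ) : ℂ) ^ (z - 1) •
        heatKernel A s b t ∂orthant n) {z : ℂ | 0 < z.re} :=
      h.comp (f := fun z : ℂ => z - 1) (by fun_prop) fun z hz => by
        have : 0 < z.re := hz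
        simp only [Set.mem_ofPred_eq, Complex.sub_re, Complex.one_re]
        linarith
    exact DifferentiableOn.fun_smul
      ((Complex.differentiable_one_div_Gamma.differentiableOn).const_mul _) h2
  refine (d1.analyticOnNhd (isOpen_re_gt 0)).eqOn_of_preconnected_of_eventuallyEq
    (d2.analyticOnNhd (isOpen_re_gt 0)) (isPreconnected_re_gt 0) (z₀ := 2) (by simp) ?_ hz
  filter_upwards [(isOpen_re_gt 1).mem_nhds (show (2 : ℂ) ∈ {z : ℂ | 1 < z.re} by simp)] with z hz
  exact lineInt_eq_of_one_lt hA hR hc0 hc (by omega) s b hz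

end

section

open MeasureTheory Filter Topology FNSTrace

variable {H : Type*} [NormedAddCommGroup H] [InnerProductSpace ℂ H] [CompleteSpace H]
variable {M : VonNeumannAlgebra H} {τ : FNSTrace M}
variable {D : H →ₗ.[ℂ] H} {A : H →L[ℂ] H} {c s q K : ℝ} {n : ℕ}

/-! ### Traces of products of heat operators -/

theorem prod_ofFn_mem : ∀ {n : ℕ} (x : Fin n → H →L[ℂ] H) (_ : ∀ i, x i ∈ M),
    (List.ofFn x).prod ∈ M := by
  intro n
  induction n with
  | zero => intro x _; simp
  | succ n ih =>
    intro x h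
    rw [List.ofFn_succ, List.prod_cons]
    exact mul_mem (h 0) (ih _ fun i => h i.succ)

/-- One factor is estimated in trace norm and all the others in operator norm. -/
theorem traceBound_prod_ofFn : ∀ {n : ℕ} (x : Fin n → H →L[ℂ] H) (y : Fin n → ℝ) {k : ℝ} (_ : 0 ≤ k)
    (_ : ∀ i, x i ∈ M) (_ : ∀ i, ‖x i‖ ≤ y i) (j : Fin n) (_ : τ.TraceBound (x j) (y j * k)),
    τ.TraceBound (List.ofFn x).prod ((∏ i, y i) * k) := by
  intro n
  induction n with
  | zero => intro x y k _ _ _ j; exact j.elim0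
  | succ n ih =>
    intro x y k hk hM hy j hj
    have hy0 : ∀ i, 0 ≤ y i := fun i => (norm_nonneg _).trans (hy i)
    rw [List.ofFn_succ, List.prod_cons, Fin.prod_univ_succ]
    induction j using Fin.cases with
    | zero =>
      refine (hj.mul_right (mul_nonneg (hy0 0) hk) (prod_ofFn_mem _ fun i => hM i.succ)).mono ?_
      have := norm_prod_ofFn_le (fun i => x i.succ) (fun i => y i.succ) fun i => hy i.succ
      calc _ ≤ (∏ i : Fin n, y i.succ) * (y 0 * k) :=
            mul_le_mul_of_nonneg_right this (mul_nonneg (hy0 0) hk)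
        _ = _ := by ring
    | succ j =>
      have h := ih (fun i => x i.succ) (fun i => y i.succ) hk (fun i => hM i.succ)
        (fun i => hy i.succ) j hj
      have hp : 0 ≤ (∏ i : Fin n, y i.succ) * k :=
        mul_nonneg (Finset.prod_nonneg fun i _ => hy0 i.succ) hk
      refine (h.mul_left hp (hM 0)).mono ?_
      rw [mul_assoc]
      exact mul_le_mul_of_nonneg_right (hy 0) hp

/-- The heat semigroup of `1 + D²` for `A = (1 + D²)⁻¹`, with a trace estimate of order `q`. -/
structure HeatData (τ : FNSTrace M) (D : H →ₗ.[ℂ] H) (A : H →L[ℂ] H) (q K : ℝ) : Prop where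
  symm : IsDenseSymm D
  aff : IsAffiliated M D
  inv : IsInvOneAdd A
  res : IsSqResolvent D (-1) (-A)
  semigroup : IsHeatSemigroup τ (heat A)
  q_pos : 0 < q
  K_nonneg : 0 ≤ K
  bound : HeatBound τ (heat A) q K

namespace HeatData

/-- Some tⱼ is at least the average σ/n. That factor is measured in trace norm, with t_j^{-q} ≤ n^q
σ^{-q}, and half of each exponential is kept. -/
theorem traceBound (hd : HeatData τ D A q K) (hn : 0 < n) {b : Fin n → H →L[ℂ] H}
    (hb : ∀ i, b i ∈ M) {t : Fin n → ℝ} (ht : ∀ i, 0 < t i) :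
    τ.TraceBound (heatProd (heat A) b t) (((∏ i, ‖b i‖) * K * (n : ℝ) ^ q) *
      ((∑ i, t i) ^ (-q) * Real.exp (-(1 / 2 * ∑ i, t i)))) := by
  have : NeZero n := ⟨hn.ne'⟩
  have hn' : (0 : ℝ) < n := by exact_mod_cast hn
  have hs := sum_pos_of_pos hn ht
  obtain ⟨j, -, hj⟩ := Finset.exists_le_of_sum_le (s := Finset.univ) (f := fun _ : Fin n => (∑ i, t i) / n)
    (g := t) Finset.univ_nonempty (by
      rw [Finset.sum_const, Finset.card_univ, Fintype.card_fin, nsmul_eq_mul,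
        mul_div_cancel₀ _ hn'.ne'])
  have hM : ∀ i, heat A (t i) ∈ M := fun i => (hd.semigroup.fin (ht i)).1
  have hk : 0 ≤ K * t j ^ (-q) := mul_nonneg hd.K_nonneg (Real.rpow_nonneg (ht j).le _)
  have h := traceBound_prod_ofFn (τ := τ) (fun i => b i * heat A (t i))
    (fun i => ‖b i‖ * Real.exp (-(t i / 2))) hk (fun i => mul_mem (hb i) (hM i))
    (fun i => (norm_mul_le _ _).trans (mul_le_mul_of_nonneg_left
      ((hd.semigroup.norm_le (ht i)).trans (Real.exp_le_exp.2 (by linarith [ht i]))) (norm_nonneg _)))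
    j (((TraceBound.of_posFin (hd.semigroup.fin (ht j))).mul_left ENNReal.toReal_nonneg (hb j)).mono (by
      rw [mul_assoc]
      refine mul_le_mul_of_nonneg_left ((hd.bound (ht j)).trans (le_of_eq ?_)) (norm_nonneg _)
      ring))
  refine TraceBound.mono h ?_
  rw [Finset.prod_mul_distrib, ← Real.exp_sum, Finset.sum_neg_distrib, ← Finset.sum_div]
  have h1 : t j ^ (-q) ≤ (n : ℝ) ^ q * (∑ i, t i) ^ (-q) := by
    refine (Real.rpow_le_rpow_of_nonpos (by positivity) hj (neg_nonpos.2 hd.q_pos.le)).trans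
      (le_of_eq ?_)
    rw [Real.div_rpow hs.le hn'.le, Real.rpow_neg hn'.le, div_inv_eq_mul, mul_comm]
  have hp : 0 ≤ ∏ i, ‖b i‖ := Finset.prod_nonneg fun i _ => norm_nonneg _
  calc _ ≤ (∏ i, ‖b i‖) * Real.exp (-((∑ i, t i) / 2)) * (K * ((n : ℝ) ^ q * (∑ i, t i) ^ (-q))) := by
        refine mul_le_mul_of_nonneg_left (mul_le_mul_of_nonneg_left h1 hd.K_nonneg) (by positivity)
    _ = _ := by ring_nf

theorem norm_trace_le (hd : HeatData τ D A q K) (hn : 0 < n) {b : Fin n → H →L[ℂ] H}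
    (hb : ∀ i, b i ∈ M) {t : Fin n → ℝ} (ht : ∀ i, 0 < t i) :
    ‖τ.trace (heatProd (heat A) b t)‖ ≤ (((∏ i, ‖b i‖) * K * (n : ℝ) ^ q) *
      ((∑ i, t i) ^ (-q) * Real.exp (-(1 / 2 * ∑ i, t i)))) := by
  have hs := sum_pos_of_pos hn ht
  have hp : 0 ≤ ∏ i, ‖b i‖ := Finset.prod_nonneg fun i _ => norm_nonneg _
  have := hd.K_nonneg
  exact norm_le_of_traceBound (hd.traceBound hn hb ht) (by positivity)

theorem integral_trace (hd : HeatData τ D A q K) (hn : 0 < n) {b : Fin n → H →L[ℂ] H}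
    (hb : ∀ i, b i ∈ M) (s : ℝ) {w : ℂ} (hw : q - n < w.re) :
    (∫ t, ((∑ i, t i : ℝ) : ℂ) ^ w • heatKernel A s b t ∂orthant n) ∈ τ.l1 ∧
    Integrable (fun t => τ.trace (((∑ i, t i : ℝ) : ℂ) ^ w • heatKernel A s b t)) (orthant n) ∧
    τ.trace (∫ t, ((∑ i, t i : ℝ) : ℂ) ^ w • heatKernel A s b t ∂orthant n) =
      ∫ t, τ.trace (((∑ i, t i : ℝ) : ℂ) ^ w • heatKernel A s b t) ∂orthant n := by
  set C := (∏ i, ‖b i‖) * K * (n : ℝ) ^ q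
  have hg := ((integrable_sum_rpow hn (α := w.re - q) (c := 1 / 2) (by linarith)
    (by norm_num)).const_mul C).abs
  have hF := integrable_cpow_smul hn (aestronglyMeasurable_heatKernel hd.inv s b) one_pos
    (fun t ht => norm_heatKernel_le hd.inv s b ht) (w := w) (by linarith [hd.q_pos])
  have h := integral_traceBound hd.semigroup.approx hF (by
    filter_upwards [ae_orthant_pos n] with t ht
    have hs := sum_pos_of_pos hn ht
    have hp : 0 ≤ ∏ i, ‖b i‖ := Finset.prod_nonneg fun i _ => norm_nonneg _
    have hK := hd.K_nonneg
    refine TraceBound.mono (((hd.traceBound hn hb ht).smul _).smul _) ?_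
    have h1 := (norm_exp_sq_le s hs.le).2
    rw [Complex.norm_cpow_eq_rpow_re_of_pos hs]
    refine le_trans ?_ (le_abs_self _)
    calc _ ≤ (∑ i, t i) ^ w.re * (1 * (C * ((∑ i, t i) ^ (-q) *
          Real.exp (-(1 / 2 * ∑ i, t i))))) := by
          refine mul_le_mul_of_nonneg_left (mul_le_mul_of_nonneg_right h1 ?_) (by positivity)
          positivity
      _ = _ := by
        rw [sub_eq_add_neg, Real.rpow_add hs]
        ring) hg fun t => abs_nonneg _
  exact ⟨h.1.1, h.2⟩

theorem trace_heatKernel (hd : HeatData τ D A q K) (hn : 0 < n) {b : Fin n → H →L[ℂ] H}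
    (hb : ∀ i, b i ∈ M) (s : ℝ) (w : ℂ) {t : Fin n → ℝ} (ht : ∀ i, 0 < t i) :
    τ.trace (((∑ i, t i : ℝ) : ℂ) ^ w • heatKernel A s b t) =
      ((∑ i, t i : ℝ) : ℂ) ^ w * (Complex.exp (-((s : ℂ) ^ 2 * (∑ i, t i : ℝ))) *
        τ.trace (heatProd (heat A) b t)) := by
  have h := (hd.traceBound hn hb ht).1
  rw [heatKernel, trace_smul _ (Submodule.smul_mem _ _ h), trace_smul _ h]

/-- Read off at s = 0 from an exponent in the range of convergence, w = q, and then divided by σ^q.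
-/
theorem aestronglyMeasurable_trace (hd : HeatData τ D A q K) (hn : 0 < n) {b : Fin n → H →L[ℂ] H}
    (hb : ∀ i, b i ∈ M) :
    AEStronglyMeasurable (fun t => τ.trace (heatProd (heat A) b t)) (orthant n) := by
  have h := (hd.integral_trace hn hb 0 (w := (q : ℂ)) (by
    have : (0 : ℝ) < n := by exact_mod_cast hn
    simpa using this)).2.1.aestronglyMeasurable
  have h2 : AEStronglyMeasurable (fun t : Fin n → ℝ => ((∑ i, t i : ℝ) : ℂ) ^ (-(q : ℂ))) (orthant n) :=
    Measurable.aestronglyMeasurable (by fun_prop)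
  refine (h2.mul h).congr ?_
  filter_upwards [ae_orthant_pos n] with t ht
  have hs := sum_pos_of_pos hn ht
  have hs' : ((∑ i, t i : ℝ) : ℂ) ≠ 0 := by exact_mod_cast hs.ne'
  rw [Pi.mul_apply, hd.trace_heatKernel hn hb 0 _ ht, ← mul_assoc, ← Complex.cpow_add _ _ hs']
  simp

theorem lineInt_mem_l1 (hd : HeatData τ D A q K) (hc0 : 0 < c) (hc : c < 1 / 2) (hn : 2 ≤ n)
    {b : Fin n → H →L[ℂ] H} (hb : ∀ i, b i ∈ M) (s : ℝ) {z : ℂ} (hz : 0 < z.re)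
    (hq : q - n < z.re - 1) :
    lineInt D c z b s ∈ τ.l1 ∧ τ.trace (lineInt D c z b s) = ((-1 : ℂ) ^ n * (Complex.Gamma z)⁻¹) *
      ∫ t, ((∑ i, t i : ℝ) : ℂ) ^ (z - 1) * (Complex.exp (-((s : ℂ) ^ 2 * (∑ i, t i : ℝ))) *
        τ.trace (heatProd (heat A) b t)) ∂orthant n := by
  obtain ⟨h1, h2, h3⟩ := hd.integral_trace (n := n) (by omega) hb s (w := z - 1) (by simpa using hq)
  rw [lineInt_eq hd.symm hd.inv hd.res hc0 hc hn s b hz, trace_smul _ h1, h3]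
  refine ⟨Submodule.smul_mem _ _ h1, ?_⟩
  congr 1
  refine integral_congr_ae ?_
  filter_upwards [ae_orthant_pos n] with t ht
  rw [hd.trace_heatKernel (by omega) hb s _ ht]

/-- `∫ σ^w τ(b₀ h(t₀) b₁ h(t₁) ⋯) dt` over the orthant, where `σ = ∑ tᵢ`. -/
def traceInt (τ : FNSTrace M) (A : H →L[ℂ] H) (b : Fin n → H →L[ℂ] H) (w : ℂ) : ℂ :=
  ∫ t, ((∑ i, t i : ℝ) : ℂ) ^ w * τ.trace (heatProd (heat A) b t) ∂orthant n

theorem integrable_traceInt (hd : HeatData τ D A q K) (hn : 0 < n) {b : Fin n → H →L[ℂ] H}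
    (hb : ∀ i, b i ∈ M) {w : ℂ} (hw : q - n < w.re) :
    Integrable (fun t => ((∑ i, t i : ℝ) : ℂ) ^ w * τ.trace (heatProd (heat A) b t)) (orthant n) :=
  integrable_cpow_smul hn (hd.aestronglyMeasurable_trace hn hb) (c := 1 / 2) (by norm_num)
    (fun _ ht => hd.norm_trace_le hn hb ht) hw

theorem differentiableOn_traceInt (hd : HeatData τ D A q K) (hn : 0 < n) {b : Fin n → H →L[ℂ] H}
    (hb : ∀ i, b i ∈ M) : DifferentiableOn ℂ (traceInt τ A b) {w | q - n < w.re} :=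
  differentiableOn_integral_cpow_smul hn (hd.aestronglyMeasurable_trace hn hb) (c := 1 / 2)
    (by norm_num) fun _ ht => hd.norm_trace_le hn hb ht

end HeatData

/-! ### The integral over s -/

theorem integral_pow_mul_exp_sq (k : ℕ) {σ : ℝ} (hσ : 0 < σ) :
    IntegrableOn (fun s : ℝ => s ^ k * Real.exp (-(s ^ 2 * σ))) (Set.Ioi 0) ∧
    ∫ s in Set.Ioi (0 : ℝ), s ^ k * Real.exp (-(s ^ 2 * σ)) =
      σ ^ (-(((k : ℝ) + 1) / 2)) * (Real.Gamma (((k : ℝ) + 1) / 2) / 2) := by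
  have hk : (-1 : ℝ) < k := by have : (0 : ℝ) ≤ k := Nat.cast_nonneg k; linarith
  have e : ∀ s : ℝ, s ^ (k : ℝ) * Real.exp (-σ * s ^ (2 : ℝ)) = s ^ k * Real.exp (-(s ^ 2 * σ)) := fun s => by
    rw [Real.rpow_natCast, Real.rpow_ofNat]; ring_nf
  have h1 := integrableOn_rpow_mul_exp_neg_mul_rpow (p := 2) hk two_pos hσ
  have h2 := integral_rpow_mul_exp_neg_mul_rpow (p := 2) two_pos hk hσ
  simp only [e] at h1 h2
  refine ⟨h1, h2.trans ?_⟩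
  rw [neg_div]
  ring

namespace HeatData

/-- The Gaussian integral over s lowers the exponent of σ by (k+1)/2. The power k and the number n
of factors are independent: the cochain has n = k + 1, its Hochschild boundary n = k + 2. -/
theorem integral_trace_lineInt (hd : HeatData τ D A q K) (hc0 : 0 < c) (hc : c < 1 / 2) (hn : 2 ≤ n)
    {b : Fin n → H →L[ℂ] H} (hb : ∀ i, b i ∈ M) (k : ℕ) {z : ℂ} (hz : 0 < z.re)
    (hq : q - n < z.re - 1 - ((k : ℝ) + 1) / 2) :
    IntegrableOn (fun s : ℝ => (s : ℂ) ^ k * τ.trace (lineInt D c z b s)) (Set.Ioi 0) ∧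
    ∫ s in Set.Ioi (0 : ℝ), (s : ℂ) ^ k * τ.trace (lineInt D c z b s) =
      ((-1 : ℂ) ^ n * (Complex.Gamma z)⁻¹) * ((Real.Gamma (((k : ℝ) + 1) / 2) / 2 : ℝ) *
        traceInt τ A b (z - 1 - ((k : ℂ) + 1) / 2)) := by
  have hn0 : 0 < n := by omega
  have hk0 : (0 : ℝ) ≤ ((k : ℝ) + 1) / 2 := by positivity
  have hwre : (z - 1 - ((k : ℂ) + 1) / 2).re = z.re - 1 - ((k : ℝ) + 1) / 2 := by
    have : ((k : ℂ) + 1) / 2 = ((((k : ℝ) + 1) / 2 : ℝ) : ℂ) := by push_cast; ring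
    rw [this]; simp
  let G : ℝ → (Fin n → ℝ) → ℂ := fun s t => ((s ^ k * Real.exp (-(s ^ 2 * ∑ i, t i)) : ℝ) : ℂ) *
    (((∑ i, t i : ℝ) : ℂ) ^ (z - 1) * τ.trace (heatProd (heat A) b t))
  have hcp : ∀ {t : Fin n → ℝ}, (∀ i, 0 < t i) →
      (((∑ i, t i) ^ (-(((k : ℝ) + 1) / 2)) : ℝ) : ℂ) * ((∑ i, t i : ℝ) : ℂ) ^ (z - 1) =
        ((∑ i, t i : ℝ) : ℂ) ^ (z - 1 - ((k : ℂ) + 1) / 2) := fun {t} ht => by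
    have hs := sum_pos_of_pos hn0 ht
    rw [Complex.ofReal_cpow hs.le, ← Complex.cpow_add _ _ (by exact_mod_cast hs.ne')]
    congr 1
    push_cast
    ring
  have hm2 : AEStronglyMeasurable (fun t : Fin n → ℝ => ((∑ i, t i : ℝ) : ℂ) ^ (z - 1) *
      τ.trace (heatProd (heat A) b t)) (orthant n) :=
    (Measurable.aestronglyMeasurable (by fun_prop)).mul (hd.aestronglyMeasurable_trace hn0 hb)
  have hGm : AEStronglyMeasurable (Function.uncurry G) ((volume.restrict (Set.Ioi 0)).prod (orthant n)) := by
    refine AEStronglyMeasurable.mul (f := fun p : ℝ × (Fin n → ℝ) =>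
      ((p.1 ^ k * Real.exp (-(p.1 ^ 2 * ∑ i, p.2 i)) : ℝ) : ℂ))
      (Continuous.aestronglyMeasurable (by fun_prop)) ?_
    exact hm2.comp_snd
  have hti := hd.integrable_traceInt hn0 hb (w := z - 1 - ((k : ℂ) + 1) / 2) (by rw [hwre]; exact hq)
  have hint : ∀ t : Fin n → ℝ, (∀ i, 0 < t i) → ∫ s in Set.Ioi (0 : ℝ), G s t =
      ((Real.Gamma (((k : ℝ) + 1) / 2) / 2 : ℝ) : ℂ) * (((∑ i, t i : ℝ) : ℂ) ^ (z - 1 - ((k : ℂ) + 1) / 2) *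
        τ.trace (heatProd (heat A) b t)) := fun t ht => by
    simp only [G]
    rw [integral_mul_const, integral_complex_ofReal, (integral_pow_mul_exp_sq k (sum_pos_of_pos hn0 ht)).2,
      Complex.ofReal_mul, ← hcp ht]
    ring
  have hGi : Integrable (Function.uncurry G) ((volume.restrict (Set.Ioi 0)).prod (orthant n)) := by
    rw [integrable_prod_iff' hGm]
    constructor
    · filter_upwards [ae_orthant_pos n] with t ht
      have h : IntegrableOn (fun s : ℝ => ((s ^ k * Real.exp (-(s ^ 2 * ∑ i, t i)) : ℝ) : ℂ))
          (Set.Ioi 0) := (integral_pow_mul_exp_sq k (sum_pos_of_pos hn0 ht)).1.ofReal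
      exact h.mul_const (((∑ i, t i : ℝ) : ℂ) ^ (z - 1) * τ.trace (heatProd (heat A) b t))
    · refine (hti.norm.const_mul (Real.Gamma (((k : ℝ) + 1) / 2) / 2)).congr ?_
      -- The norm of the integrand has the same Gaussian integral, so Fubini reduces to
      -- integrability of the final orthant integrand.
      filter_upwards [ae_orthant_pos n] with t ht
      have hs := sum_pos_of_pos hn0 ht
      have e : ∀ s ∈ Set.Ioi (0 : ℝ), ‖Function.uncurry G (s, t)‖ =
          s ^ k * Real.exp (-(s ^ 2 * ∑ i, t i)) *
            ‖((∑ i, t i : ℝ) : ℂ) ^ (z - 1) * τ.trace (heatProd (heat A) b t)‖ := fun s hs => by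
        have hs : 0 < s := hs
        simp only [Function.uncurry, G]
        rw [norm_mul, Complex.norm_real, Real.norm_of_nonneg (by positivity)]
      rw [setIntegral_congr_fun measurableSet_Ioi e, integral_mul_const,
        (integral_pow_mul_exp_sq k hs).2, ← hcp ht, norm_mul, norm_mul, norm_mul, Complex.norm_real,
        Real.norm_of_nonneg (by positivity)]
      ring
  have hGs : ∀ s : ℝ, (s : ℂ) ^ k * τ.trace (lineInt D c z b s) =
      ((-1 : ℂ) ^ n * (Complex.Gamma z)⁻¹) * ∫ t, G s t ∂orthant n := fun s => by
    rw [(hd.lineInt_mem_l1 hc0 hc hn hb s hz (by linarith)).2, mul_left_comm, ← integral_const_mul]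
    congr 1
    refine integral_congr_ae (Eventually.of_forall fun t => ?_)
    simp only [G]
    push_cast
    ring
  simp only [hGs]
  refine ⟨hGi.integral_prod_left.const_mul _, ?_⟩
  rw [integral_const_mul, integral_integral_swap hGi]
  congr 1
  rw [traceInt, ← integral_const_mul]
  refine integral_congr_ae ?_
  filter_upwards [ae_orthant_pos n] with t ht using hint t ht

end HeatData

end

section

open MeasureTheory Filter Topology FNSTrace

variable {H : Type*} [NormedAddCommGroup H] [InnerProductSpace ℂ H] [CompleteSpace H]
variable {M : VonNeumannAlgebra H} {τ : FNSTrace M}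
variable {D : H →ₗ.[ℂ] H} {A : H →L[ℂ] H} {c s q K : ℝ} {n k : ℕ}

/-! ### Cyclic permutations -/

theorem trace_prod_ofFn_rotate_one {y : Fin (k + 1) → H →L[ℂ] H} (hy : ∀ i, y i ∈ τ.l1) :
    τ.trace (List.ofFn fun i => y (1 + i)).prod = τ.trace (List.ofFn y).prod := by
  rw [List.ofFn_succ_last, List.ofFn_succ (f := y), List.prod_append, List.prod_singleton, List.prod_cons]
  have e1 : (1 : Fin (k + 1)) + Fin.last k = 0 := by rw [add_comm (1 : Fin (k + 1)), Fin.last_add_one]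
  have e2 : ∀ i : Fin k, (1 : Fin (k + 1)) + i.castSucc = i.succ := fun i => by
    rw [add_comm (1 : Fin (k + 1)), Fin.coeSucc_eq_succ]
  simp only [e1, e2]
  exact trace_mul_comm (hy 0) (prod_ofFn_mem _ fun i => mem_vN_of_mem_l1 (hy i.succ))

theorem trace_prod_ofFn_rotate {y : Fin (k + 1) → H →L[ℂ] H} (hy : ∀ i, y i ∈ τ.l1)
    (j : Fin (k + 1)) :
    τ.trace (List.ofFn fun i => y (j + i)).prod = τ.trace (List.ofFn y).prod := by
  induction j using Fin.induction with
  | zero => simp only [zero_add]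
  | succ j ih =>
    rw [← ih, ← trace_prod_ofFn_rotate_one (y := fun i => y (j.castSucc + i)) fun i => hy _]
    simp only [← add_assoc, Fin.coeSucc_eq_succ]

theorem HeatData.trace_heatProd_rotate (hd : HeatData τ D A q K) {x : Fin (k + 1) → H →L[ℂ] H}
    (hx : ∀ i, x i ∈ M) {t : Fin (k + 1) → ℝ} (ht : ∀ i, 0 < t i) (j : Fin (k + 1)) :
    τ.trace (heatProd (heat A) (fun i => x (j + i)) fun i => t (j + i)) =
      τ.trace (heatProd (heat A) x t) :=
  trace_prod_ofFn_rotate (y := fun i => x i * heat A (t i))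
    (fun i => mul_mem_l1 (posFin_subset_l1 (hd.semigroup.fin (ht i))) (hx i)) j

theorem heatProd_cons (h : ℝ → H →L[ℂ] H) (b : H →L[ℂ] H) (x : Fin n → H →L[ℂ] H)
    (t : Fin (n + 1) → ℝ) :
    heatProd h (Fin.cons b x) t = b * h (t 0) * heatProd h x (fun i => t i.succ) := by
  rw [heatProd, List.ofFn_succ, List.prod_cons]
  rfl

theorem heatProd_succ_last (h : ℝ → H →L[ℂ] H) (x : Fin (n + 1) → H →L[ℂ] H)
    (t : Fin (n + 1) → ℝ) :
    heatProd h x t = heatProd h (fun i => x i.castSucc) (fun i => t i.castSucc) *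
      (x (Fin.last n) * h (t (Fin.last n))) := by
  rw [heatProd, List.ofFn_succ_last, List.prod_append, List.prod_singleton]
  rfl

/-! ### Merging two variables -/

/-- The integrand sees the first and last variables only through their sum; integrating along the
fibres leaves that sum as one variable, weighted by its length. -/
theorem integral_orthant_merge {f : (Fin (k + 1) → ℝ) → ℂ}
    (h1 : Integrable (fun t : Fin (k + 2) → ℝ => f ((Fin.last k).insertNth
      (t 0 + t (Fin.last k).succ) fun j => t ((Fin.last k).succAbove j).succ)) (orthant (k + 2)))
    (h2 : Integrable (fun t => (t (Fin.last k) : ℂ) * f t) (orthant (k + 1))) :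
    ∫ t, f ((Fin.last k).insertNth (t 0 + t (Fin.last k).succ)
      fun j => t ((Fin.last k).succAbove j).succ) ∂orthant (k + 2) =
      ∫ t, (t (Fin.last k) : ℂ) * f t ∂orthant (k + 1) := by
  set μ : Measure ℝ := volume.restrict (Set.Ioi (0 : ℝ)) with hμ
  have m1 := measurePreserving_orthant_cons (k + 1) 0
  have m2 := measurePreserving_orthant_cons k (Fin.last k)
  have m3 := (MeasurePreserving.id μ).prod m2
  have m4 := (measurePreserving_prodAssoc μ μ (orthant k)).symm
  have m5 := m4.comp (m3.comp m1)
  let e := (MeasurableEquiv.piFinSuccAbove (fun _ : Fin (k + 2) => ℝ) 0).trans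
    (((MeasurableEquiv.refl ℝ).prodCongr
      (MeasurableEquiv.piFinSuccAbove (fun _ : Fin (k + 1) => ℝ) (Fin.last k))).trans
        MeasurableEquiv.prodAssoc.symm)
  have m6 : MeasurePreserving e (orthant (k + 2)) ((μ.prod μ).prod (orthant k)) := m5
  let G : (ℝ × ℝ) × (Fin k → ℝ) → ℂ := fun p =>
    f ((Fin.last k).insertNth (p.1.1 + p.1.2) p.2)
  have hG : (fun t : Fin (k + 2) → ℝ => f ((Fin.last k).insertNth
      (t 0 + t (Fin.last k).succ) fun j => t ((Fin.last k).succAbove j).succ)) = G ∘ e := by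
    ext t; rfl
  have hGi : Integrable G ((μ.prod μ).prod (orthant k)) := by
    rw [← m6.integrable_comp_emb e.measurableEmbedding, ← hG]
    exact h1
  let L : ℝ × (Fin k → ℝ) → ℂ := fun p => (p.1 : ℂ) * f ((Fin.last k).insertNth p.1 p.2)
  have hL : (fun t : Fin (k + 1) → ℝ => (t (Fin.last k) : ℂ) * f t) =
      L ∘ MeasurableEquiv.piFinSuccAbove (fun _ : Fin (k + 1) => ℝ) (Fin.last k) := by
    ext t
    change _ = (t (Fin.last k) : ℂ) * f ((Fin.last k).insertNth (t (Fin.last k))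
      fun j => t ((Fin.last k).succAbove j))
    congr 2
    exact (Fin.insertNth_self_removeNth (Fin.last k) t).symm
  have hLi : Integrable L (μ.prod (orthant k)) := by
    rw [← m2.integrable_comp_emb (MeasurableEquiv.measurableEmbedding _), ← hL]
    exact h2
  rw [hG, hL]
  refine (m6.integral_comp' G).trans (Eq.trans ?_ (m2.integral_comp' L).symm)
  rw [integral_prod_symm _ hGi, integral_prod_symm _ hLi]
  refine integral_congr_ae ?_
  filter_upwards [hGi.prod_left_ae] with y hy
  refine (integral_add_prod (φ := fun w => f ((Fin.last k).insertNth w y)) hy).trans ?_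
  refine integral_congr_ae (Eventually.of_forall fun w => ?_)
  simp only [L, Complex.real_smul]

namespace HeatData

/-- With leading entry 1, cyclicity carries h(t₀) past the end of the product, where it merges with
the last heat operator. -/
theorem traceInt_cons_one (hd : HeatData τ D A q K) {x : Fin (k + 1) → H →L[ℂ] H}
    (hx : ∀ i, x i ∈ M) {w : ℂ} (hw : q - ((k + 2 : ℕ) : ℝ) < w.re) :
    Integrable (fun t => (t (Fin.last k) : ℂ) * (((∑ i, t i : ℝ) : ℂ) ^ w *
      τ.trace (heatProd (heat A) x t))) (orthant (k + 1)) ∧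
    traceInt τ A (Fin.cons 1 x : Fin (k + 2) → H →L[ℂ] H) w =
      ∫ t, (t (Fin.last k) : ℂ) * (((∑ i, t i : ℝ) : ℂ) ^ w * τ.trace (heatProd (heat A) x t))
        ∂orthant (k + 1) := by
  have hcx : ∀ i, (Fin.cons 1 x : Fin (k + 2) → H →L[ℂ] H) i ∈ M := fun i => by
    induction i using Fin.cases with
    | zero => simp
    | succ i => simpa using hx i
  have hi := hd.integrable_traceInt (n := k + 2) (by omega) hcx hw
  have hj := hd.integrable_traceInt (n := k + 1) (by omega) hx (w := w + 1) (by
    push_cast at hw ⊢; rw [Complex.add_re, Complex.one_re]; linarith)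
  have h2 : Integrable (fun t => (t (Fin.last k) : ℂ) * (((∑ i, t i : ℝ) : ℂ) ^ w *
      τ.trace (heatProd (heat A) x t))) (orthant (k + 1)) := by
    refine hj.mono (AEStronglyMeasurable.mul (Continuous.aestronglyMeasurable (by fun_prop))
      ((Measurable.aestronglyMeasurable (by fun_prop)).mul
        (hd.aestronglyMeasurable_trace (by omega) hx))) ?_
    filter_upwards [ae_orthant_pos (k + 1)] with t ht
    have hs := sum_pos_of_pos (by omega) ht
    rw [Complex.cpow_add _ _ (by exact_mod_cast hs.ne'), Complex.cpow_one, norm_mul, norm_mul,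
      norm_mul, norm_mul, Complex.norm_real, Complex.norm_real, Real.norm_of_nonneg hs.le,
      Real.norm_of_nonneg (ht _).le, mul_comm _ (∑ i, t i), mul_assoc]
    exact mul_le_mul_of_nonneg_right (Finset.single_le_sum (fun j _ => (ht j).le)
      (Finset.mem_univ _)) (by positivity)
  refine ⟨h2, ?_⟩
  have key : ∀ᵐ t ∂orthant (k + 2), ((∑ i, t i : ℝ) : ℂ) ^ w *
      τ.trace (heatProd (heat A) (Fin.cons 1 x) t) =
      (fun t : Fin (k + 1) → ℝ => ((∑ i, t i : ℝ) : ℂ) ^ w * τ.trace (heatProd (heat A) x t))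
        ((Fin.last k).insertNth (t 0 + t (Fin.last k).succ)
          fun j => t ((Fin.last k).succAbove j).succ) := by
    filter_upwards [ae_orthant_pos (k + 2)] with t ht
    have hT : heatProd (heat A) x (fun i => t i.succ) ∈ τ.l1 :=
      (hd.traceBound (by omega) hx fun i => ht i.succ).1
    have e1 : ∀ j : Fin k, (Fin.last k).succAbove j = j.castSucc := fun j => by simp
    simp only [Fin.insertNth_last', e1]
    congr 1
    · congr 2
      rw [Fin.sum_univ_succ, Fin.sum_univ_castSucc, Fin.sum_univ_castSucc (n := k)]
      simp only [Fin.snoc_castSucc, Fin.snoc_last]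
      ring
    · rw [heatProd_cons, one_mul, trace_mul_comm hT (hd.semigroup.fin (ht 0)).1,
        heatProd_succ_last _ x, heatProd_succ_last _ x]
      simp only [Fin.snoc_castSucc, Fin.snoc_last]
      rw [add_comm (t 0), ← hd.semigroup.mul (ht _) (ht 0)]
      simp only [mul_assoc]
  rw [traceInt, integral_congr_ae key]
  exact integral_orthant_merge (f := fun t : Fin (k + 1) → ℝ => ((∑ i, t i : ℝ) : ℂ) ^ w *
    τ.trace (heatProd (heat A) x t)) (hi.congr key) h2

/-- After rotating the integration variables along with the entries, the j-th term is the same trace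
weighted by one variable tᵢ, each occurring once. The weights add up to σ, hence the exponent w + 1.
-/
theorem sum_traceInt_cons_one (hd : HeatData τ D A q K) {x : Fin (k + 1) → H →L[ℂ] H}
    (hx : ∀ i, x i ∈ M) {w : ℂ} (hw : q - ((k + 2 : ℕ) : ℝ) < w.re) :
    ∑ j, traceInt τ A (Fin.cons 1 fun i => x (j + i) : Fin (k + 2) → H →L[ℂ] H) w =
      traceInt τ A x (w + 1) := by
  let g : Fin (k + 1) → (Fin (k + 1) → ℝ) → ℂ := fun j t => (t (Fin.last k) : ℂ) *
    (((∑ i, t i : ℝ) : ℂ) ^ w * τ.trace (heatProd (heat A) (fun i => x (j + i)) t))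
  have e1 : ∀ j, Integrable (fun t => g j fun i => t (j + i)) (orthant (k + 1)) := fun j =>
    (measurePreserving_orthant_comp (Equiv.addLeft j)).integrable_comp_emb
      (MeasurableEquiv.measurableEmbedding _) |>.2 (hd.traceInt_cons_one (fun i => hx (j + i)) hw).1
  have e2 : ∀ j, traceInt τ A (Fin.cons 1 fun i => x (j + i) : Fin (k + 2) → H →L[ℂ] H) w =
      ∫ t, g j (fun i => t (j + i)) ∂orthant (k + 1) := fun j => by
    rw [(hd.traceInt_cons_one (fun i => hx (j + i)) hw).2]
    exact (integral_orthant_comp (Equiv.addLeft j) (g j)).symm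
  simp only [e2]
  rw [← integral_finsetSum _ fun j _ => e1 j, traceInt]
  refine integral_congr_ae ?_
  filter_upwards [ae_orthant_pos (k + 1)] with t ht
  have hs := sum_pos_of_pos (by omega) ht
  have e3 : ∀ j : Fin (k + 1), ∑ i, t (j + i) = ∑ i, t i := fun j =>
    Equiv.sum_comp (Equiv.addLeft j) t
  simp only [g, e3, hd.trace_heatProd_rotate hx ht]
  rw [← Finset.sum_mul, Complex.cpow_add _ _ (by exact_mod_cast hs.ne'), Complex.cpow_one,
    ← Complex.ofReal_sum, show ∑ i, t (i + Fin.last k) = ∑ i, t i from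
      Equiv.sum_comp (Equiv.addRight (Fin.last k)) t]
  ring

end HeatData

end

section

open MeasureTheory Filter Topology FNSTrace

/-! ### The algebra of the Hochschild boundary -/

theorem contractNth_zero {α : Type*} (g : α → α → α) {k : ℕ} (x : Fin (k + 2) → α) :
    Fin.contractNth 0 g x = Fin.cons (g (x 0) (x 1)) fun i : Fin k => x i.succ.succ := by
  ext i
  induction i using Fin.cases with
  | zero => simp [Fin.contractNth]
  | succ i => simp [Fin.contractNth]

theorem contractNth_succ {α : Type*} (g : α → α → α) {k : ℕ} (j : Fin (k + 1)) (x : Fin (k + 2) → α) :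
    Fin.contractNth j.succ g x = Fin.cons (x 0) (Fin.contractNth j g fun i => x i.succ) := by
  ext i
  induction i using Fin.cases with
  | zero => simp [Fin.contractNth]
  | succ i => simp [Fin.contractNth]

section

variable {α B : Type*} [Mul α] [Ring B] [Algebra ℂ B]

/-- `u₀ T u₁ T ⋯`. -/
def interProd (T : B) {k : ℕ} (u : Fin k → B) : B := (List.ofFn fun i => u i * T).prod

theorem interProd_zero (T : B) (u : Fin 0 → B) : interProd T u = 1 := by simp [interProd]

theorem interProd_succ (T : B) {k : ℕ} (u : Fin (k + 1) → B) :
    interProd T u = u 0 * T * interProd T fun i => u i.succ := by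
  rw [interProd, List.ofFn_succ, List.prod_cons]; rfl

theorem interProd_cons (T : B) {k : ℕ} (y : B) (u : Fin k → B) :
    interProd T (Fin.cons y u : Fin (k + 1) → B) = y * T * interProd T u := by
  rw [interProd_succ]; rfl

theorem prod_mul_interProd (T : B) : ∀ {k : ℕ} (u : Fin k → B),
    (List.ofFn fun i => T * u i).prod * T = T * interProd T u := by
  intro k
  induction k with
  | zero => intro u; simp [interProd_zero]
  | succ k ih =>
    intro u
    rw [List.ofFn_succ, List.prod_cons, interProd_succ, mul_assoc, ih]
    simp only [mul_assoc]

/-- Here d is a derivation along f, and Q stands for DT. Leibniz splits each contracted entry in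
two, and neighbouring terms combine to commutators [T, f(x)] = Q d(x) T + T d(x) Q. In the
alternating sum the interior occurrences of Q cancel, leaving Q at the two ends only. The induction
absorbs the first entry into y. -/
theorem hochschild_telescope {f d : α → B} (hd : ∀ x y, d (x * y) = d x * f y + f x * d y)
    {T Q : B} (hT : ∀ x, T * f x - f x * T = Q * d x * T + T * d x * Q) :
    ∀ {k : ℕ} (x : Fin (k + 1) → α) (y : B),
      y * f (x 0) * T * interProd T (fun i => d (x i.succ)) +
        ∑ j : Fin k, (-1 : ℂ) ^ ((j : ℕ) + 1) •
          (y * T * interProd T fun i => d (Fin.contractNth j.castSucc (· * ·) x i)) +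
        (-1 : ℂ) ^ (k + 1) • (y * T * interProd T (fun i => d (x i.castSucc)) * f (x (Fin.last k))) =
      (-1 : ℂ) ^ (k + 1) • (y * (List.ofFn fun i => T * d (x i)).prod * Q) -
        y * Q * interProd T (fun i => d (x i)) := by
  intro k
  induction k with
  | zero =>
    intro x y
    have h := congrArg (fun z => y * z) (hT (x 0))
    have e : (List.ofFn fun i : Fin (0 + 1) => T * d (x i)).prod = T * d (x 0) := by simp
    rw [e]
    simp only [interProd_zero, interProd_succ, mul_one, Finset.univ_eq_empty, Finset.sum_empty, add_zero, zero_add, pow_one,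
      Fin.last_zero, neg_smul, one_smul]
    simp only [mul_add, mul_sub, ← mul_assoc] at h ⊢
    rw [← sub_eq_zero] at h ⊢
    rw [← neg_eq_zero, ← h]
    abel
  | succ k ih =>
    intro x y
    have h := congrArg (fun z => y * z * interProd T (fun i : Fin (k + 1) => d (x i.succ))) (hT (x 0))
    have h2 := ih (fun i => x i.succ) (y * T * d (x 0))
    rw [Fin.sum_univ_succ]
    have e1 : (interProd T fun i => d (Fin.contractNth (Fin.castSucc 0) (· * ·) x i)) =
        d (x 0) * f (x 1) * T * interProd T (fun i : Fin k => d (x i.succ.succ)) +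
          f (x 0) * interProd T (fun i => d (x i.succ)) := by
      rw [Fin.castSucc_zero, contractNth_zero, interProd_succ, interProd_succ _ fun i => d (x i.succ)]
      simp only [Fin.cons_zero, Fin.cons_succ, hd, add_mul, mul_assoc]
      rfl
    have e2 : ∀ j : Fin k, (interProd T fun i => d (Fin.contractNth j.succ.castSucc (· * ·) x i)) =
        d (x 0) * T * interProd T (fun i => d (Fin.contractNth j.castSucc (· * ·) (fun i => x i.succ) i)) :=
      fun j => by
      rw [← Fin.succ_castSucc, contractNth_succ, interProd_succ]
      simp only [Fin.cons_zero, Fin.cons_succ]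
    have e3 : (interProd T fun i => d (x i.castSucc)) =
        d (x 0) * T * interProd T (fun i : Fin k => d (x i.castSucc.succ)) := by
      rw [interProd_succ]
      simp only [Fin.castSucc_zero, Fin.succ_castSucc]
    have e4 : ∑ j : Fin k, (-1 : ℂ) ^ (((j.succ : Fin (k + 1)) : ℕ) + 1) •
        (y * T * interProd T fun i => d (Fin.contractNth j.succ.castSucc (· * ·) x i)) =
        -∑ j : Fin k, (-1 : ℂ) ^ ((j : ℕ) + 1) • (y * T * d (x 0) * T *
          interProd T fun i => d (Fin.contractNth j.castSucc (· * ·) (fun i => x i.succ) i)) := by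
      rw [← Finset.sum_neg_distrib]
      refine Finset.sum_congr rfl fun j _ => ?_
      rw [e2, Fin.val_succ, pow_succ _ ((j : ℕ) + 1), mul_neg_one, neg_smul]
      simp only [mul_assoc]
    rw [e4, e1, e3, List.ofFn_succ, List.prod_cons, interProd_succ _ fun i => d (x i),
      pow_succ _ (k + 1), mul_neg_one]
    have e5 : x (Fin.last k).succ = x (Fin.last (k + 1)) := by rw [Fin.succ_last]
    have e6 : (x (Fin.succ 0)) = x 1 := rfl
    simp only [e5, e6] at h2
    generalize (∑ j : Fin k, (-1 : ℂ) ^ ((j : ℕ) + 1) • (y * T * d (x 0) * T *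
          interProd T fun i => d (Fin.contractNth j.castSucc (· * ·) (fun i => x i.succ) i))) = S at h2 ⊢
    simp only [mul_add, add_mul, mul_sub, sub_mul, ← mul_assoc, neg_smul, smul_add,
      Fin.val_zero, zero_add, pow_one, one_smul] at h h2 ⊢
    rw [← sub_eq_zero] at h h2 ⊢
    have := congrArg₂ (fun a b => -a - b) h h2
    simp only [neg_zero, sub_zero] at this
    rw [← this]
    abel

end

end

section

open MeasureTheory Filter Topology FNSTrace

variable {H : Type*} [NormedAddCommGroup H] [InnerProductSpace ℂ H] [CompleteSpace H]
variable {M : VonNeumannAlgebra H} {τ : FNSTrace M}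
variable {D : H →ₗ.[ℂ] H} {A : H →L[ℂ] H} {c s q K : ℝ} {n m : ℕ}

/-! ### The trace of the Hochschild boundary -/

theorem conj_lineInt (hd : HeatData τ D A q K) (hc0 : 0 < c) (hc : c < 1 / 2) (hn : 2 ≤ n)
    {b : Fin n → H →L[ℂ] H} {s : ℝ} {z : ℂ} (hz : 0 < z.re) (X Y : H →L[ℂ] H) :
    Integrable (fun v => X * lineFun D c z b s v * Y) ∧
    X * lineInt D c z b s * Y =
      (2 * (Real.pi : ℂ) * Complex.I)⁻¹ • ∫ v : ℝ, X * lineFun D c z b s v * Y := by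
  have hi := integrable_lineFun hd.symm hd.inv hd.res hc0 hc hn s b hz
  refine ⟨(hi.const_mul X).mul_const Y, ?_⟩
  have := (ContinuousLinearMap.mulLeftRight ℂ (H →L[ℂ] H) X Y).integral_comp_comm hi
  simp only [ContinuousLinearMap.mulLeftRight_apply] at this
  rw [this, lineInt, mul_smul_comm, smul_mul_assoc]

theorem lineFun_eq (D : H →ₗ.[ℂ] H) (c : ℝ) (z : ℂ) (b : Fin n → H →L[ℂ] H) (s v : ℝ) :
    lineFun D c z b s v = (((c : ℂ) + v * Complex.I) ^ (-z) * Complex.I) •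
      interProd (R D s ((c : ℂ) + v * Complex.I)) b := rfl

theorem mul_lineInt_cons (hd : HeatData τ D A q K) (hc0 : 0 < c) (hc : c < 1 / 2) (hn : 1 ≤ n)
    {u : Fin n → H →L[ℂ] H} {s : ℝ} {z : ℂ} (hz : 0 < z.re) (x y : H →L[ℂ] H) :
    lineInt D c z (Fin.cons (x * y) u : Fin (n + 1) → H →L[ℂ] H) s =
      x * lineInt D c z (Fin.cons y u : Fin (n + 1) → H →L[ℂ] H) s := by
  have h := (conj_lineInt hd hc0 hc (show 2 ≤ n + 1 by omega) (b := Fin.cons y u) (s := s) hz x 1).2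
  simp only [mul_one] at h
  rw [h, lineInt]
  congr 2
  ext1 v
  rw [lineFun_eq, lineFun_eq, interProd_cons, interProd_cons, mul_smul_comm]
  simp only [mul_assoc]

variable {𝓐 : StarSubalgebra ℂ (H →L[ℂ] H)}

/-- `(a₀, [D, a₁], …, [D, a_m])`. -/
def formVec (D : H →ₗ.[ℂ] H) (a : Fin (m + 1) → 𝓐) : Fin (m + 1) → H →L[ℂ] H :=
  Fin.cons (a 0 : H →L[ℂ] H) fun j : Fin m => comm D (a j.succ)

/-- The elements of `𝓐` lie in `M` and have bounded commutators with `D`. -/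
structure HasCommutators (M : VonNeumannAlgebra H) (𝓐 : StarSubalgebra ℂ (H →L[ℂ] H))
    (D : H →ₗ.[ℂ] H) : Prop where
  mem : ∀ a : 𝓐, (a : H →L[ℂ] H) ∈ M
  comm_mem : ∀ a : 𝓐, comm D (a : H →L[ℂ] H) ∈ M
  isCommutator : ∀ a : 𝓐, IsCommutator D (a : H →L[ℂ] H) (comm D a)
  leibniz : ∀ a b : 𝓐, comm D ((a * b : 𝓐) : H →L[ℂ] H) = comm D a * b + a * comm D b

theorem formVec_mem (h : HasCommutators M 𝓐 D) (a : Fin (m + 1) → 𝓐) (i : Fin (m + 1)) :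
    formVec D a i ∈ M := by
  induction i using Fin.cases with
  | zero => exact h.mem (a 0)
  | succ i => exact h.comm_mem (a i.succ)

/-- E is a heat operator and B = DE. The Q at either end is moved outwards by QE = TB and E a₀ Q =
(B a₀ - E[D, a₀])T. The unbounded commutator with D then appears as the bounded EXB - BXE, plus the
term whose first entry is [D, a₀]. -/
theorem conj_boundary (h : HasCommutators M 𝓐 D) {z : ℂ} {T Q E B : H →L[ℂ] H}
    (hT : IsSqResolvent D z T) (hQ : ∀ x, (T x, Q x) ∈ D.graph ∧ (Q x, z • T x - x) ∈ D.graph)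
    (hE1 : ∀ x, (E x, B x) ∈ D.graph) (hE2 : ∀ x u, (x, u) ∈ D.graph → B x = E u)
    (hm : Odd m) (a : Fin (m + 2) → 𝓐) :
    E * ((∑ j : Fin (m + 1), (-1 : ℂ) ^ (j : ℕ) •
        interProd T (formVec D (Fin.contractNth j.castSucc (· * ·) a))) +
      interProd T (formVec D fun i => a i.castSucc) * a (Fin.last (m + 1))) * E =
      E * interProd T (formVec D a) * B - B * interProd T (formVec D a) * E +
        E * interProd T (fun i => comm D (a i)) * E := by
  have key := hochschild_telescope (α := 𝓐) (f := fun x => (x : H →L[ℂ] H))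
    (d := fun x => comm D (x : H →L[ℂ] H)) h.leibniz
    (fun x => hT.commutator hQ (h.isCommutator x)) (fun i => a i.succ) (a 0 : H →L[ℂ] H)
  rw [(show Even (m + 1) from hm.add_one).neg_one_pow, one_smul, one_smul] at key
  have e : (∑ j : Fin (m + 1), (-1 : ℂ) ^ (j : ℕ) •
        interProd T (formVec D (Fin.contractNth j.castSucc (· * ·) a))) +
      interProd T (formVec D fun i => a i.castSucc) * a (Fin.last (m + 1)) =
      (a 0 : H →L[ℂ] H) * (List.ofFn fun i : Fin (m + 1) => T * comm D (a i.succ : H →L[ℂ] H)).prod * Q -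
        (a 0 : H →L[ℂ] H) * Q * interProd T (fun i : Fin (m + 1) => comm D (a i.succ : H →L[ℂ] H)) := by
    rw [← key, Fin.sum_univ_succ]
    congr 1
    congr 1
    · rw [Fin.castSucc_zero, contractNth_zero, Fin.val_zero, pow_zero, one_smul, formVec,
        interProd_cons]
      rfl
    · refine Finset.sum_congr rfl fun j _ => ?_
      rw [← Fin.succ_castSucc, contractNth_succ, formVec, interProd_cons]
      rfl
    · rw [formVec, interProd_cons]
      rfl
  have hQE : Q * E = T * B := by
    ext x
    exact hT.mul_graph hQ (hE1 x)
  have hEQ : E * (a 0 : H →L[ℂ] H) * Q = B * a 0 * T - E * comm D (a 0 : H →L[ℂ] H) * T := by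
    ext x
    have := hE2 _ _ (isCommutator_graph (h.isCommutator (a 0)) (hQ x).1)
    change E ((a 0 : H →L[ℂ] H) (Q x)) = B ((a 0 : H →L[ℂ] H) (T x)) - E (comm D (a 0 : H →L[ℂ] H) (T x))
    rw [this, _root_.map_add, add_sub_cancel_right]
  have hP := prod_mul_interProd T fun i : Fin (m + 1) => comm D (a i.succ : H →L[ℂ] H)
  have e2 : interProd T (formVec D a) = (a 0 : H →L[ℂ] H) * T *
      interProd T (fun i : Fin (m + 1) => comm D (a i.succ : H →L[ℂ] H)) := interProd_cons T _ _
  have e3 : interProd T (fun i => comm D (a i : H →L[ℂ] H)) = comm D (a 0 : H →L[ℂ] H) * T *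
      interProd T (fun i : Fin (m + 1) => comm D (a i.succ : H →L[ℂ] H)) := interProd_succ T _
  rw [e, e2, e3]
  generalize interProd T (fun i : Fin (m + 1) => comm D (a i.succ : H →L[ℂ] H)) = P at hP ⊢
  generalize (List.ofFn fun i : Fin (m + 1) => T * comm D (a i.succ : H →L[ℂ] H)).prod = P' at hP ⊢
  calc _ = E * a 0 * P' * (Q * E) - (E * a 0 * Q) * P * E := by noncomm_ring
    _ = E * a 0 * (P' * T) * B - (B * a 0 * T - E * comm D (a 0 : H →L[ℂ] H) * T) * P * E := by
      rw [hQE, hEQ]; noncomm_ring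
    _ = _ := by rw [hP]; noncomm_ring

/-- The operator Q depends on λ but no longer occurs in `conj_boundary`, so that identity can be
integrated along the line with E and B fixed. -/
theorem conj_boundary_lineInt (hd : HeatData τ D A q K) (h : HasCommutators M 𝓐 D) (hc0 : 0 < c)
    (hc : c < 1 / 2) (hm : Odd m) {E B : H →L[ℂ] H}
    (hE1 : ∀ x, (E x, B x) ∈ D.graph) (hE2 : ∀ x u, (x, u) ∈ D.graph → B x = E u)
    (a : Fin (m + 2) → 𝓐) (s : ℝ) {z : ℂ} (hz : 0 < z.re) :
    E * ((∑ j : Fin (m + 1), (-1 : ℂ) ^ (j : ℕ) •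
        lineInt D c z (formVec D (Fin.contractNth j.castSucc (· * ·) a)) s) +
      lineInt D c z (formVec D fun i => a i.castSucc) s * a (Fin.last (m + 1))) * E =
      E * lineInt D c z (formVec D a) s * B - B * lineInt D c z (formVec D a) s * E +
        E * lineInt D c z (fun i => comm D (a i)) s * E := by
  have hm1 : 1 ≤ m := hm.pos
  have H1 := fun j : Fin (m + 1) => conj_lineInt hd hc0 hc (show 2 ≤ m + 1 by omega)
    (b := formVec D (Fin.contractNth j.castSucc (· * ·) a)) (s := s) hz E E
  have H2 := conj_lineInt hd hc0 hc (show 2 ≤ m + 1 by omega)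
    (b := formVec D fun i => a i.castSucc) (s := s) hz E (a (Fin.last (m + 1)) * E)
  have H3 := conj_lineInt hd hc0 hc (show 2 ≤ m + 2 by omega) (b := formVec D a) (s := s) hz E B
  have H4 := conj_lineInt hd hc0 hc (show 2 ≤ m + 2 by omega) (b := formVec D a) (s := s) hz B E
  have H5 := conj_lineInt hd hc0 hc (show 2 ≤ m + 2 by omega)
    (b := fun i => comm D (a i : H →L[ℂ] H)) (s := s) hz E E
  have pt : ∀ v : ℝ, (∑ j : Fin (m + 1), (-1 : ℂ) ^ (j : ℕ) •
        (E * lineFun D c z (formVec D (Fin.contractNth j.castSucc (· * ·) a)) s v * E)) +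
      E * lineFun D c z (formVec D fun i => a i.castSucc) s v * (a (Fin.last (m + 1)) * E) =
      E * lineFun D c z (formVec D a) s v * B - B * lineFun D c z (formVec D a) s v * E +
        E * lineFun D c z (fun i => comm D (a i)) s v * E := fun v => by
    have hT := (R_eq hd.inv hd.res (l := (c : ℂ) + v * Complex.I) (by simp; linarith) s).2
    obtain ⟨Q, hQ⟩ := hT.exists_mul hd.symm
    have := congrArg (fun X => (((c : ℂ) + v * Complex.I) ^ (-z) * Complex.I) • X)
      (conj_boundary h hT hQ hE1 hE2 hm a)
    simp only [lineFun_eq, mul_smul_comm, smul_mul_assoc, mul_add, add_mul, Finset.mul_sum,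
      Finset.sum_mul, smul_add, smul_sub, Finset.smul_sum, mul_assoc] at this ⊢
    rw [← this]
    congr 1
    exact Finset.sum_congr rfl fun j _ => smul_comm _ _ _
  have hint := integral_congr_ae (μ := volume) (Eventually.of_forall pt)
  have H6 : ∀ j : Fin (m + 1), Integrable (fun v => (-1 : ℂ) ^ (j : ℕ) •
      (E * lineFun D c z (formVec D (Fin.contractNth j.castSucc (· * ·) a)) s v * E)) :=
    fun j => (H1 j).1.smul ((-1 : ℂ) ^ (j : ℕ))
  have H7 : Integrable fun v => E * lineFun D c z (formVec D a) s v * B -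
      B * lineFun D c z (formVec D a) s v * E := H3.1.sub H4.1
  rw [integral_add (integrable_finsetSum _ fun j _ => H6 j) H2.1,
    integral_finsetSum _ fun j _ => H6 j, integral_add H7 H5.1,
    integral_sub H3.1 H4.1] at hint
  simp only [integral_smul] at hint
  have := congrArg (fun X => (2 * (Real.pi : ℂ) * Complex.I)⁻¹ • X) hint
  simp only [smul_add, smul_sub, Finset.smul_sum] at this
  rw [← H2.2, ← H3.2, ← H4.2, ← H5.2] at this
  rw [← this, mul_add, add_mul, Finset.mul_sum, Finset.sum_mul]
  congr 1
  refine Finset.sum_congr rfl fun j _ => ?_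
  rw [mul_smul_comm, smul_mul_assoc, (H1 j).2, smul_comm]

/-- Since B and E commute, EXB and BXE have equal traces and only [D, a₀]R⋯[D, a_{m+1}]R survives.
The regularization by E is removed through the approximate unit. -/
theorem trace_boundary (hd : HeatData τ D A q K) (h : HasCommutators M 𝓐 D) (hc0 : 0 < c)
    (hc : c < 1 / 2) (hm : Odd m) (a : Fin (m + 2) → 𝓐) (s : ℝ) {z : ℂ} (hz : 0 < z.re)
    (hq : q - ((m + 1 : ℕ) : ℝ) < z.re - 1) :
    (∑ j : Fin (m + 1), (-1 : ℂ) ^ (j : ℕ) *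
        τ.trace (lineInt D c z (formVec D (Fin.contractNth j.castSucc (· * ·) a)) s)) +
      τ.trace (lineInt D c z (formVec D (Fin.cons (a (Fin.last (m + 1)) * a 0)
        fun i : Fin m => a i.succ.castSucc)) s) =
      τ.trace (lineInt D c z (fun i => comm D (a i)) s) := by
  have hm1 : 1 ≤ m := hm.pos
  have hq2 : q - ((m + 2 : ℕ) : ℝ) < z.re - 1 := by push_cast at hq ⊢; linarith
  have l1 := fun b : Fin (m + 1) → 𝓐 => (hd.lineInt_mem_l1 hc0 hc (show 2 ≤ m + 1 by omega)
    (formVec_mem h b) s hz hq).1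
  have l2 := (hd.lineInt_mem_l1 hc0 hc (show 2 ≤ m + 2 by omega) (formVec_mem h a) s hz hq2).1
  have l3 := (hd.lineInt_mem_l1 hc0 hc (show 2 ≤ m + 2 by omega) (fun i => h.comm_mem (a i)) s hz hq2).1
  have hlast := h.mem (a (Fin.last (m + 1)))
  set Z := (∑ j : Fin (m + 1), (-1 : ℂ) ^ (j : ℕ) •
        lineInt D c z (formVec D (Fin.contractNth j.castSucc (· * ·) a)) s) +
      lineInt D c z (formVec D fun i => a i.castSucc) s * a (Fin.last (m + 1)) with hZ
  have hs : ∀ j ∈ (Finset.univ : Finset (Fin (m + 1))), (-1 : ℂ) ^ (j : ℕ) •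
        lineInt D c z (formVec D (Fin.contractNth j.castSucc (· * ·) a)) s ∈ τ.l1 := fun j _ =>
    Submodule.smul_mem _ _ (l1 _)
  have hZ1 : Z ∈ τ.l1 := Submodule.add_mem _ (Submodule.sum_mem _ hs) (mem_l1_mul (l1 _) hlast)
  have e1 : τ.trace Z = (∑ j : Fin (m + 1), (-1 : ℂ) ^ (j : ℕ) *
        τ.trace (lineInt D c z (formVec D (Fin.contractNth j.castSucc (· * ·) a)) s)) +
      τ.trace (lineInt D c z (formVec D (Fin.cons (a (Fin.last (m + 1)) * a 0)
        fun i : Fin m => a i.succ.castSucc)) s) := by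
    rw [hZ, trace_add (Submodule.sum_mem _ hs) (mem_l1_mul (l1 _) hlast), trace_sum _ hs,
      ← trace_mul_comm (l1 _) hlast]
    congr 1
    · exact Finset.sum_congr rfl fun j _ => trace_smul _ (l1 _)
    · congr 1
      exact (mul_lineInt_cons hd hc0 hc hm1 hz _ _).symm
  have key : ∀ t : ℝ, 0 < t → τ.trace (heat A (t + t) * Z) =
      τ.trace (heat A (t + t) * lineInt D c z (fun i => comm D (a i)) s) := fun t ht => by
    obtain ⟨B, hB, hE1, hE2⟩ := hd.res.exists_heat_graph hd.symm hd.aff t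
    have hE := (hd.semigroup.fin ht).1
    have hBE : B * heat A t = heat A t * B := by
      ext x
      exact hE2 _ _ (hE1 x)
    have hid := conj_boundary_lineInt hd h hc0 hc hm hE1 hE2 a s hz
    rw [← hZ] at hid
    have e2 : ∀ {X : H →L[ℂ] H}, X ∈ τ.l1 → τ.trace (heat A t * X * heat A t) =
        τ.trace (heat A (t + t) * X) := fun {X} hX => by
      rw [← trace_mul_comm (mul_mem_l1 hX hE) hE, ← mul_assoc, hd.semigroup.mul ht ht]
    have e3 := congrArg τ.trace hid
    rw [trace_add (Submodule.sub_mem _ (mem_l1_mul (mul_mem_l1 l2 hE) hB)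
      (mem_l1_mul (mul_mem_l1 l2 hB) hE)) (mem_l1_mul (mul_mem_l1 l3 hE) hE),
      trace_sub (mem_l1_mul (mul_mem_l1 l2 hE) hB) (mem_l1_mul (mul_mem_l1 l2 hB) hE),
      ← trace_mul_comm (mul_mem_l1 l2 hE) hB, ← trace_mul_comm (mul_mem_l1 l2 hB) hE,
      ← mul_assoc, ← mul_assoc, hBE, sub_self, zero_add, e2 hZ1, e2 l3] at e3
    exact e3
  rw [← e1]
  have t1 := tendsto_trace_mul hd.semigroup.approx hZ1
  have t2 := tendsto_trace_mul hd.semigroup.approx l3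
  refine tendsto_nhds_unique t1 (t2.congr fun n => ?_)
  -- Two copies of h(t) are needed around Z, so half the time is used to recover the approximate
  -- unit at time 1/(n+1).
  have := key (1 / ((n : ℝ) + 1) / 2) (half_pos Nat.one_div_pos_of_nat)
  rw [add_halves] at this
  exact this.symm

end

section

open MeasureTheory Filter Topology FNSTrace

variable {H : Type*} [NormedAddCommGroup H] [InnerProductSpace ℂ H] [CompleteSpace H]
variable {M : VonNeumannAlgebra H} {τ : FNSTrace M}
variable {D : H →ₗ.[ℂ] H} {A : H →L[ℂ] H} {c s q K p : ℝ} {n m : ℕ}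
variable {𝓐 : StarSubalgebra ℂ (H →L[ℂ] H)}

/-! ### The resolvent cochain -/

theorem IsSpectralTriple.hasCommutators (h : IsSpectralTriple M τ 𝓐 D) : HasCommutators M 𝓐 D where
  mem := fun a => h.alg_le a a.2
  comm_mem := fun a => isCommutator_mem h.dense h.affiliated (h.alg_le a a.2)
    (isCommutator_comm (h.bounded_comm a a.2))
  isCommutator := fun a => isCommutator_comm (h.bounded_comm a a.2)
  leibniz := fun a b => comm_eq h.dense (isCommutator_mul
    (isCommutator_comm (h.bounded_comm a a.2)) (isCommutator_comm (h.bounded_comm b b.2)))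

/-- The infimum provides k < 2q with (1 + D²)^{-k/2} of finite trace, hence a heat estimate of order
k/2. The order is positive because k ≥ p ≥ 1. -/
theorem IsSpectralTriple.exists_heatData (h : IsSpectralTriple M τ 𝓐 D) (hp : 1 ≤ p)
    (hdim : IsSpectralDimension τ D p) {q : ℝ} (hq : p / 2 < q) :
    ∃ q' < q, ∃ K, HeatData τ D (-resolventOp (sq D) (-1)) q' K := by
  obtain ⟨T, -, hT⟩ := h.compact_resolvent Complex.I (by simp)
  obtain ⟨T', -, hT'⟩ := h.compact_resolvent (-Complex.I) (by simp)
  have hD := isDenseSymm_of_isSelfAdjoint h.dense h.selfAdjoint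
  have hR0 := exists_isSqResolvent_neg_one hT hT'
  have hR : IsSqResolvent D (-1) (-(-resolventOp (sq D) (-1))) := by
    rw [neg_neg, resolventOp_eq hR0]
    exact hR0
  have hA := hR.isInvOneAdd hD
  have hAM : -resolventOp (sq D) (-1) ∈ M := by
    have := hR.mem h.affiliated
    rw [neg_neg] at this
    exact neg_mem this
  obtain ⟨k, hk, hkq⟩ : ∃ k ∈ {k : ℝ | 0 ≤ k ∧ τ.toFun (invPow D k) < ∞}, k < 2 * q := by
    by_contra! hcon
    have := hdim.2 hcon
    linarith
  have hpk : p ≤ k := hdim.1 hk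
  have hk2 : 0 < k / 2 := by linarith
  have hfin : τ.toFun (cfc (fun a : ℝ => a ^ (k / 2)) (-resolventOp (sq D) (-1))) < ∞ := by
    rw [← CFC.rpow_eq_cfc_real hA.nonneg]
    exact hk.2
  exact ⟨k / 2, by linarith, _,
    { symm := hD
      aff := h.affiliated
      inv := hA
      res := hR
      semigroup := isHeatSemigroup_heat hA hAM hk2 hfin
      q_pos := hk2
      K_nonneg := mul_nonneg (Real.rpow_nonneg (by linarith) _) ENNReal.toReal_nonneg
      bound := fun ht => (hA.heat_posFin hAM hk2 hfin ht).2 }⟩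

theorem lineIntegrand_eq (D : H →ₗ.[ℂ] H) (p c : ℝ) (r : ℂ) (a : Fin (m + 1) → 𝓐) (s : ℝ) :
    lineIntegrand D p c r a s = lineFun D c ((p : ℂ) / 2 + r) (formVec D a) s := by
  ext1 v
  rw [lineIntegrand, lineFun, show -((p : ℂ) / 2 + r) = -(p : ℂ) / 2 - r by ring]
  rfl

theorem lineIntegral_eq (D : H →ₗ.[ℂ] H) (p c : ℝ) (r : ℂ) (a : Fin (m + 1) → 𝓐) (s : ℝ) :
    lineIntegral D p c r a s = lineInt D c ((p : ℂ) / 2 + r) (formVec D a) s := by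
  rw [lineIntegral, lineInt, lineIntegrand_eq]

/-- The constant `-√(2πi)`. -/
def constK : ℂ := -(2 * (Real.pi : ℂ) * Complex.I) ^ (1 / 2 : ℂ)

/-- The Gaussian integral cancels the degree-dependent Gamma factor, so cochains of different
degrees share one constant. -/
theorem constC_mul (m : ℕ) : constC m * ((Real.Gamma (((m : ℝ) + 1) / 2) / 2 : ℝ) : ℂ) = constK := by
  have e : (((m : ℂ) + 1) / 2) = ((((m : ℝ) + 1) / 2 : ℝ) : ℂ) := by push_cast; ring
  have hG : (Real.Gamma (((m : ℝ) + 1) / 2) : ℂ) ≠ 0 := by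
    exact_mod_cast (Real.Gamma_pos_of_pos (by positivity)).ne'
  rw [constC, constK, e, Complex.Gamma_ofReal]
  push_cast at hG ⊢
  field_simp

theorem re_add (p : ℝ) (r : ℂ) : ((p : ℂ) / 2 + r).re = p / 2 + r.re := by
  have : (p : ℂ) / 2 = ((p / 2 : ℝ) : ℂ) := by push_cast; ring
  rw [this]; simp

namespace HeatData

theorem phiConverges (hd : HeatData τ D A q K) (h : HasCommutators M 𝓐 D)
    (hc0 : 0 < c) (hc : c < 1 / 2) (hm : 1 ≤ m) {r : ℂ} (hr : 0 < p / 2 + r.re)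
    (hq : q < p / 2 + r.re + ((m : ℝ) - 1) / 2) (a : Fin (m + 1) → 𝓐) : PhiConverges τ D p c r a := by
  have hm' : (1 : ℝ) ≤ m := by exact_mod_cast hm
  refine ⟨fun s _ => ?_, ?_⟩
  · rw [lineIntegrand_eq, lineIntegral_eq]
    exact ⟨integrable_lineFun hd.symm hd.inv hd.res hc0 hc (by omega) s _ (by rwa [re_add]),
      memL1_of_mem_l1 (hd.lineInt_mem_l1 hc0 hc (by omega) (formVec_mem h a) s (by rwa [re_add])
        (by rw [re_add]; push_cast; linarith)).1⟩
  · simp only [lineIntegral_eq]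
    exact (hd.integral_trace_lineInt hc0 hc (by omega) (formVec_mem h a) m (by rwa [re_add])
      (by rw [re_add]; push_cast; linarith)).1

theorem phi_eq (hd : HeatData τ D A q K) (h : HasCommutators M 𝓐 D)
    (hc0 : 0 < c) (hc : c < 1 / 2) (hm : 1 ≤ m) {r : ℂ} (hr : 0 < p / 2 + r.re)
    (hq : q < p / 2 + r.re + ((m : ℝ) - 1) / 2) (a : Fin (m + 1) → 𝓐) :
    phi τ 𝓐 D p c r m a = constK * ((-1) ^ (m + 1) * (Complex.Gamma ((p : ℂ) / 2 + r))⁻¹) *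
      traceInt τ A (formVec D a) ((p : ℂ) / 2 + r - 1 - ((m : ℂ) + 1) / 2) := by
  simp only [phi, lineIntegral_eq]
  rw [(hd.integral_trace_lineInt hc0 hc (by omega) (formVec_mem h a) m (by rwa [re_add])
      (by rw [re_add]; push_cast; linarith)).2, ← constC_mul m]
  ring

/-- Differentiability is stated at a point, on a neighbourhood allowed by q, because q must be taken
closer to p/2 as r approaches the boundary of the half-plane. -/
theorem differentiableAt_phi (hd : HeatData τ D A q K) (h : HasCommutators M 𝓐 D)
    (hc0 : 0 < c) (hc : c < 1 / 2) (hm : 1 ≤ m) {r : ℂ} (hr : 0 < p / 2 + r.re)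
    (hq : q < p / 2 + r.re + ((m : ℝ) - 1) / 2) (a : Fin (m + 1) → 𝓐) :
    DifferentiableAt ℂ (fun r => phi τ 𝓐 D p c r m a) r := by
  set U : Set ℂ := {r : ℂ | -(p / 2) < r.re} ∩ {r : ℂ | q - (p / 2 + ((m : ℝ) - 1) / 2) < r.re} with hU
  have hUo : IsOpen U := (isOpen_re_gt _).inter (isOpen_re_gt _)
  have hrU : r ∈ U := ⟨show -(p / 2) < r.re by linarith,
    show q - (p / 2 + ((m : ℝ) - 1) / 2) < r.re by linarith⟩
  have hfo : DifferentiableOn ℂ (fun r => phi τ 𝓐 D p c r m a) U := by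
    have h1 := hd.differentiableOn_traceInt (n := m + 1) (by omega) (formVec_mem h a)
    have h2 : DifferentiableOn ℂ (fun r : ℂ => traceInt τ A (formVec D a)
        ((p : ℂ) / 2 + r - 1 - ((m : ℂ) + 1) / 2)) U :=
      h1.comp (f := fun r : ℂ => (p : ℂ) / 2 + r - 1 - ((m : ℂ) + 1) / 2) (by fun_prop) fun r hr => by
        have e : ((p : ℂ) / 2 + r - 1 - ((m : ℂ) + 1) / 2) =
            r + ((p / 2 - 1 - ((m : ℝ) + 1) / 2 : ℝ) : ℂ) := by push_cast; ring
        have h3 : q - (p / 2 + ((m : ℝ) - 1) / 2) < r.re := hr.2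
        change q - ((m + 1 : ℕ) : ℝ) < ((p : ℂ) / 2 + r - 1 - ((m : ℂ) + 1) / 2).re
        rw [e, Complex.add_re, Complex.ofReal_re]
        push_cast
        linarith
    have h3 : DifferentiableOn ℂ (fun r : ℂ => constK * ((-1) ^ (m + 1) *
        (Complex.Gamma ((p : ℂ) / 2 + r))⁻¹)) U :=
      (((Complex.differentiable_one_div_Gamma.comp (f := fun r : ℂ => (p : ℂ) / 2 + r)
        (by fun_prop)).const_mul _).const_mul _).differentiableOn
    refine (h3.mul h2).congr fun r hr => ?_
    have h4 : -(p / 2) < r.re := hr.1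
    have h5 : q - (p / 2 + ((m : ℝ) - 1) / 2) < r.re := hr.2
    exact hd.phi_eq h hc0 hc hm (by linarith) (by linarith) a
  exact hfo.differentiableAt (hUo.mem_nhds hrU)

/-- For odd m all signs of B are +1. Degree m + 2 lowers the exponent of σ by one more than degree
m, and the factor σ from the cyclic sum restores it. -/
theorem opB_phi (hd : HeatData τ D A q K) (h : HasCommutators M 𝓐 D)
    (hc0 : 0 < c) (hc : c < 1 / 2) (hm : Odd m) {r : ℂ} (hr : 0 < p / 2 + r.re)
    (hq : q < p / 2 + r.re + ((m : ℝ) + 1) / 2) (a : Fin (m + 2) → 𝓐) :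
    opB (phi τ 𝓐 D p c r (m + 2)) a = constK * (Complex.Gamma ((p : ℂ) / 2 + r))⁻¹ *
      traceInt τ A (fun i => comm D (a i)) ((p : ℂ) / 2 + r - 1 - ((m : ℂ) + 1) / 2) := by
  have hm2 : Even (m + 1) := hm.add_one
  have hsg : (-1 : ℂ) ^ (m + 2 + 1) = 1 := (hm2.add even_two).neg_one_pow
  have e1 : ∀ j : Fin (m + 2), formVec D (Fin.cons 1 fun i => a (j + i) : Fin (m + 3) → 𝓐) =
      Fin.cons 1 fun i => comm D (a (j + i) : H →L[ℂ] H) := fun j => rfl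
  have e2 : ((p : ℂ) / 2 + r - 1 - (((m + 2 : ℕ) : ℂ) + 1) / 2) + 1 =
      (p : ℂ) / 2 + r - 1 - ((m : ℂ) + 1) / 2 := by push_cast; ring
  have e3 : ((p : ℂ) / 2 + r - 1 - (((m + 2 : ℕ) : ℂ) + 1) / 2) =
      r + ((p / 2 - 1 - ((m : ℝ) + 3) / 2 : ℝ) : ℂ) := by push_cast; ring
  have hs := hd.sum_traceInt_cons_one (k := m + 1) (fun i => h.comm_mem (a i))
    (w := (p : ℂ) / 2 + r - 1 - (((m + 2 : ℕ) : ℂ) + 1) / 2) (by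
      rw [e3, Complex.add_re, Complex.ofReal_re]; push_cast; linarith)
  rw [e2] at hs
  rw [opB, ← hs, Finset.mul_sum]
  refine Finset.sum_congr rfl fun j _ => ?_
  rw [hd.phi_eq h hc0 hc (by omega) hr (by push_cast; linarith), e1, pow_mul, hm2.neg_one_pow, one_pow,
    hsg, one_mul, one_mul]

/-- The weight s^m is kept while the boundary has m + 2 resolvents, so the exponent agrees with
`opB_phi`. The sign (-1)^{m+2} = -1 makes the two cancel. -/
theorem opb_phi (hd : HeatData τ D A q K) (h : HasCommutators M 𝓐 D)
    (hc0 : 0 < c) (hc : c < 1 / 2) (hm : Odd m) {r : ℂ} (hr : 0 < p / 2 + r.re)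
    (hq : q < p / 2 + r.re + ((m : ℝ) - 1) / 2) (a : Fin (m + 2) → 𝓐) :
    opb (phi τ 𝓐 D p c r m) a = -(constK * (Complex.Gamma ((p : ℂ) / 2 + r))⁻¹ *
      traceInt τ A (fun i => comm D (a i)) ((p : ℂ) / 2 + r - 1 - ((m : ℂ) + 1) / 2)) := by
  have hm1 : 1 ≤ m := hm.pos
  have hm' : (1 : ℝ) ≤ m := by exact_mod_cast hm1
  have hr' : 0 < ((p : ℂ) / 2 + r).re := by rwa [re_add]
  have hi := fun b : Fin (m + 1) → 𝓐 => (hd.integral_trace_lineInt hc0 hc (by omega)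
    (formVec_mem h b) m hr' (by rw [re_add]; push_cast; linarith)).1
  have e1 := (hd.integral_trace_lineInt hc0 hc (show 2 ≤ m + 2 by omega)
    (fun i => h.comm_mem (a i)) m hr' (by rw [re_add]; push_cast; linarith)).2
  have hsum : opb (phi τ 𝓐 D p c r m) a = constC m * ∫ s in Set.Ioi (0 : ℝ), (s : ℂ) ^ m *
      τ.trace (lineInt D c ((p : ℂ) / 2 + r) (fun i => comm D (a i : H →L[ℂ] H)) s) := by
    simp only [opb, phi, lineIntegral_eq]
    rw [(show Even (m + 1) from hm.add_one).neg_one_pow, one_mul]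
    simp only [mul_left_comm _ (constC m)]
    rw [← Finset.mul_sum, ← mul_add]
    congr 1
    simp only [← integral_const_mul]
    rw [← integral_finsetSum _ fun j _ => (hi _).const_mul _,
      ← integral_add (integrable_finsetSum _ fun j _ => (hi _).const_mul _) (hi _)]
    refine integral_congr_ae (Eventually.of_forall fun s => ?_)
    beta_reduce
    rw [← trace_boundary hd h hc0 hc hm a s hr' (by rw [re_add]; push_cast; linarith), mul_add,
      Finset.mul_sum]
    congr 1
    exact Finset.sum_congr rfl fun j _ => mul_left_comm _ _ _
  have hsg : (-1 : ℂ) ^ (m + 2) = -1 := (hm.add_even even_two).neg_one_pow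
  rw [hsum, e1, hsg, ← constC_mul m]
  ring

/-- With E = h(t/2) and B = DE, E[D, a]E = BaE - EaB. The two terms have equal traces because B and
E commute. -/
theorem trace_comm_mul_heat (hd : HeatData τ D A q K) (h : HasCommutators M 𝓐 D) (a : 𝓐) {t : ℝ}
    (ht : 0 < t) : τ.trace (comm D (a : H →L[ℂ] H) * heat A t) = 0 := by
  have ht2 := half_pos ht
  obtain ⟨B, hB, hE1, hE2⟩ := hd.res.exists_heat_graph hd.symm hd.aff (t / 2)
  have hEf := hd.semigroup.fin ht2
  have hEE : heat A (t / 2) * heat A (t / 2) = heat A t := by rw [hd.semigroup.mul ht2 ht2, add_halves]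
  generalize heat A (t / 2) = E at hE1 hE2 hEf hEE
  have hE := posFin_subset_l1 hEf
  have hBE : B * E = E * B := by
    ext x
    exact hE2 _ _ (hE1 x)
  have key : E * comm D (a : H →L[ℂ] H) * E = B * (a * E) - E * (a * B) := by
    ext x
    have := hE2 _ _ (isCommutator_graph (h.isCommutator a) (hE1 x))
    change E (comm D (a : H →L[ℂ] H) (E x)) = B ((a : H →L[ℂ] H) (E x)) - E ((a : H →L[ℂ] H) (B x))
    rw [this, _root_.map_add, add_sub_cancel_left]
  have haE := mul_mem_l1 hE (h.mem a)
  have haB := mul_mem (h.mem a) hB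
  rw [← hEE, ← mul_assoc, ← trace_mul_comm (mul_mem_l1 hE (h.comm_mem a)) hEf.1, ← mul_assoc, key,
    trace_sub (mul_mem_l1 haE hB) (mem_l1_mul hE haB), trace_mul_comm haE hB, ← trace_mul_comm hE haB,
    mul_assoc, mul_assoc, hBE, sub_self]

theorem opB_phi_one (hd : HeatData τ D A q K) (h : HasCommutators M 𝓐 D)
    (hc0 : 0 < c) (hc : c < 1 / 2) {r : ℂ} (hr : 0 < p / 2 + r.re) (hq : q < p / 2 + r.re)
    (a : Fin 1 → 𝓐) : opB (phi τ 𝓐 D p c r 1) a = 0 := by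
  have e3 : ((p : ℂ) / 2 + r - 1 - (((1 : ℕ) : ℂ) + 1) / 2) =
      r + ((p / 2 - 2 : ℝ) : ℂ) := by push_cast; ring
  have hs := hd.sum_traceInt_cons_one (k := 0) (fun i => h.comm_mem (a i))
    (w := (p : ℂ) / 2 + r - 1 - (((1 : ℕ) : ℂ) + 1) / 2) (by
      rw [e3, Complex.add_re, Complex.ofReal_re]; push_cast; linarith)
  have h0 : ∀ w, traceInt τ A (fun i => comm D (a i : H →L[ℂ] H)) w = 0 := fun w => by
    refine integral_eq_zero_of_ae ?_
    filter_upwards [ae_orthant_pos 1] with t ht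
    have e : heatProd (heat A) (fun i => comm D (a i : H →L[ℂ] H)) t =
        comm D (a 0 : H →L[ℂ] H) * heat A (t 0) := by simp [heatProd]
    rw [e, hd.trace_comm_mul_heat h (a 0) (ht 0), mul_zero]
    rfl
  rw [h0, Fin.sum_univ_one] at hs
  have e1 : formVec D (Fin.cons 1 fun i => a (0 + i) : Fin 2 → 𝓐) =
      Fin.cons 1 fun i => comm D (a (0 + i) : H →L[ℂ] H) := rfl
  rw [opB, Fin.sum_univ_one, hd.phi_eq h hc0 hc le_rfl hr (by push_cast; linarith), e1, hs, mul_zero,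
    mul_zero]

/-- There are m + 2 heat operators instead of m + 1, which moves the boundary of the half-plane one
unit to the left of that of the cochain. The factor 1/Γ is entire. -/
theorem differentiableOn_cocycle (hd : HeatData τ D A q K) (h : HasCommutators M 𝓐 D)
    (a : Fin (m + 2) → 𝓐) :
    DifferentiableOn ℂ (fun r : ℂ => -(constK * (Complex.Gamma ((p : ℂ) / 2 + r))⁻¹ *
      traceInt τ A (fun i => comm D (a i)) ((p : ℂ) / 2 + r - 1 - ((m : ℂ) + 1) / 2)))
      {r : ℂ | q - p / 2 - ((m : ℝ) + 1) / 2 < r.re} := by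
  have h1 := hd.differentiableOn_traceInt (n := m + 2) (by omega) fun i => h.comm_mem (a i)
  have h2 : DifferentiableOn ℂ (fun r : ℂ => traceInt τ A (fun i => comm D (a i))
      ((p : ℂ) / 2 + r - 1 - ((m : ℂ) + 1) / 2)) {r : ℂ | q - p / 2 - ((m : ℝ) + 1) / 2 < r.re} :=
    h1.comp (f := fun r : ℂ => (p : ℂ) / 2 + r - 1 - ((m : ℂ) + 1) / 2) (by fun_prop) fun r hr => by
      have e : ((p : ℂ) / 2 + r - 1 - ((m : ℂ) + 1) / 2) =
          r + ((p / 2 - 1 - ((m : ℝ) + 1) / 2 : ℝ) : ℂ) := by push_cast; ring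
      have h3 : q - p / 2 - ((m : ℝ) + 1) / 2 < r.re := hr
      change q - ((m + 2 : ℕ) : ℝ) < ((p : ℂ) / 2 + r - 1 - ((m : ℂ) + 1) / 2).re
      rw [e, Complex.add_re, Complex.ofReal_re]
      push_cast
      linarith
  have h3 : Differentiable ℂ fun r : ℂ => constK * (Complex.Gamma ((p : ℂ) / 2 + r))⁻¹ :=
    (Complex.differentiable_one_div_Gamma.comp (f := fun r : ℂ => (p : ℂ) / 2 + r)
      (by fun_prop)).const_mul _
  exact (h3.differentiableOn.mul h2).neg

end HeatData

end

end ResolventCocycle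

end

/-! ### The theorem -/

open ResolventCocycle in
theorem proposition7 {H : Type*} [NormedAddCommGroup H] [InnerProductSpace ℂ H] [CompleteSpace H]
    (M : VonNeumannAlgebra H) (τ : FNSTrace M) (𝓐 : StarSubalgebra ℂ (H →L[ℂ] H))
    (D : H →ₗ.[ℂ] H) (hD : IsSpectralTriple M τ 𝓐 D) (hQC : IsQCInfty 𝓐 D)
    (p : ℝ) (hp : 1 ≤ p) (hdim : IsSpectralDimension τ D p)
    (c : ℝ) (hc₀ : 0 < c) (hc : c < 1 / 2) (N : ℕ) (hN : N = ⌊p / 2⌋₊ + 1) :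
    (∀ m : ℕ, Odd m → m ≤ 2 * N - 1 → ∀ a : Fin (m + 1) → 𝓐,
      (∀ r : ℂ, (1 - (m : ℝ)) / 2 < r.re → PhiConverges τ D p c r a) ∧
      DifferentiableOn ℂ (fun r : ℂ => phi τ 𝓐 D p c r m a)
        {r : ℂ | (1 - (m : ℝ)) / 2 < r.re}) ∧
    (∀ m : ℕ, Odd m → m + 2 ≤ 2 * N - 1 → ∀ r : ℂ, (1 - (m : ℝ)) / 2 < r.re →
      ∀ a : Fin (m + 2) → 𝓐,
        opB (phi τ 𝓐 D p c r (m + 2)) a + opb (phi τ 𝓐 D p c r m) a = 0) ∧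
    (∀ r : ℂ, 0 < r.re → ∀ a : Fin 1 → 𝓐, opB (phi τ 𝓐 D p c r 1) a = 0) ∧
    (∃ δ' : ℝ, 0 < δ' ∧ δ' < 1 ∧ ∀ a : Fin (2 * N - 1 + 2) → 𝓐,
      ∃ F : ℂ → ℂ, DifferentiableOn ℂ F {r : ℂ | -p / 2 + δ' / 2 < r.re} ∧
        ∀ r : ℂ, -p / 2 + δ' / 2 < r.re → 1 - (N : ℝ) < r.re →
          opb (phi τ 𝓐 D p c r (2 * N - 1)) a = F r) := by
  have h := hD.hasCommutators
  have hfl := Nat.floor_le (show 0 ≤ p / 2 by linarith)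
  have hfu := Nat.lt_floor_add_one (p / 2)
  have hNr : (N : ℝ) = (⌊p / 2⌋₊ : ℝ) + 1 := by rw [hN]; push_cast; ring
  have hN1 : 1 ≤ N := by omega
  have hm : ∀ m : ℕ, m ≤ 2 * N - 1 → (m : ℝ) ≤ 2 * N - 1 := fun m hm => by
    have : m + 1 ≤ 2 * N := by omega
    have : ((m + 1 : ℕ) : ℝ) ≤ ((2 * N : ℕ) : ℝ) := by exact_mod_cast this
    push_cast at this
    linarith
  refine ⟨fun m hmo hmN a => ?_, fun m hmo hmN r hr a => ?_, fun r hr a => ?_,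
    -- Any δ' in (0, 1) works, since the continuation exists on a half-plane containing Re r ≥ -p/2.
    1 / 2, by norm_num, by norm_num, fun a => ?_⟩
  · have hmr := hm m hmN
    -- From m ≤ 2N - 1 it follows that (1 - m)/2 ≥ 1 - N = -⌊p/2⌋ ≥ -p/2, so p/2 + r has positive
    -- real part on the whole half-plane.
    have hdata : ∀ r : ℂ, (1 - (m : ℝ)) / 2 < r.re → 0 < p / 2 + r.re ∧
        ∃ q < p / 2 + r.re + ((m : ℝ) - 1) / 2, ∃ K, HeatData τ D (-resolventOp (sq D) (-1)) q K :=
      fun r hr => ⟨by linarith, hD.exists_heatData hp hdim (by linarith)⟩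
    refine ⟨fun r hr => ?_, fun r hr => ?_⟩
    · obtain ⟨h1, q, hq, K, hd⟩ := hdata r hr
      exact hd.phiConverges h hc₀ hc hmo.pos h1 hq a
    · obtain ⟨h1, q, hq, K, hd⟩ := hdata r hr
      exact (hd.differentiableAt_phi h hc₀ hc hmo.pos h1 hq a).differentiableWithinAt
  · have hmr := hm _ hmN
    push_cast at hmr
    obtain ⟨q, hq, K, hd⟩ := hD.exists_heatData hp hdim
      (show p / 2 < p / 2 + r.re + ((m : ℝ) - 1) / 2 by linarith)
    rw [hd.opB_phi h hc₀ hc hmo (by linarith) (by linarith),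
      hd.opb_phi h hc₀ hc hmo (by linarith) hq, add_neg_cancel]
  · obtain ⟨q, hq, K, hd⟩ := hD.exists_heatData hp hdim (show p / 2 < p / 2 + r.re by linarith)
    exact hd.opB_phi_one h hc₀ hc (by linarith) hq a
  · have hcast : ((2 * N - 1 : ℕ) : ℝ) = 2 * N - 1 := by
      rw [Nat.cast_sub (by omega)]; push_cast; ring
    have hodd : Odd (2 * N - 1) := ⟨N - 1, by omega⟩
    -- N = ⌊p/2⌋ + 1 exceeds p/2, so some order q < N is available; the boundary q - p/2 - N then
    -- lies to the left of -p/2.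
    obtain ⟨q, hq, K, hd⟩ := hD.exists_heatData hp hdim (show p / 2 < N by linarith)
    refine ⟨_, (hd.differentiableOn_cocycle (p := p) h a).mono fun r hr => ?_, fun r hr1 hr2 => ?_⟩
    · have hr : -p / 2 + 1 / 2 / 2 < r.re := hr
      change q - p / 2 - (((2 * N - 1 : ℕ) : ℝ) + 1) / 2 < r.re
      rw [hcast]
      linarith
    -- The order q' depends on r and only justifies the formula at that point. The formula itself
    -- involves no order, so it agrees with the function obtained from the fixed q.
    · obtain ⟨q', hq', K', hd'⟩ := hD.exists_heatData hp hdim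
        (show p / 2 < p / 2 + r.re + (((2 * N - 1 : ℕ) : ℝ) - 1) / 2 by rw [hcast]; linarith)
      exact hd'.opb_phi h hc₀ hc hodd (by linarith) hq' a
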